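/- Let $G\rightrightarrows Q$ be a Lie groupoid (finite-dimensional smooth Hausdorff manifolds) with source $\alpha$, target $\beta$, identity section $\varepsilon:Q\to G$ and left translations $l_g:\alpha^{-1}(\beta(g))\to\alpha^{-1}(\alpha(g))$. Let $\tau:AG\to Q$ be its Lie algebroid, with fibres $A_qG=\ker T_{\varepsilon(q)}\alpha$ and anchor $\rho=T\beta|_{AG}$, let $\tilde\tau:V\alpha=\ker T\alpha\to G$ be the vertical bundle of $\alpha$, let $\iota:AG\to V\alpha$ be the inclusion over $\varepsilon$, and let $\Psi:V\alpha\to AG$, $\Psi(v_g)=Tl_{g^{-1}}(v_g)$. Let $\Gamma$ be a homogeneous quadratic SODE on $AG$, that is, a smooth vector field on $AG$ with $T_a\tau(\Gamma(a))=\rho(a)$ for all $a\in AG$ and $[\Delta,\Gamma]=\Gamma$, where $\Delta$ is the Euler vector field of $AG$ (with flow $(t,a)\mapsto e^ta$). Then there is a unique SODE $\tilde\Gamma$ on $V\alpha$ (a smooth vector field with $T\tilde\tau(\tilde\Gamma(v))=v$ for all $v \in V\alpha$) that is $\Psi$-related to $\Gamma$, that is, $T\Psi\circ\tilde\Gamma=\Gamma\circ\Psi$.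 Let $D\subseteq AG$ be the set of those $v$ for which the integral curve of $\tilde\Gamma$ starting at $\iota(v)$ is defined on $[0,1]$, and let $\exp^\Gamma:D\to G$, $\exp^\Gamma(v)=\tilde\tau(\Phi^{\tilde\Gamma}_1(\iota(v)))$, where $\Phi^{\tilde\Gamma}$ is the flow of $\tilde\Gamma$. Then: 1. $D$ is open, contains the zero section, and is star-shaped: $tv\in D$ for $v\in D$ and $t\in[0,1]$. 2. $\exp^\Gamma(0_q)=\varepsilon(q)$ for every $q\in Q$. 3. $\exp^\Gamma(tv)=\sigma_v(t)$ for every $v\in D$ and $t\in[0,1]$, where $\sigma_v:[0,1]\to G$ is the trajectory of $\tilde\Gamma$ with initial velocity $v$, i.e. the projection by $\tilde\tau$ of the integral curve of $\tilde\Gamma$ starting at $\iota(v)$. 4. For every $q\in Q$ the maps $T_qQ\times A_qG\to T_{0_q}AG$, $(u,v)\mapsto (T_q0)(u)+\frac{d}{dt}\big|_{t=0}(tv)$, and $T_qQ\times A_qG\to T_{\varepsilon(q)}G$, $(u,v)\mapsto (T_q\varepsilon)(u)+v$, are bijective, $\exp^\Gamma$ is differentiable at $0_q$, and under these identifications $T_{0_q}\exp^\Gamma$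 is the identity map, i.e. $T_{0_q}\exp^\Gamma\big((T_q0)(u)+\frac{d}{dt}\big|_{t=0}(tv)\big)=(T_q\varepsilon)(u)+v$ for all $u \in T_qQ$ and $v\in A_qG$. -/

import Mathlib

open Set Filter Topology Bundle
open scoped Manifold ContDiff

/-! ### The vertical bundle of a submersion, pulled back along a smooth map -/

section VerticalBundle

set_option linter.unusedSectionVars false

/-- A smooth submersion `proj : M → N` together with a smooth map `base : Z → M`. -/
structure VertData (EZ : Type*) [NormedAddCommGroup EZ] [NormedSpace ℝ EZ]
    (Z : Type*) [TopologicalSpace Z] [ChartedSpace EZ Z]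
    (EM : Type*) [NormedAddCommGroup EM] [NormedSpace ℝ EM]
    (M : Type*) [TopologicalSpace M] [ChartedSpace EM M]
    (EN : Type*) [NormedAddCommGroup EN] [NormedSpace ℝ EN]
    (N : Type*) [TopologicalSpace N] [ChartedSpace EN N] where
  base : Z → M
  proj : M → N
  contMDiff_base : ContMDiff 𝓘(ℝ, EZ) 𝓘(ℝ, EM) ∞ base
  contMDiff_proj : ContMDiff 𝓘(ℝ, EM) 𝓘(ℝ, EN) ∞ proj
  surjective_mfderiv : ∀ x : M, Function.Surjective (mfderiv 𝓘(ℝ, EM) 𝓘(ℝ, EN) proj x)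

/-- The model fibre: a Euclidean space of dimension `dim M - dim N`. -/
abbrev VertModel (EM EN : Type*) [NormedAddCommGroup EM] [NormedSpace ℝ EM]
    [NormedAddCommGroup EN] [NormedSpace ℝ EN] : Type :=
  EuclideanSpace ℝ (Fin (Module.finrank ℝ EM - Module.finrank ℝ EN))

theorem exists_complementary_map {EM EN : Type*} [NormedAddCommGroup EM] [NormedSpace ℝ EM]
    [FiniteDimensional ℝ EM] [NormedAddCommGroup EN] [NormedSpace ℝ EN] [FiniteDimensional ℝ EN]
    (A : EM →L[ℝ] EN) (hA : Function.Surjective A) :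
    ∃ P : EM →L[ℝ] VertModel EM EN, (A.prod P).IsInvertible := by
  have hr : Module.finrank ℝ EN + Module.finrank ℝ (LinearMap.ker A.toLinearMap)
      = Module.finrank ℝ EM := by
    have h := LinearMap.finrank_range_add_finrank_ker A.toLinearMap
    rwa [LinearMap.range_eq_top.2 hA, finrank_top] at h
  have hd : Module.finrank ℝ (LinearMap.ker A.toLinearMap)
      = Module.finrank ℝ (VertModel EM EN) := by
    rw [finrank_euclideanSpace_fin]; omega
  obtain ⟨p, hp⟩ := LinearMap.exists_leftInverse_of_injective
    (LinearMap.ker A.toLinearMap).subtype (Submodule.ker_subtype _)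
  let e := LinearEquiv.ofFinrankEq _ _ hd
  let P : EM →ₗ[ℝ] VertModel EM EN := e.toLinearMap ∘ₗ p
  let B : EM →ₗ[ℝ] EN × VertModel EM EN := A.toLinearMap.prod P
  have hinj : Function.Injective B := by
    rw [← LinearMap.ker_eq_bot, LinearMap.ker_eq_bot']
    intro x hx
    have h1 : A x = 0 := congrArg Prod.fst hx
    have h2 : e (p x) = 0 := congrArg Prod.snd hx
    have h3 : p x = 0 := by simpa using h2
    have h4 : p x = ⟨x, h1⟩ := by simpa using LinearMap.congr_fun hp ⟨x, h1⟩
    simpa [h3] using (congrArg Subtype.val h4).symm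
  have hdim : Module.finrank ℝ EM = Module.finrank ℝ (EN × VertModel EM EN) := by
    rw [Module.finrank_prod, ← hd, hr]
  refine ⟨P.toContinuousLinearMap,
    (LinearEquiv.ofInjectiveOfFinrankEq B hinj hdim).toContinuousLinearEquiv, ?_⟩
  ext x <;> rfl

namespace VertData

variable {EZ : Type*} [NormedAddCommGroup EZ] [NormedSpace ℝ EZ]
  {Z : Type*} [TopologicalSpace Z] [ChartedSpace EZ Z]
  {EM : Type*} [NormedAddCommGroup EM] [NormedSpace ℝ EM]
  {M : Type*} [TopologicalSpace M] [ChartedSpace EM M]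
  {EN : Type*} [NormedAddCommGroup EN] [NormedSpace ℝ EN]
  {N : Type*} [TopologicalSpace N] [ChartedSpace EN N]
  (S : VertData EZ Z EM M EN N)

/-- The fibre over `z` of the pull-back along `base : Z → M` of the vertical bundle of
`proj : M → N`: the subspace `ker (T proj)` of the tangent space of `M` at `base z`. -/
def Fiber (z : Z) : Type _ :=
  LinearMap.ker (mfderiv 𝓘(ℝ, EM) 𝓘(ℝ, EN) S.proj (S.base z)).toLinearMap

noncomputable instance (z : Z) : AddCommGroup (S.Fiber z) :=
  inferInstanceAs (AddCommGroup (LinearMap.ker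
    (mfderiv 𝓘(ℝ, EM) 𝓘(ℝ, EN) S.proj (S.base z)).toLinearMap))

noncomputable instance (z : Z) : Module ℝ (S.Fiber z) :=
  inferInstanceAs (Module ℝ (LinearMap.ker
    (mfderiv 𝓘(ℝ, EM) 𝓘(ℝ, EN) S.proj (S.base z)).toLinearMap))

instance (z : Z) : TopologicalSpace (S.Fiber z) :=
  inferInstanceAs (TopologicalSpace (LinearMap.ker
    (mfderiv 𝓘(ℝ, EM) 𝓘(ℝ, EN) S.proj (S.base z)).toLinearMap))

/-- The inclusion of the fibre into the tangent space. -/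
noncomputable def fiberIncl (z : Z) : S.Fiber z →L[ℝ] TangentSpace 𝓘(ℝ, EM) (S.base z) :=
  (LinearMap.ker (mfderiv 𝓘(ℝ, EM) 𝓘(ℝ, EN) S.proj (S.base z)).toLinearMap).subtypeL

theorem fiberIncl_injective (z : Z) : Function.Injective (S.fiberIncl z) :=
  Subtype.val_injective

theorem mfderiv_fiberIncl (z : Z) (v : S.Fiber z) :
    mfderiv 𝓘(ℝ, EM) 𝓘(ℝ, EN) S.proj (S.base z) (S.fiberIncl z v) = 0 :=
  v.2

/-- The submersion read in the charts centred at `base z₀` and at its image. -/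
noncomputable def localRep (z₀ : Z) : EM → EN :=
  extChartAt 𝓘(ℝ, EN) (S.proj (S.base z₀)) ∘ S.proj ∘ (extChartAt 𝓘(ℝ, EM) (S.base z₀)).symm

/-- The differential of the submersion at `base z`, in the charts centred at `z₀`. -/
noncomputable def localDeriv (z₀ z : Z) : EM →L[ℝ] EN :=
  fderiv ℝ (S.localRep z₀) (extChartAt 𝓘(ℝ, EM) (S.base z₀) (S.base z))

/-- The differential at `base z` of the chart centred at `base z₀`. -/
noncomputable def chartDeriv (z₀ z : Z) : TangentSpace 𝓘(ℝ, EM) (S.base z) →L[ℝ] EM :=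
  mfderiv 𝓘(ℝ, EM) 𝓘(ℝ, EM) (extChartAt 𝓘(ℝ, EM) (S.base z₀)) (S.base z)

/-- The points `z` for which `base z` and its image lie in the charts centred at `z₀`. -/
def chartSet (z₀ : Z) : Set Z :=
  S.base ⁻¹' ((extChartAt 𝓘(ℝ, EM) (S.base z₀)).source ∩
    S.proj ⁻¹' (extChartAt 𝓘(ℝ, EN) (S.proj (S.base z₀))).source)

theorem isOpen_chartSet (z₀ : Z) : IsOpen (S.chartSet z₀) :=
  ((isOpen_extChartAt_source _).inter ((isOpen_extChartAt_source _).preimage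
    S.contMDiff_proj.continuous)).preimage S.contMDiff_base.continuous

variable [IsManifold 𝓘(ℝ, EM) ∞ M] [IsManifold 𝓘(ℝ, EN) ∞ N]

theorem contDiffAt_localRep {z₀ z : Z} (hz : z ∈ S.chartSet z₀) :
    ContDiffAt ℝ ∞ (S.localRep z₀) (extChartAt 𝓘(ℝ, EM) (S.base z₀) (S.base z)) := by
  rw [← contMDiffAt_iff_contDiffAt]
  have h1 := (extChartAt 𝓘(ℝ, EM) (S.base z₀)).left_inv hz.1
  refine ContMDiffAt.comp (I' := 𝓘(ℝ, EN)) _ ?_ (ContMDiffAt.comp (I' := 𝓘(ℝ, EM)) _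
    S.contMDiff_proj.contMDiffAt ?_)
  · simp only [Function.comp_apply, h1]
    exact contMDiffAt_extChartAt' (by simpa using hz.2)
  · exact (contMDiffOn_extChartAt_symm _).contMDiffAt
      ((isOpen_extChartAt_target _).mem_nhds ((extChartAt _ _).map_source hz.1))

theorem chartDeriv_isInvertible {z₀ z : Z} (hz : z ∈ S.chartSet z₀) :
    (S.chartDeriv z₀ z).IsInvertible :=
  isInvertible_mfderiv_extChartAt hz.1

/-- The chain rule for the local representative. -/
theorem localDeriv_chartDeriv {z₀ z : Z} (hz : z ∈ S.chartSet z₀)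
    (v : TangentSpace 𝓘(ℝ, EM) (S.base z)) :
    S.localDeriv z₀ z (S.chartDeriv z₀ z v) =
      mfderiv 𝓘(ℝ, EN) 𝓘(ℝ, EN) (extChartAt 𝓘(ℝ, EN) (S.proj (S.base z₀))) (S.proj (S.base z))
        (mfderiv 𝓘(ℝ, EM) 𝓘(ℝ, EN) S.proj (S.base z) v) := by
  have hc : HasMFDerivAt 𝓘(ℝ, EM) 𝓘(ℝ, EM) (extChartAt 𝓘(ℝ, EM) (S.base z₀)) (S.base z)
      (S.chartDeriv z₀ z) :=
    (mdifferentiableAt_extChartAt (by simpa using hz.1)).hasMFDerivAt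
  have hl : HasMFDerivAt 𝓘(ℝ, EM) 𝓘(ℝ, EN) (S.localRep z₀)
      (extChartAt 𝓘(ℝ, EM) (S.base z₀) (S.base z)) (S.localDeriv z₀ z) :=
    ((S.contDiffAt_localRep hz).differentiableAt (by simp)).hasFDerivAt.hasMFDerivAt
  have h1 := HasMFDerivAt.comp (S.base z) hl hc
  have hn : HasMFDerivAt 𝓘(ℝ, EN) 𝓘(ℝ, EN) (extChartAt 𝓘(ℝ, EN) (S.proj (S.base z₀)))
      (S.proj (S.base z)) _ :=
    (mdifferentiableAt_extChartAt (by simpa using hz.2)).hasMFDerivAt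
  have hp : HasMFDerivAt 𝓘(ℝ, EM) 𝓘(ℝ, EN) S.proj (S.base z) _ :=
    (S.contMDiff_proj.mdifferentiableAt (by simp)).hasMFDerivAt
  have h2 := HasMFDerivAt.comp (S.base z) hn hp
  have heq : S.localRep z₀ ∘ extChartAt 𝓘(ℝ, EM) (S.base z₀) =ᶠ[𝓝 (S.base z)]
      extChartAt 𝓘(ℝ, EN) (S.proj (S.base z₀)) ∘ S.proj := by
    filter_upwards [(isOpen_extChartAt_source (I := 𝓘(ℝ, EM)) (S.base z₀)).mem_nhds hz.1]
      with x hx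
    simp only [localRep, Function.comp_apply, (extChartAt 𝓘(ℝ, EM) (S.base z₀)).left_inv hx]
  have h3 := h1.mfderiv.symm.trans (heq.mfderiv_eq.trans h2.mfderiv)
  exact congrArg (fun L => L v) h3

variable [FiniteDimensional ℝ EM] [FiniteDimensional ℝ EN]

theorem localDeriv_surjective {z₀ z : Z} (hz : z ∈ S.chartSet z₀) :
    Function.Surjective (S.localDeriv z₀ z) := by
  intro y
  obtain ⟨D, hD⟩ := isInvertible_mfderiv_extChartAt (I := 𝓘(ℝ, EN)) hz.2
  obtain ⟨v, hv⟩ := S.surjective_mfderiv (S.base z) (D.symm y)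
  refine ⟨S.chartDeriv z₀ z v, ?_⟩
  rw [S.localDeriv_chartDeriv hz, hv, ← hD]
  exact D.apply_symm_apply y

theorem mem_chartSet (z₀ : Z) : z₀ ∈ S.chartSet z₀ :=
  ⟨mem_extChartAt_source _, mem_extChartAt_source _⟩

/-- A linear map whose restriction to the vertical space at `z₀` is an isomorphism. -/
noncomputable def compl (z₀ : Z) : EM →L[ℝ] VertModel EM EN :=
  (exists_complementary_map _ (S.localDeriv_surjective (S.mem_chartSet z₀))).choose

/-- The isomorphism (for `z` near `z₀`) of which the vertical space is a coordinate subspace. -/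
noncomputable def frame (z₀ z : Z) : EM →L[ℝ] EN × VertModel EM EN :=
  (S.localDeriv z₀ z).prod (S.compl z₀)

/-- The domain of the local trivialization centred at `z₀`. -/
def trivSet (z₀ : Z) : Set Z :=
  {z | z ∈ S.chartSet z₀ ∧ (S.frame z₀ z).IsInvertible}

theorem mem_trivSet (z₀ : Z) : z₀ ∈ S.trivSet z₀ :=
  ⟨S.mem_chartSet z₀,
    (exists_complementary_map _ (S.localDeriv_surjective (S.mem_chartSet z₀))).choose_spec⟩

theorem contMDiffOn_chart (z₀ : Z) : ContMDiffOn 𝓘(ℝ, EZ) 𝓘(ℝ, EM) ∞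
    (fun z => extChartAt 𝓘(ℝ, EM) (S.base z₀) (S.base z)) (S.chartSet z₀) :=
  contMDiffOn_extChartAt.comp S.contMDiff_base.contMDiffOn
    fun z hz => by simpa using hz.1

theorem contMDiffOn_frame (z₀ : Z) :
    ContMDiffOn 𝓘(ℝ, EZ) 𝓘(ℝ, EM →L[ℝ] EN × VertModel EM EN) ∞ (S.frame z₀) (S.chartSet z₀) := by
  intro z hz
  have h1 : ContDiffAt ℝ ∞ (fun x => (fderiv ℝ (S.localRep z₀) x).prod (S.compl z₀))
      (extChartAt 𝓘(ℝ, EM) (S.base z₀) (S.base z)) := by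
    have h0 : ContDiffAt ℝ ∞ (fderiv ℝ (S.localRep z₀))
        (extChartAt 𝓘(ℝ, EM) (S.base z₀) (S.base z)) :=
      (S.contDiffAt_localRep hz).fderiv_right (by simp)
    refine ((contDiffAt_const (c := ContinuousLinearMap.inl ℝ EN (VertModel EM EN))).clm_comp
      h0).add (contDiffAt_const (c := (ContinuousLinearMap.inr ℝ EN (VertModel EM EN)).comp
        (S.compl z₀))) |>.congr_of_eventuallyEq (Eventually.of_forall fun x => ?_)
    ext v <;> simp
  exact h1.contMDiffAt.comp_contMDiffWithinAt z (S.contMDiffOn_chart z₀ z hz)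

theorem isOpen_trivSet (z₀ : Z) : IsOpen (S.trivSet z₀) := by
  have h := (S.contMDiffOn_frame z₀).continuousOn.isOpen_inter_preimage (S.isOpen_chartSet z₀)
    (ContinuousLinearEquiv.isOpen (𝕜 := ℝ) (E := EM) (F := EN × VertModel EM EN))
  exact h

/-- The local trivialization centred at `z₀`, on the fibre over `z`. -/
noncomputable def trivMap (z₀ z : Z) : S.Fiber z →L[ℝ] VertModel EM EN :=
  (S.compl z₀).comp ((S.chartDeriv z₀ z).comp (S.fiberIncl z))

theorem frame_chartDeriv {z₀ z : Z} (hz : z ∈ S.trivSet z₀) (v : S.Fiber z) :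
    S.frame z₀ z (S.chartDeriv z₀ z (S.fiberIncl z v)) = (0, S.trivMap z₀ z v) := by
  refine Prod.ext ?_ rfl
  change S.localDeriv z₀ z _ = 0
  rw [S.localDeriv_chartDeriv hz.1, mfderiv_fiberIncl]
  exact map_zero _

theorem bijective_trivMap {z₀ z : Z} (hz : z ∈ S.trivSet z₀) :
    Function.Bijective (S.trivMap z₀ z) := by
  obtain ⟨B, hB⟩ := hz.2
  obtain ⟨C, hC⟩ := S.chartDeriv_isInvertible hz.1
  obtain ⟨D, hD⟩ := isInvertible_mfderiv_extChartAt (I := 𝓘(ℝ, EN)) hz.1.2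
  constructor
  · intro v w hvw
    have h : S.frame z₀ z (S.chartDeriv z₀ z (S.fiberIncl z v))
        = S.frame z₀ z (S.chartDeriv z₀ z (S.fiberIncl z w)) := by
      rw [S.frame_chartDeriv hz, S.frame_chartDeriv hz, hvw]
    rw [← hB, ← hC] at h
    exact S.fiberIncl_injective z (C.injective (B.injective h))
  · intro y
    have hBy : S.frame z₀ z (B.symm (0, y)) = (0, y) := by
      rw [← hB]; exact B.apply_symm_apply _
    have hker : mfderiv 𝓘(ℝ, EM) 𝓘(ℝ, EN) S.proj (S.base z) (C.symm (B.symm (0, y))) = 0 := by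
      apply D.injective
      have h := S.localDeriv_chartDeriv hz.1 (C.symm (B.symm (0, y)))
      rw [← hD, ← hC] at h
      rw [map_zero]
      refine h.symm.trans ?_
      have h' : C (C.symm (B.symm (0, y))) = B.symm (0, y) := C.apply_symm_apply _
      change S.localDeriv z₀ z (C (C.symm (B.symm (0, y)))) = 0
      rw [h']
      exact congrArg Prod.fst hBy
    refine ⟨⟨C.symm (B.symm (0, y)), hker⟩, ?_⟩
    change S.compl z₀ (S.chartDeriv z₀ z (C.symm (B.symm (0, y)))) = y
    rw [← hC]
    have h' : C (C.symm (B.symm (0, y))) = B.symm (0, y) := C.apply_symm_apply _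
    change S.compl z₀ (C (C.symm (B.symm (0, y)))) = y
    rw [h']
    exact congrArg Prod.snd hBy

/-- `trivMap` as a linear equivalence. -/
noncomputable def trivEquiv {z₀ z : Z} (hz : z ∈ S.trivSet z₀) :
    S.Fiber z ≃ₗ[ℝ] VertModel EM EN :=
  LinearEquiv.ofBijective (S.trivMap z₀ z).toLinearMap (S.bijective_trivMap hz)

open Classical in
/-- The local trivialization centred at `z₀`:
`(z, v) ↦ (z, compl z₀ (T chart v))` with `v ∈ ker (T proj)`. -/
noncomputable def pretriv (z₀ : Z) :
    Pretrivialization (VertModel EM EN) (π (VertModel EM EN) S.Fiber) where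
  toFun p := (p.1, S.trivMap z₀ p.1 p.2)
  invFun p := if h : p.1 ∈ S.trivSet z₀ then ⟨p.1, (S.trivEquiv h).symm p.2⟩ else ⟨p.1, 0⟩
  source := π (VertModel EM EN) S.Fiber ⁻¹' S.trivSet z₀
  target := S.trivSet z₀ ×ˢ univ
  map_source' p hp := ⟨hp, mem_univ _⟩
  map_target' p hp := by simp [hp.1]
  left_inv' := by
    rintro ⟨z, v⟩ hp
    have hz : z ∈ S.trivSet z₀ := hp
    simp only [hz, dite_true]
    congr 1
    exact (S.trivEquiv hz).symm_apply_apply v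
  right_inv' := by
    rintro ⟨z, y⟩ hp
    have hz : z ∈ S.trivSet z₀ := hp.1
    rw [dif_pos hz]
    exact Prod.ext rfl ((S.trivEquiv hz).apply_symm_apply y)
  open_target := (S.isOpen_trivSet z₀).prod isOpen_univ
  baseSet := S.trivSet z₀
  open_baseSet := S.isOpen_trivSet z₀
  source_eq := rfl
  target_eq := rfl
  proj_toFun _ _ := rfl

instance (z₀ : Z) : (S.pretriv z₀).IsLinear ℝ where
  linear z _ := (S.trivMap z₀ z).toLinearMap.isLinear

theorem pretriv_symm_apply {z₀ z : Z} (hz : z ∈ S.trivSet z₀) (y : VertModel EM EN) :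
    (S.pretriv z₀).symm z y = (S.trivEquiv hz).symm y := by
  apply (S.trivEquiv hz).injective
  rw [LinearEquiv.apply_symm_apply]
  have h := (S.pretriv z₀).apply_mk_symm hz y
  exact congrArg Prod.snd h

/-- The transition functions. -/
noncomputable def transition (z₀ z₁ z : Z) : VertModel EM EN →L[ℝ] VertModel EM EN :=
  (S.compl z₁).comp ((fderiv ℝ
    (extChartAt 𝓘(ℝ, EM) (S.base z₁) ∘ (extChartAt 𝓘(ℝ, EM) (S.base z₀)).symm)
      (extChartAt 𝓘(ℝ, EM) (S.base z₀) (S.base z))).comp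
    ((S.frame z₀ z).inverse.comp (ContinuousLinearMap.inr ℝ EN (VertModel EM EN))))

theorem contDiffAt_chartChange {z₀ z₁ z : Z} (h₀ : z ∈ S.chartSet z₀) (h₁ : z ∈ S.chartSet z₁) :
    ContDiffAt ℝ ∞ (extChartAt 𝓘(ℝ, EM) (S.base z₁) ∘ (extChartAt 𝓘(ℝ, EM) (S.base z₀)).symm)
      (extChartAt 𝓘(ℝ, EM) (S.base z₀) (S.base z)) := by
  rw [← contMDiffAt_iff_contDiffAt]
  refine ContMDiffAt.comp (I' := 𝓘(ℝ, EM)) _ ?_ ?_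
  · rw [(extChartAt 𝓘(ℝ, EM) (S.base z₀)).left_inv h₀.1]
    exact contMDiffAt_extChartAt' (by simpa using h₁.1)
  · exact (contMDiffOn_extChartAt_symm _).contMDiffAt
      ((isOpen_extChartAt_target _).mem_nhds ((extChartAt _ _).map_source h₀.1))

theorem chartChange_chartDeriv {z₀ z₁ z : Z} (h₀ : z ∈ S.chartSet z₀) (h₁ : z ∈ S.chartSet z₁)
    (v : TangentSpace 𝓘(ℝ, EM) (S.base z)) :
    fderiv ℝ (extChartAt 𝓘(ℝ, EM) (S.base z₁) ∘ (extChartAt 𝓘(ℝ, EM) (S.base z₀)).symm)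
      (extChartAt 𝓘(ℝ, EM) (S.base z₀) (S.base z)) (S.chartDeriv z₀ z v)
      = S.chartDeriv z₁ z v := by
  have hc : HasMFDerivAt 𝓘(ℝ, EM) 𝓘(ℝ, EM) (extChartAt 𝓘(ℝ, EM) (S.base z₀)) (S.base z)
      (S.chartDeriv z₀ z) :=
    (mdifferentiableAt_extChartAt (by simpa using h₀.1)).hasMFDerivAt
  have hl : HasMFDerivAt 𝓘(ℝ, EM) 𝓘(ℝ, EM)
      (extChartAt 𝓘(ℝ, EM) (S.base z₁) ∘ (extChartAt 𝓘(ℝ, EM) (S.base z₀)).symm)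
      (extChartAt 𝓘(ℝ, EM) (S.base z₀) (S.base z)) _ :=
    ((S.contDiffAt_chartChange h₀ h₁).differentiableAt (by simp)).hasFDerivAt.hasMFDerivAt
  have h1 := HasMFDerivAt.comp (S.base z) hl hc
  have heq : (extChartAt 𝓘(ℝ, EM) (S.base z₁) ∘ (extChartAt 𝓘(ℝ, EM) (S.base z₀)).symm) ∘
      extChartAt 𝓘(ℝ, EM) (S.base z₀) =ᶠ[𝓝 (S.base z)] extChartAt 𝓘(ℝ, EM) (S.base z₁) := by
    filter_upwards [(isOpen_extChartAt_source (I := 𝓘(ℝ, EM)) (S.base z₀)).mem_nhds h₀.1]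
      with x hx
    simp only [Function.comp_apply, (extChartAt 𝓘(ℝ, EM) (S.base z₀)).left_inv hx]
  have h3 := h1.mfderiv.symm.trans heq.mfderiv_eq
  exact congrArg (fun L => L v) h3

theorem transition_apply {z₀ z₁ z : Z} (h₀ : z ∈ S.trivSet z₀) (h₁ : z ∈ S.trivSet z₁)
    (y : VertModel EM EN) :
    S.transition z₀ z₁ z y = (S.pretriv z₁ ⟨z, (S.pretriv z₀).symm z y⟩).2 := by
  obtain ⟨v, rfl⟩ := (S.bijective_trivMap h₀).2 y
  rw [S.pretriv_symm_apply h₀]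
  have hv : (S.trivEquiv h₀).symm (S.trivMap z₀ z v) = v :=
    (S.trivEquiv h₀).symm_apply_apply v
  rw [hv]
  have hinv : (S.frame z₀ z).inverse (0, S.trivMap z₀ z v)
      = S.chartDeriv z₀ z (S.fiberIncl z v) := by
    rw [← S.frame_chartDeriv h₀]
    obtain ⟨B, hB⟩ := h₀.2
    rw [← hB, ContinuousLinearMap.inverse_equiv]
    exact B.symm_apply_apply _
  change S.compl z₁ (fderiv ℝ _ _ ((S.frame z₀ z).inverse (0, S.trivMap z₀ z v))) = _
  rw [hinv, S.chartChange_chartDeriv h₀.1 h₁.1]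
  rfl

theorem contMDiffOn_transition (z₀ z₁ : Z) :
    ContMDiffOn 𝓘(ℝ, EZ) 𝓘(ℝ, VertModel EM EN →L[ℝ] VertModel EM EN) ∞ (S.transition z₀ z₁)
      (S.trivSet z₀ ∩ S.trivSet z₁) := by
  intro z hz
  have h1 : ContDiffAt ℝ ∞ (fderiv ℝ
      (extChartAt 𝓘(ℝ, EM) (S.base z₁) ∘ (extChartAt 𝓘(ℝ, EM) (S.base z₀)).symm))
      (extChartAt 𝓘(ℝ, EM) (S.base z₀) (S.base z)) :=
    (S.contDiffAt_chartChange hz.1.1 hz.2.1).fderiv_right (by simp)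
  have h2 := h1.contMDiffAt.comp_contMDiffWithinAt z (S.contMDiffOn_chart z₀ z hz.1.1)
  have h3 : ContDiffAt ℝ ∞ (ContinuousLinearMap.inverse :
      (EM →L[ℝ] EN × VertModel EM EN) → _) (S.frame z₀ z) := by
    obtain ⟨B, hB⟩ := hz.1.2
    rw [← hB]
    exact contDiffAt_map_inverse B
  have h4 := h3.contMDiffAt.comp_contMDiffWithinAt z (S.contMDiffOn_frame z₀ z hz.1.1)
  have hsub : S.trivSet z₀ ∩ S.trivSet z₁ ⊆ S.chartSet z₀ := fun x hx => hx.1.1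
  exact ContMDiffWithinAt.clm_comp contMDiffWithinAt_const
    (ContMDiffWithinAt.clm_comp (h2.mono hsub)
      (ContMDiffWithinAt.clm_comp (h4.mono hsub) contMDiffWithinAt_const))

/-- The local trivializations assemble to a smooth vector bundle. -/
noncomputable def prebundle : VectorPrebundle ℝ (VertModel EM EN) S.Fiber where
  pretrivializationAtlas := range S.pretriv
  pretrivialization_linear' := by
    rintro _ ⟨z₀, rfl⟩
    infer_instance
  pretrivializationAt := S.pretriv
  mem_base_pretrivializationAt := S.mem_trivSet
  pretrivialization_mem_atlas z₀ := ⟨z₀, rfl⟩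
  exists_coordChange := by
    rintro _ ⟨z₀, rfl⟩ _ ⟨z₁, rfl⟩
    exact ⟨S.transition z₀ z₁, (S.contMDiffOn_transition z₀ z₁).continuousOn,
      fun z hz y => S.transition_apply hz.1 hz.2 y⟩
  totalSpaceMk_isInducing z := by
    have : FiniteDimensional ℝ (TangentSpace 𝓘(ℝ, EM) (S.base z)) :=
      inferInstanceAs (FiniteDimensional ℝ EM)
    let K := LinearMap.ker (mfderiv 𝓘(ℝ, EM) 𝓘(ℝ, EN) S.proj (S.base z)).toLinearMap
    have : T2Space K := inferInstanceAs (T2Space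
      (LinearMap.ker (show EM →ₗ[ℝ] EN from
        (mfderiv 𝓘(ℝ, EM) 𝓘(ℝ, EN) S.proj (S.base z)).toLinearMap)))
    let e : K ≃L[ℝ] VertModel EM EN :=
      LinearEquiv.toContinuousLinearEquiv (S.trivEquiv (S.mem_trivSet z))
    exact (isInducing_const_prod.2 e.toHomeomorph.isInducing :
      IsInducing fun v : K => (z, e v))

instance prebundle_isContMDiff : S.prebundle.IsContMDiff 𝓘(ℝ, EZ) ∞ where
  exists_contMDiffCoordChange := by
    rintro _ ⟨z₀, rfl⟩ _ ⟨z₁, rfl⟩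
    exact ⟨S.transition z₀ z₁, S.contMDiffOn_transition z₀ z₁,
      fun z hz y => S.transition_apply hz.1 hz.2 y⟩

noncomputable instance : TopologicalSpace (TotalSpace (VertModel EM EN) S.Fiber) :=
  S.prebundle.totalSpaceTopology

noncomputable instance : FiberBundle (VertModel EM EN) S.Fiber := S.prebundle.toFiberBundle

instance : VectorBundle ℝ (VertModel EM EN) S.Fiber := S.prebundle.toVectorBundle

instance : ContMDiffVectorBundle ∞ (VertModel EM EN) S.Fiber 𝓘(ℝ, EZ) :=
  S.prebundle.contMDiffVectorBundle 𝓘(ℝ, EZ)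

/-- The total space of the bundle, a smooth manifold modelled on `S.model`. -/
abbrev Total : Type _ := TotalSpace (VertModel EM EN) S.Fiber

/-- The model with corners of the total space. -/
noncomputable abbrev model (_S : VertData EZ Z EM M EN N) :
    ModelWithCorners ℝ (EZ × VertModel EM EN) (ModelProd EZ (VertModel EM EN)) :=
  𝓘(ℝ, EZ).prod 𝓘(ℝ, VertModel EM EN)

/-- Vector fields on the total space (smoothness is `IsSmoothField`). -/
abbrev VField : Type _ := (p : S.Total) → TangentSpace S.model p

variable [IsManifold 𝓘(ℝ, EZ) ∞ Z]

/-- Smoothness of a vector field on the total space. -/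
def IsSmoothField (X : S.VField) : Prop :=
  ContMDiff S.model S.model.tangent ∞ fun p => (⟨p, X p⟩ : TangentBundle S.model S.Total)

/-- The inclusion of the total space into the tangent bundle of `M`. -/
noncomputable def incl (p : S.Total) : TangentBundle 𝓘(ℝ, EM) M :=
  ⟨S.base p.1, S.fiberIncl p.1 p.2⟩

/-- Fibrewise scalar multiplication on the total space. -/
noncomputable def dilate (t : ℝ) (p : S.Total) : S.Total := ⟨p.1, t • p.2⟩

/-- The Euler vector field, the infinitesimal generator of the flow `(t, p) ↦ eᵗ p`.
(The velocity is a tangent vector at `e⁰ p`, which is `p`.) -/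
noncomputable def euler : S.VField := fun p =>
  mfderiv 𝓘(ℝ, ℝ) S.model (fun t : ℝ => S.dilate (Real.exp t) p) 0 (1 : ℝ)

/-- A vector field `X` is homogeneous quadratic if `[Δ, X] = X`, with `Δ` the Euler field. -/
def IsHomogeneousQuadratic (X : S.VField) : Prop :=
  ∀ p, VectorField.mlieBracket S.model S.euler X p = X p

end VertData

/-- Every vector in the kernel of the differential of a submersion is the velocity of a curve
in the fibre. -/
theorem exists_curve_in_fiber {EM : Type*} [NormedAddCommGroup EM] [NormedSpace ℝ EM]
    {M : Type*} [TopologicalSpace M] [ChartedSpace EM M]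
    {EN : Type*} [NormedAddCommGroup EN] [NormedSpace ℝ EN]
    {N : Type*} [TopologicalSpace N] [ChartedSpace EN N]
    [IsManifold 𝓘(ℝ, EM) ∞ M] [IsManifold 𝓘(ℝ, EN) ∞ N]
    [FiniteDimensional ℝ EM] [FiniteDimensional ℝ EN]
    {f : M → N} (hf : ContMDiff 𝓘(ℝ, EM) 𝓘(ℝ, EN) ∞ f)
    (hs : ∀ x, Function.Surjective (mfderiv 𝓘(ℝ, EM) 𝓘(ℝ, EN) f x)) (x : M)
    (v : TangentSpace 𝓘(ℝ, EM) x) (hv : mfderiv 𝓘(ℝ, EM) 𝓘(ℝ, EN) f x v = 0) :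
    ∃ c : ℝ → M, c 0 = x ∧ (∀ᶠ t in 𝓝 (0 : ℝ), f (c t) = f x) ∧
      HasMFDerivAt 𝓘(ℝ, ℝ) 𝓘(ℝ, EM) c 0
        ((ContinuousLinearMap.toSpanSingleton ℝ (v : EM) : ℝ →L[ℝ] EM)) := by
  have : CompleteSpace EM := FiniteDimensional.complete ℝ EM
  have : CompleteSpace EN := FiniteDimensional.complete ℝ EN
  let S : VertData EM M EM M EN N := ⟨id, f, contMDiff_id, hf, hs⟩
  let a : EM := extChartAt 𝓘(ℝ, EM) x x
  have hg : HasStrictFDerivAt (S.localRep x) (S.localDeriv x x) a :=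
    (S.contDiffAt_localRep (S.mem_chartSet x)).hasStrictFDerivAt (by simp)
  have hr : LinearMap.range (S.localDeriv x x).toLinearMap = ⊤ :=
    LinearMap.range_eq_top.2 (S.localDeriv_surjective (S.mem_chartSet x))
  obtain ⟨C, hC⟩ := S.chartDeriv_isInvertible (S.mem_chartSet x)
  let w : EM := C v
  have hw : w ∈ LinearMap.ker (S.localDeriv x x).toLinearMap := by
    have h := S.localDeriv_chartDeriv (S.mem_chartSet x) v
    have h' : mfderiv 𝓘(ℝ, EM) 𝓘(ℝ, EN) S.proj (S.base x) v = 0 := hv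
    rw [h', map_zero, ← hC] at h
    exact h
  let φ := HasStrictFDerivAt.implicitFunction (S.localRep x) (S.localDeriv x x) hg hr
    (S.localRep x a)
  let d : ℝ → EM := fun t => φ (t • ⟨w, hw⟩)
  have hd0 : d 0 = a := by
    simp only [d, zero_smul]
    exact hg.implicitFunction_apply_image hr
  have hline : HasFDerivAt (fun t : ℝ => t • (⟨w, hw⟩ : LinearMap.ker
      (S.localDeriv x x).toLinearMap)) (ContinuousLinearMap.toSpanSingleton ℝ ⟨w, hw⟩) 0 :=
    (ContinuousLinearMap.toSpanSingleton ℝ (⟨w, hw⟩ : LinearMap.ker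
      (S.localDeriv x x).toLinearMap)).hasFDerivAt
  have hdd : HasFDerivAt d (ContinuousLinearMap.toSpanSingleton ℝ w) 0 := by
    have h1 : HasFDerivAt φ (LinearMap.ker (S.localDeriv x x).toLinearMap).subtypeL ((0 : ℝ) • (⟨w, hw⟩ : LinearMap.ker
      (S.localDeriv x x).toLinearMap)) := by
      rw [zero_smul]; exact (hg.to_implicitFunction hr).hasFDerivAt
    have h2 := h1.comp (0 : ℝ) hline
    have h3 : ContinuousLinearMap.toSpanSingleton ℝ w =
        (LinearMap.ker (S.localDeriv x x).toLinearMap).subtypeL.comp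
          (ContinuousLinearMap.toSpanSingleton ℝ ⟨w, hw⟩) :=
      ContinuousLinearMap.ext fun t => rfl
    rw [h3]
    exact h2
  have ha : a ∈ (extChartAt 𝓘(ℝ, EM) x).target := mem_extChartAt_target x
  have hca : (extChartAt 𝓘(ℝ, EM) x).symm a = x := extChartAt_to_inv x
  have hsymm : MDifferentiableAt 𝓘(ℝ, EM) 𝓘(ℝ, EM) (extChartAt 𝓘(ℝ, EM) x).symm a :=
    ((contMDiffOn_extChartAt_symm (n := ∞) x).contMDiffAt
      ((isOpen_extChartAt_target x).mem_nhds ha)).mdifferentiableAt (by simp)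
  let D := mfderiv 𝓘(ℝ, EM) 𝓘(ℝ, EM) (extChartAt 𝓘(ℝ, EM) x).symm a
  refine ⟨(extChartAt 𝓘(ℝ, EM) x).symm ∘ d, by rw [Function.comp_apply, hd0, hca], ?_, ?_⟩
  · have hev : ∀ᶠ t in 𝓝 (0 : ℝ), S.localRep x (d t) = S.localRep x a := by
      have h := hg.map_implicitFunction_eq hr
      have ht : Tendsto (fun t : ℝ => (S.localRep x a, t • (⟨w, hw⟩ : LinearMap.ker
          (S.localDeriv x x).toLinearMap))) (𝓝 0) (𝓝 (S.localRep x a, 0)) := by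
        refine Tendsto.prodMk_nhds tendsto_const_nhds ?_
        have := hline.continuousAt.tendsto
        simpa using this
      exact ht.eventually h
    have hcont : ContinuousAt (fun t => (extChartAt 𝓘(ℝ, EM) x).symm (d t)) 0 := by
      refine ContinuousAt.comp (g := (extChartAt 𝓘(ℝ, EM) x).symm) ?_ hdd.continuousAt
      rw [hd0]; exact hsymm.continuousAt
    have hsrc : ∀ᶠ t in 𝓝 (0 : ℝ), f ((extChartAt 𝓘(ℝ, EM) x).symm (d t)) ∈
        (extChartAt 𝓘(ℝ, EN) (f x)).source := by
      have h2 : ContinuousAt (fun t => f ((extChartAt 𝓘(ℝ, EM) x).symm (d t))) 0 :=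
        hf.continuous.continuousAt.comp hcont
      refine h2.eventually_mem ((isOpen_extChartAt_source (f x)).mem_nhds ?_)
      rw [hd0, hca]; exact mem_extChartAt_source _
    filter_upwards [hev, hsrc] with t h1 h2
    refine (extChartAt 𝓘(ℝ, EN) (f x)).injOn h2 (mem_extChartAt_source _) ?_
    have h3 : S.localRep x a = extChartAt 𝓘(ℝ, EN) (f x) (f x) := by
      change extChartAt 𝓘(ℝ, EN) (f x) (f ((extChartAt 𝓘(ℝ, EM) x).symm a)) = _
      rw [hca]
    exact h1.trans h3
  · have h1 : HasMFDerivAt 𝓘(ℝ, EM) 𝓘(ℝ, EM) (extChartAt 𝓘(ℝ, EM) x).symm (d 0) D := by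
      rw [hd0]; exact hsymm.hasMFDerivAt
    have h2 := HasMFDerivAt.comp (0 : ℝ) h1 hdd.hasMFDerivAt
    have hD : D.comp (S.chartDeriv x x) = ContinuousLinearMap.id ℝ _ := by
      have hc : HasMFDerivAt 𝓘(ℝ, EM) 𝓘(ℝ, EM) (extChartAt 𝓘(ℝ, EM) x) x (S.chartDeriv x x) :=
        (mdifferentiableAt_extChartAt (by simp)).hasMFDerivAt
      have h3 : HasMFDerivAt 𝓘(ℝ, EM) 𝓘(ℝ, EM) _ _ _ :=
        HasMFDerivAt.comp x hsymm.hasMFDerivAt hc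
      have heq : (extChartAt 𝓘(ℝ, EM) x).symm ∘ extChartAt 𝓘(ℝ, EM) x =ᶠ[𝓝 x] id := by
        filter_upwards [(isOpen_extChartAt_source (I := 𝓘(ℝ, EM)) x).mem_nhds
          (mem_extChartAt_source x)] with y hy
        exact (extChartAt 𝓘(ℝ, EM) x).left_inv hy
      exact h3.mfderiv.symm.trans (heq.mfderiv_eq.trans mfderiv_id)
    have h4 : D (S.chartDeriv x x v) = v := congrArg (fun L => L v) hD
    rw [← hC] at h4
    have h5 : (ContinuousLinearMap.toSpanSingleton ℝ (v : EM) : ℝ →L[ℝ] EM) =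
        ContinuousLinearMap.comp (show EM →L[ℝ] EM from D)
          (ContinuousLinearMap.toSpanSingleton ℝ w) := by
      refine ContinuousLinearMap.ext_ring ?_
      change (1 : ℝ) • (show EM from v) = (show EM →L[ℝ] EM from D) ((1 : ℝ) • w)
      rw [one_smul, one_smul]
      exact h4.symm
    rw [h5]
    exact h2

end VerticalBundle

/-! ### Lie groupoids -/

section Groupoid

/-- A Lie groupoid `G ⇉ Q`. The product `mul g h` is meaningful only for composable pairs,
`tgt g = src h`; its values elsewhere are irrelevant. Smoothness of the product is smoothness on
the (embedded) submanifold of composable pairs of `G × G`. -/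
structure LieGroupoid (EG : Type*) [NormedAddCommGroup EG] [NormedSpace ℝ EG]
    (G : Type*) [TopologicalSpace G] [ChartedSpace EG G]
    (EQ : Type*) [NormedAddCommGroup EQ] [NormedSpace ℝ EQ]
    (Q : Type*) [TopologicalSpace Q] [ChartedSpace EQ Q] where
  src : G → Q
  tgt : G → Q
  one : Q → G
  inv : G → G
  mul : G → G → G
  src_mul : ∀ g h, tgt g = src h → src (mul g h) = src g
  tgt_mul : ∀ g h, tgt g = src h → tgt (mul g h) = tgt h
  mul_assoc : ∀ g h k, tgt g = src h → tgt h = src k → mul (mul g h) k = mul g (mul h k)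
  src_one : ∀ q, src (one q) = q
  tgt_one : ∀ q, tgt (one q) = q
  one_mul : ∀ g, mul (one (src g)) g = g
  mul_one : ∀ g, mul g (one (tgt g)) = g
  src_inv : ∀ g, src (inv g) = tgt g
  tgt_inv : ∀ g, tgt (inv g) = src g
  inv_mul : ∀ g, mul (inv g) g = one (tgt g)
  mul_inv : ∀ g, mul g (inv g) = one (src g)
  contMDiff_src : ContMDiff 𝓘(ℝ, EG) 𝓘(ℝ, EQ) ∞ src
  contMDiff_tgt : ContMDiff 𝓘(ℝ, EG) 𝓘(ℝ, EQ) ∞ tgt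
  contMDiff_one : ContMDiff 𝓘(ℝ, EQ) 𝓘(ℝ, EG) ∞ one
  contMDiff_inv : ContMDiff 𝓘(ℝ, EG) 𝓘(ℝ, EG) ∞ inv
  contMDiffOn_mul : ContMDiffOn (𝓘(ℝ, EG).prod 𝓘(ℝ, EG)) 𝓘(ℝ, EG) ∞
    (fun p : G × G => mul p.1 p.2) {p | tgt p.1 = src p.2}
  surjective_mfderiv_src : ∀ g, Function.Surjective (mfderiv 𝓘(ℝ, EG) 𝓘(ℝ, EQ) src g)
  surjective_mfderiv_tgt : ∀ g, Function.Surjective (mfderiv 𝓘(ℝ, EG) 𝓘(ℝ, EQ) tgt g)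

namespace LieGroupoid

variable {EG : Type*} [NormedAddCommGroup EG] [NormedSpace ℝ EG]
  {G : Type*} [TopologicalSpace G] [ChartedSpace EG G]
  {EQ : Type*} [NormedAddCommGroup EQ] [NormedSpace ℝ EQ]
  {Q : Type*} [TopologicalSpace Q] [ChartedSpace EQ Q]
  (𝒢 : LieGroupoid EG G EQ Q)

/-- The Lie algebroid `AG → Q`, with fibre `A_q G = ker (T_{ε(q)} α)`. -/
abbrev A : VertData EQ Q EG G EQ Q :=
  ⟨𝒢.one, 𝒢.src, 𝒢.contMDiff_one, 𝒢.contMDiff_src, 𝒢.surjective_mfderiv_src⟩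

/-- The vertical bundle `Vα → G` of the source map, with fibre `V_g α = ker (T_g α)`. -/
abbrev V : VertData EG G EG G EQ Q :=
  ⟨id, 𝒢.src, contMDiff_id, 𝒢.contMDiff_src, 𝒢.surjective_mfderiv_src⟩

/-- The fibre of the source map through `g`. -/
def srcFiber (g : G) : Set G := {h | 𝒢.src h = 𝒢.src g}

/-- The tangent map at `g` of the left translation by `g⁻¹`, defined on the source fibre of `g`.
Only its values on vectors tangent to that fibre, `V_g α`, are meaningful (on these, all
derivatives within the fibre agree). It takes values at `g⁻¹ g`, which is `ε(β(g))`. -/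
noncomputable def leftTransl (g : G) :
    TangentSpace 𝓘(ℝ, EG) g →L[ℝ] TangentSpace 𝓘(ℝ, EG) (𝒢.one (𝒢.tgt g)) :=
  mfderivWithin 𝓘(ℝ, EG) 𝓘(ℝ, EG) (fun h => 𝒢.mul (𝒢.inv g) h) (𝒢.srcFiber g) g

theorem hasMFDerivWithinAt_leftTransl (g : G) :
    HasMFDerivWithinAt 𝓘(ℝ, EG) 𝓘(ℝ, EG) (fun h => 𝒢.mul (𝒢.inv g) h) (𝒢.srcFiber g) g
      (𝒢.leftTransl g) := by
  have h1 := 𝒢.contMDiffOn_mul (𝒢.inv g, g) (𝒢.tgt_inv g)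
  have h2 : ContMDiffWithinAt 𝓘(ℝ, EG) (𝓘(ℝ, EG).prod 𝓘(ℝ, EG)) ∞ (fun h => (𝒢.inv g, h))
      (𝒢.srcFiber g) g := contMDiffWithinAt_const.prodMk contMDiffWithinAt_id
  have h3 := ContMDiffWithinAt.comp g h1 h2
    (fun h hh => by
      change 𝒢.tgt (𝒢.inv g) = 𝒢.src h
      rw [𝒢.tgt_inv]; exact Eq.symm hh)
  exact (h3.mdifferentiableWithinAt (by simp)).hasMFDerivWithinAt

variable [IsManifold 𝓘(ℝ, EG) ∞ G] [IsManifold 𝓘(ℝ, EQ) ∞ Q]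
  [FiniteDimensional ℝ EG] [FiniteDimensional ℝ EQ]

theorem mfderiv_src_leftTransl (g : G) (v : TangentSpace 𝓘(ℝ, EG) g)
    (hv : mfderiv 𝓘(ℝ, EG) 𝓘(ℝ, EQ) 𝒢.src g v = 0) :
    mfderiv 𝓘(ℝ, EG) 𝓘(ℝ, EQ) 𝒢.src (𝒢.one (𝒢.tgt g)) (𝒢.leftTransl g v) = 0 := by
  obtain ⟨c, hc0, hcs, hc⟩ :=
    exists_curve_in_fiber 𝒢.contMDiff_src 𝒢.surjective_mfderiv_src g v hv
  have hl : HasMFDerivWithinAt 𝓘(ℝ, EG) 𝓘(ℝ, EG) (fun h => 𝒢.mul (𝒢.inv g) h)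
      (𝒢.srcFiber g) (c 0) (show EG →L[ℝ] EG from 𝒢.leftTransl g) := by
    rw [hc0]; exact 𝒢.hasMFDerivWithinAt_leftTransl g
  have hs : HasMFDerivAt 𝓘(ℝ, EG) 𝓘(ℝ, EQ) 𝒢.src (𝒢.mul (𝒢.inv g) (c 0))
      (show EG →L[ℝ] EQ from mfderiv 𝓘(ℝ, EG) 𝓘(ℝ, EQ) 𝒢.src (𝒢.one (𝒢.tgt g))) := by
    rw [hc0, 𝒢.inv_mul]
    exact (𝒢.contMDiff_src.mdifferentiableAt (by simp)).hasMFDerivAt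
  have h1 := HasMFDerivAt.comp_hasMFDerivWithinAt (c 0) hs hl
  have h2 := HasMFDerivWithinAt.comp (0 : ℝ) h1
    (hc.hasMFDerivWithinAt (s := c ⁻¹' 𝒢.srcFiber g)) Subset.rfl
  have hmem : c ⁻¹' 𝒢.srcFiber g ∈ 𝓝 (0 : ℝ) := hcs
  have h3 := h2.hasMFDerivAt hmem
  have hconst : (𝒢.src ∘ fun h => 𝒢.mul (𝒢.inv g) h) ∘ c =ᶠ[𝓝 0] fun _ => 𝒢.tgt g := by
    filter_upwards [hcs] with t ht
    change 𝒢.src (𝒢.mul (𝒢.inv g) (c t)) = 𝒢.tgt g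
    rw [𝒢.src_mul _ _ (by rw [𝒢.tgt_inv]; exact ht.symm), 𝒢.src_inv]
  have h4 := h3.mfderiv.symm.trans (hconst.mfderiv_eq.trans mfderiv_const)
  have h5 : (show EG →L[ℝ] EQ from mfderiv 𝓘(ℝ, EG) 𝓘(ℝ, EQ) 𝒢.src (𝒢.one (𝒢.tgt g)))
      ((show EG →L[ℝ] EG from 𝒢.leftTransl g) ((1 : ℝ) • (show EG from v))) = 0 :=
    congrArg (fun L : ℝ →L[ℝ] EQ => L (1 : ℝ)) h4
  rw [one_smul] at h5
  exact h5

/-- The vector bundle map `Ψ : Vα → AG` over `β : G → Q`, `Ψ(v_g) = T l_{g⁻¹} v_g`. -/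
noncomputable def Psi (v : 𝒢.V.Total) : 𝒢.A.Total :=
  ⟨𝒢.tgt v.1, ⟨𝒢.leftTransl v.1 (𝒢.V.fiberIncl v.1 v.2),
    𝒢.mfderiv_src_leftTransl v.1 _ (𝒢.V.mfderiv_fiberIncl v.1 v.2)⟩⟩

/-- The canonical inclusion `ι : AG → Vα` over the identity section `ε : Q → G`. -/
noncomputable def iota (a : 𝒢.A.Total) : 𝒢.V.Total := ⟨𝒢.one a.1, a.2⟩

/-- `Γ` is a (smooth) SODE on the Lie algebroid `AG`: `T τ (Γ(a)) = ρ(a)`, where the anchor `ρ` is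
the restriction of `Tβ` to `AG`. -/
structure IsSODE (Γ : 𝒢.A.VField) : Prop where
  smooth : 𝒢.A.IsSmoothField Γ
  anchor : ∀ a : 𝒢.A.Total,
    tangentMap 𝒢.A.model 𝓘(ℝ, EQ) (fun b : 𝒢.A.Total => b.1) ⟨a, Γ a⟩
      = tangentMap 𝓘(ℝ, EG) 𝓘(ℝ, EQ) 𝒢.tgt (𝒢.A.incl a)

/-- `X` is a (smooth) SODE on the Lie algebroid `Vα`, whose anchor is the inclusion in `TG`:
`T τ̃ (X(v)) = v`. -/
structure IsVertSODE (X : 𝒢.V.VField) : Prop where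
  smooth : 𝒢.V.IsSmoothField X
  anchor : ∀ v : 𝒢.V.Total,
    tangentMap 𝒢.V.model 𝓘(ℝ, EG) (fun w : 𝒢.V.Total => w.1) ⟨v, X v⟩ = 𝒢.V.incl v

/-- `X` is a SODE on `Vα` which is `Ψ`-related to `Γ`: `T Ψ ∘ X = Γ ∘ Ψ`. -/
structure IsLift (Γ : 𝒢.A.VField) (X : 𝒢.V.VField) : Prop where
  sode : 𝒢.IsVertSODE X
  related : ∀ v : 𝒢.V.Total,
    tangentMap 𝒢.V.model 𝒢.A.model 𝒢.Psi ⟨v, X v⟩ = ⟨𝒢.Psi v, Γ (𝒢.Psi v)⟩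

/-- `σ : [0, 1] → G` is the trajectory of `X` with initial velocity `v`: the projection of an
integral curve of `X` on `[0, 1]` which starts at `v`. -/
def IsTrajectory (X : 𝒢.V.VField) (v : 𝒢.V.Total) (σ : ℝ → G) : Prop :=
  ∃ c : ℝ → 𝒢.V.Total, c 0 = v ∧ IsMIntegralCurveOn c X (Icc 0 1) ∧
    ∀ t ∈ Icc (0 : ℝ) 1, σ t = (c t).1

/-- The domain of the exponential map: the `v ∈ AG` for which the integral curve of `X` which
starts at `ι v` is defined on `[0, 1]`. -/
def expDomain (X : 𝒢.V.VField) : Set 𝒢.A.Total :=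
  {v | ∃ c : ℝ → 𝒢.V.Total, c 0 = 𝒢.iota v ∧ IsMIntegralCurveOn c X (Icc 0 1)}

open Classical in
/-- The exponential map at time `1`: `exp v = τ̃ (Φ₁ (ι v))`, with `Φ` the flow of `X`
(and the irrelevant value `ε(τ(v))` outside the domain). -/
noncomputable def exp (X : 𝒢.V.VField) (v : 𝒢.A.Total) : G :=
  if h : v ∈ 𝒢.expDomain X then (h.choose 1).1 else 𝒢.one v.1

/-- The zero vector `0_q ∈ A_q G`. -/
noncomputable def zeroVec (q : Q) : 𝒢.A.Total := ⟨q, 0⟩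

/-- The vertical vector `d/dt|₀ (t v)` at `0_q` defined by `v ∈ A_q G`. -/
noncomputable def vertVec (q : Q) (v : 𝒢.A.Fiber q) : TangentSpace 𝒢.A.model (𝒢.zeroVec q) :=
  mfderiv 𝓘(ℝ, ℝ) 𝒢.A.model (fun t : ℝ => 𝒢.A.dilate t ⟨q, v⟩) 0 (1 : ℝ)

/-- The identification `T_q Q × A_q G ≃ T_{0_q} AG`,
`(u, v) ↦ (T_q 0)(u) + d/dt|₀ (t v)`. -/
noncomputable def identAG (q : Q) (p : TangentSpace 𝓘(ℝ, EQ) q × 𝒢.A.Fiber q) :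
    TangentSpace 𝒢.A.model (𝒢.zeroVec q) :=
  mfderiv 𝓘(ℝ, EQ) 𝒢.A.model 𝒢.zeroVec q p.1 + 𝒢.vertVec q p.2

/-- The identification `T_q Q × A_q G ≃ T_{ε(q)} G`, `(u, v) ↦ (T_q ε)(u) + v`. -/
noncomputable def identG (q : Q) (p : TangentSpace 𝓘(ℝ, EQ) q × 𝒢.A.Fiber q) :
    TangentSpace 𝓘(ℝ, EG) (𝒢.one q) :=
  mfderiv 𝓘(ℝ, EQ) 𝓘(ℝ, EG) 𝒢.one q p.1 + 𝒢.A.fiberIncl q p.2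

end LieGroupoid

end Groupoid

/-! Lift. The map `Ψ` is linear and injective on fibres of equal dimension and covers `β`, so it
exhibits `Vα` as the pull-back of `AG` along `β`. A tangent vector of `Vα` is therefore determined
by its images under `T τ̃` and `T Ψ`, and these can be prescribed whenever they agree in `TQ`. For
the values `v` and `Γ(Ψ v)` agreement means `Tβ(v) = ρ(Ψ v)`, which is the derivative of `β(g⁻¹ h) =
β(h)`. In the coordinates `liftCoord` the lift solves a smooth invertible linear system. The
delicate point is smoothness of `Ψ` itself: it is a derivative along the varying source fibres, so
the division map `(g, h) ↦ g⁻¹ h` is first extended off the set `α(g) = α(h)`, through a smooth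
family of retractions onto these fibres.

Homogeneity. In a bundle chart `[Δ, Γ] = Γ` becomes Euler's equation, so the fibre component of `Γ`
has degree two along rays; by the anchor condition the base component has degree one. Together: `Γ(s
a) = s T(s·) Γ(a)` for `s ≥ 0`, and the lift inherits this identity because `Ψ` commutes with
dilations. Hence `t ↦ s c(s t)` is an integral curve whenever `c` is. This gives the star shape, the
zeros of the lift along the zero section, and `exp(t v) = σ_v(t)`.

Differential. Openness of the domain is a continuation argument along a given integral curve. The
differential of `exp` is needed only at zero vectors, where the lift has an equilibrium. There a
Grönwall estimate against the linearized equation makes a short-time flow map differentiable.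
Homogeneity carries this to time one: `exp(v) = τ̃(Φ_ε(ι(v/ε)))` near `0_q`. The value of the
differential follows from `exp(0_q) = ε(q)` along the zero section and from `σ_v'(0) = v` in fibre
directions. -/

set_option linter.unusedSectionVars false

/-! ### Local flows in Banach spaces and their differentiability at an equilibrium -/

section LocalFlow

variable {E : Type*} [NormedAddCommGroup E] [NormedSpace ℝ E] [CompleteSpace E]

/-- The time-`ε` map of a family of solutions of `x' = f x` which depends on its starting point in
a Lipschitz way is differentiable at an equilibrium of `f`. -/
theorem hasFDerivAt_of_solutions_near_equilibrium {f : E → E} {x₀ : E} {A : E →L[ℝ] E}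
    (hf : HasFDerivAt f A x₀) (hf0 : f x₀ = 0) {ε r : ℝ} (hε : 0 < ε) (hr : 0 < r)
    {α : E → ℝ → E} {C : ℝ} (hC : 0 < C)
    (hα0 : ∀ x ∈ Metric.ball x₀ r, α x 0 = x)
    (hα : ∀ x ∈ Metric.ball x₀ r, ∀ t ∈ Icc 0 ε,
      HasDerivWithinAt (α x) (f (α x t)) (Icc 0 ε) t)
    (hlip : ∀ x ∈ Metric.ball x₀ r, ∀ t ∈ Icc 0 ε, ‖α x t - x₀‖ ≤ C * ‖x - x₀‖) :
    HasFDerivAt (fun x => α x ε) (NormedSpace.exp (ε • A)) x₀ := by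
  have h0 : α x₀ ε = x₀ := by
    have := hlip x₀ (Metric.mem_ball_self hr) ε (right_mem_Icc.2 hε.le)
    simpa [sub_eq_zero] using this
  rw [hasFDerivAt_iff_isLittleO, Asymptotics.isLittleO_iff]
  intro c hc
  -- The added `1` excludes the degenerate case `K = 0` of the Grönwall bound.
  set K : ℝ := ‖A‖ + 1 with hK
  have hKpos : 0 < K := by positivity
  -- `B` is the factor by which Grönwall amplifies the remainder up to time `ε`. Requiring the
  -- remainder of `f` to be below `c / B` makes the final error exactly `c ‖x - x₀‖`.
  set B : ℝ := C / K * (Real.exp (K * ε) - 1) with hB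
  have hBpos : 0 < B := by
    have : 1 < Real.exp (K * ε) := Real.one_lt_exp_iff.2 (by positivity)
    have h2 : 0 < Real.exp (K * ε) - 1 := by linarith
    positivity
  have hfo := (hasFDerivAt_iff_isLittleO.1 hf)
  rw [Asymptotics.isLittleO_iff] at hfo
  obtain ⟨δ, hδ, hfδ⟩ := Metric.eventually_nhds_iff_ball.1 (hfo (div_pos hc hBpos))
  have hnear : ∀ᶠ x in 𝓝 x₀, x ∈ Metric.ball x₀ (min r (δ / C)) :=
    Metric.ball_mem_nhds _ (lt_min hr (div_pos hδ hC))
  filter_upwards [hnear] with x hx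
  have hxr : x ∈ Metric.ball x₀ r := Metric.ball_subset_ball (min_le_left _ _) hx
  have hxδ : C * ‖x - x₀‖ < δ := by
    have := (Metric.mem_ball.1 hx).trans_le (min_le_right _ _)
    rw [dist_eq_norm, lt_div_iff₀ hC] at this
    linarith
  -- The deviation of the solution from the linearized one. Its derivative is `A z` plus the
  -- nonlinear remainder of `f`, so Grönwall applies.
  let z : ℝ → E := fun t => α x t - x₀ - NormedSpace.exp (t • A) (x - x₀)
  let z' : ℝ → E := fun t => f (α x t) - (A * NormedSpace.exp (t • A)) (x - x₀)
  have hz : ∀ t ∈ Icc 0 ε, HasDerivWithinAt z (z' t) (Icc 0 ε) t := by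
    intro t ht
    have h1 := ((hα x hxr t ht).sub_const x₀)
    have h2 : HasDerivAt (fun t : ℝ => NormedSpace.exp (t • A)) (A * NormedSpace.exp (t • A)) t :=
      hasDerivAt_exp_smul_const' A t
    have h3 : HasDerivAt (fun t : ℝ => NormedSpace.exp (t • A) (x - x₀))
        ((A * NormedSpace.exp (t • A)) (x - x₀)) t :=
      ((ContinuousLinearMap.apply ℝ E (x - x₀)).hasFDerivAt.comp_hasDerivAt t h2)
    exact h1.sub h3.hasDerivWithinAt
  have hbound : ∀ t ∈ Ico 0 ε, ‖z' t‖ ≤ K * ‖z t‖ + c / B * (C * ‖x - x₀‖) := by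
    intro t ht
    have ht' := Ico_subset_Icc_self ht
    have hl := hlip x hxr t ht'
    have h1 := hfδ (α x t) (by rw [mem_ball_iff_norm]; linarith)
    rw [hf0, sub_zero] at h1
    have h2 : z' t = (f (α x t) - A (α x t - x₀)) + A (z t) := by
      simp only [z', z, map_sub, mul_apply_eq_comp]
      abel
    rw [h2]
    calc ‖(f (α x t) - A (α x t - x₀)) + A (z t)‖
        ≤ ‖f (α x t) - A (α x t - x₀)‖ + ‖A (z t)‖ := norm_add_le _ _
      _ ≤ c / B * ‖α x t - x₀‖ + ‖A‖ * ‖z t‖ := add_le_add h1 (A.le_opNorm _)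
      _ ≤ c / B * (C * ‖x - x₀‖) + K * ‖z t‖ := by
          gcongr
          linarith
      _ = _ := add_comm _ _
  have hz0 : ‖z 0‖ ≤ 0 := by simp [z, hα0 x hxr]
  have hg := norm_le_gronwallBound_of_norm_deriv_right_le (f := z) (f' := z')
    (fun t ht => (hz t ht).continuousWithinAt)
    (fun t ht => (hz t (Ico_subset_Icc_self ht)).mono_of_mem_nhdsWithin
      (mem_of_superset (Icc_mem_nhdsGE ht.2) (Icc_subset_Icc_left ht.1)))
    hz0 hbound ε (right_mem_Icc.2 hε.le)
  rw [gronwallBound_of_K_ne_0 hKpos.ne', sub_zero] at hg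
  simp only [zero_mul, zero_add] at hg
  rw [h0]
  refine hg.trans (le_of_eq ?_)
  have hB' : B ≠ 0 := hBpos.ne'
  calc c / B * (C * ‖x - x₀‖) / K * (Real.exp (K * ε) - 1)
      = c / B * B * ‖x - x₀‖ := by rw [hB]; ring
    _ = c * ‖x - x₀‖ := by field_simp

/-- The local flow of a `C¹` vector field on a Banach space, on an interval `[0, ε]`. Its time-`ε`
map is differentiable at `x₀` if `x₀` is an equilibrium. -/
theorem exists_local_flow_of_contDiffAt {f : E → E} {x₀ : E} (hf : ContDiffAt ℝ 1 f x₀)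
    {U : Set E} (hU : U ∈ 𝓝 x₀) :
    ∃ ε > (0 : ℝ), ∃ r > (0 : ℝ), ∃ α : E → ℝ → E,
      (∀ x ∈ Metric.ball x₀ r, α x 0 = x ∧ ∀ t ∈ Icc 0 ε, α x t ∈ U ∧
        HasDerivWithinAt (α x) (f (α x t)) (Icc 0 ε) t) ∧
      (∀ t ∈ Icc 0 ε, ContinuousOn (fun x => α x t) (Metric.ball x₀ r)) ∧
      (f x₀ = 0 → α x₀ ε = x₀ ∧ ∃ L : E →L[ℝ] E, HasFDerivAt (fun x => α x ε) L x₀) := by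
  obtain ⟨ε₀, hε₀, a, r₀, L, K, hr₀, hpl⟩ := IsPicardLindelof.of_contDiffAt_one hf
  obtain ⟨α, hα, C, hC⟩ :=
    (hpl 0).exists_forall_mem_closedBall_eq_hasDerivWithinAt_lipschitzOnWith
  simp only [zero_sub, zero_add] at hα hC
  obtain ⟨K', s, hs, hlip⟩ := hf.exists_lipschitzOnWith
  obtain ⟨ρ, hρ, hρU⟩ := Metric.mem_nhds_iff.1 (inter_mem hU hs)
  have hx₀ : x₀ ∈ Metric.closedBall x₀ (r₀ : ℝ) := Metric.mem_closedBall_self r₀.2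
  have hcont : ContinuousAt (α x₀) 0 :=
    ((hα x₀ hx₀).2 0 ⟨by linarith, hε₀.le⟩).continuousWithinAt.continuousAt
      (Icc_mem_nhds (by linarith) hε₀)
  have hc2 : ∀ᶠ t in 𝓝 (0 : ℝ), dist (α x₀ t) x₀ < ρ / 2 := by
    have := hcont.eventually (Metric.ball_mem_nhds (α x₀ 0) (half_pos hρ))
    rw [(hα x₀ hx₀).1] at this
    exact this
  obtain ⟨ε₁, hε₁, hball⟩ := Metric.eventually_nhds_iff.1 hc2
  -- `ε` keeps the solution from `x₀` within `ρ / 2` of `x₀`, and `r` keeps the other solutions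
  -- within `ρ / 2` of that one. All of them then stay in `U ∩ s`, where `f` is Lipschitz. The
  -- Lipschitz constant `C` may vanish, hence `C + 1`.
  set ε := min ε₀ (ε₁ / 2) with hεdef
  have hε : 0 < ε := lt_min hε₀ (half_pos hε₁)
  set r := min (r₀ : ℝ) (ρ / 2 / (C + 1)) with hrdef
  have hr : 0 < r := lt_min hr₀ (by positivity)
  have hsub : Icc 0 ε ⊆ Icc (-ε₀) ε₀ := Icc_subset_Icc (by linarith) (min_le_left _ _)
  have hrsub : Metric.ball x₀ r ⊆ Metric.closedBall x₀ r₀ :=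
    Metric.ball_subset_closedBall.trans (Metric.closedBall_subset_closedBall (min_le_left _ _))
  have hmem : ∀ x ∈ Metric.ball x₀ r, ∀ t ∈ Icc 0 ε, α x t ∈ U ∩ s := by
    intro x hx t ht
    apply hρU
    have h1 := (hC t (hsub ht)).dist_le_mul x (hrsub hx) x₀ hx₀
    have h2 : dist (α x₀ t) x₀ < ρ / 2 := by
      apply hball
      rw [Real.dist_0_eq_abs, abs_of_nonneg ht.1]
      have := ht.2.trans (min_le_right _ _)
      linarith
    have h3 : (C : ℝ) * dist x x₀ ≤ ρ / 2 := by
      have h4 : dist x x₀ ≤ ρ / 2 / (C + 1) := (Metric.mem_ball.1 hx).le.trans (min_le_right _ _)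
      rw [le_div_iff₀ (by positivity)] at h4
      nlinarith [dist_nonneg (x := x) (y := x₀)]
    rw [Metric.mem_ball]
    linarith [dist_triangle (α x t) (α x₀ t) x₀]
  have hder : ∀ x ∈ Metric.ball x₀ r, ∀ t ∈ Icc 0 ε,
      HasDerivWithinAt (α x) (f (α x t)) (Icc 0 ε) t :=
    fun x hx t ht => ((hα x (hrsub hx)).2 t (hsub ht)).mono hsub
  refine ⟨ε, hε, r, hr, α, fun x hx => ⟨(hα x (hrsub hx)).1, fun t ht =>
    ⟨(hmem x hx t ht).1, hder x hx t ht⟩⟩, fun t ht => (hC t (hsub ht)).continuousOn.mono hrsub,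
    fun hf0 => ?_⟩
  have hx₀' : x₀ ∈ Metric.ball x₀ r := Metric.mem_ball_self hr
  -- At an equilibrium the constant curve is a solution. Comparing with it turns Lipschitz
  -- dependence on the starting point into the bound on `‖α x t - x₀‖` needed below.
  have heq : EqOn (α x₀) (fun _ => x₀) (Icc 0 ε) := by
    refine ODE_solution_unique_of_mem_Icc_right (v := fun _ => f) (s := fun _ => s) (K := K')
      (fun t _ => hlip) (fun t ht => (hder x₀ hx₀' t ht).continuousWithinAt)
      (fun t ht => (hder x₀ hx₀' t (Ico_subset_Icc_self ht)).mono_of_mem_nhdsWithin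
        (mem_of_superset (Icc_mem_nhdsGE ht.2) (Icc_subset_Icc_left ht.1)))
      (fun t ht => (hmem x₀ hx₀' t (Ico_subset_Icc_self ht)).2) continuousOn_const ?_
      (fun t _ => mem_of_mem_nhds hs) (hα x₀ hx₀).1
    intro t _
    simp only [hf0]
    exact hasDerivWithinAt_const _ _ _
  refine ⟨heq (right_mem_Icc.2 hε.le), _, hasFDerivAt_of_solutions_near_equilibrium
    (hf.differentiableAt (by simp)).hasFDerivAt hf0 hε hr (C := C + 1) (by positivity)
    (fun x hx => (hα x (hrsub hx)).1) hder fun x hx t ht => ?_⟩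
  have h1 := (hC t (hsub ht)).dist_le_mul x (hrsub hx) x₀ hx₀
  rw [heq ht, dist_eq_norm, dist_eq_norm] at h1
  nlinarith [norm_nonneg (x - x₀)]

end LocalFlow

/-! ### Integral curves on closed intervals -/

section ManifoldFlow

variable {E : Type*} [NormedAddCommGroup E] [NormedSpace ℝ E]
  {H : Type*} [TopologicalSpace H] {I : ModelWithCorners ℝ E H}
  {M : Type*} [TopologicalSpace M] [ChartedSpace H M]
  {v : (x : M) → TangentSpace I x}

/-- The bridge between smoothness of a vector field, which is tested in trivializations of the
tangent bundle, and derivatives of charts. -/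
theorem trivializationAt_tangent_snd [IsManifold I 1 M] {x y : M}
    (hy : y ∈ (extChartAt I x).source) (w : TangentSpace I y) :
    (trivializationAt E (TangentSpace I) x ⟨y, w⟩).2 = mfderiv I 𝓘(ℝ, E) (extChartAt I x) y w := by
  have hb : y ∈ (trivializationAt E (TangentSpace I) x).baseSet := by
    simpa [TangentBundle.trivializationAt_baseSet] using hy
  have h1 := TangentBundle.continuousLinearMapAt_trivializationAt (I := I) (x₀ := x) (x := y)
    (by simpa using hy)
  have h2 := congrArg (fun L : TangentSpace I y →L[ℝ] E => L w) h1
  refine Eq.trans ?_ h2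
  exact (Trivialization.linearMapAt_apply (R := ℝ) (trivializationAt E (TangentSpace I) x) w).trans
    (if_pos hb) |>.symm

/-- Concatenation of integral curves. -/
theorem IsMIntegralCurveOn.concat {γ₁ γ₂ : ℝ → M} {a b c : ℝ} (hab : a ≤ b) (hbc : b ≤ c)
    (h₁ : IsMIntegralCurveOn γ₁ v (Icc a b)) (h₂ : IsMIntegralCurveOn γ₂ v (Icc b c))
    (h : γ₁ b = γ₂ b) :
    IsMIntegralCurveOn (fun t => if t ≤ b then γ₁ t else γ₂ t) v (Icc a c) := by
  set γ : ℝ → M := fun t => if t ≤ b then γ₁ t else γ₂ t with hγ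
  have e₁ : ∀ t ∈ Icc a b, γ t = γ₁ t := fun t ht => if_pos ht.2
  have e₂ : ∀ t ∈ Icc b c, γ t = γ₂ t := by
    intro t ht
    rcases ht.1.eq_or_lt with rfl | hlt
    · rw [e₁ b ⟨hab, le_rfl⟩, h]
    · exact if_neg (not_le.2 hlt)
  have d₁ : IsMIntegralCurveOn γ v (Icc a b) := by
    intro t ht
    have := (h₁ t ht).congr_of_eventuallyEq (eventually_of_mem self_mem_nhdsWithin e₁) (e₁ t ht)
    rwa [← e₁ t ht] at this
  have d₂ : IsMIntegralCurveOn γ v (Icc b c) := by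
    intro t ht
    have := (h₂ t ht).congr_of_eventuallyEq (eventually_of_mem self_mem_nhdsWithin e₂) (e₂ t ht)
    rwa [← e₂ t ht] at this
  intro t ht
  rcases lt_trichotomy t b with hlt | rfl | hlt
  · refine (d₁ t ⟨ht.1, hlt.le⟩).mono_of_mem_nhdsWithin ?_
    filter_upwards [self_mem_nhdsWithin, mem_nhdsWithin_of_mem_nhds (Iio_mem_nhds hlt)]
      with s hs hs' using ⟨hs.1, le_of_lt hs'⟩
  · rw [← Icc_union_Icc_eq_Icc hab hbc]
    exact (d₁ t ⟨hab, le_rfl⟩).union (d₂ t ⟨le_rfl, hbc⟩)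
  · refine (d₂ t ⟨hlt.le, ht.2⟩).mono_of_mem_nhdsWithin ?_
    filter_upwards [self_mem_nhdsWithin, mem_nhdsWithin_of_mem_nhds (Ioi_mem_nhds hlt)]
      with s hs hs' using ⟨le_of_lt hs', hs.2⟩

theorem IsMIntegralCurveOn.comp_add_Icc {γ : ℝ → M} {a b d : ℝ}
    (h : IsMIntegralCurveOn γ v (Icc a b)) :
    IsMIntegralCurveOn (fun t => γ (t + d)) v (Icc (a - d) (b - d)) :=
  (h.comp_add d).mono fun t ht => by
    simp only [mem_ofPred_eq]
    exact ⟨by linarith [ht.1], by linarith [ht.2]⟩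

variable [IsManifold I 1 M] [CompleteSpace E] [I.Boundaryless]

/-- Integral curves on a closed interval are determined by their initial point. -/
theorem IsMIntegralCurveOn.eqOn_Icc [T2Space M]
    (hv : ContMDiff I I.tangent 1 (fun x => (⟨x, v x⟩ : TangentBundle I M)))
    {γ γ' : ℝ → M} {T : ℝ} (h : IsMIntegralCurveOn γ v (Icc 0 T))
    (h' : IsMIntegralCurveOn γ' v (Icc 0 T)) (h0 : γ 0 = γ' 0) : EqOn γ γ' (Icc 0 T) := by
  rcases lt_or_ge 0 T with hT | hT
  swap
  · intro t ht
    have : t = 0 := le_antisymm (ht.2.trans hT) ht.1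
    rw [this, h0]
  -- The uniqueness theorem concerns open intervals with the initial time inside. Both curves are
  -- therefore prolonged to negative times by one local integral curve `η`; the endpoint `T` is
  -- recovered by continuity.
  obtain ⟨η, hη0, hη⟩ := exists_isMIntegralCurveAt_of_contMDiffAt_boundaryless (I := I) 0
    (hv.contMDiffAt (x := γ 0))
  obtain ⟨ε, hε, hη⟩ := isMIntegralCurveAt_iff'.1 hη
  have hη' : IsMIntegralCurveOn η v (Icc (-(ε / 2)) 0) := hη.mono fun t ht => by
    rw [Real.ball_eq_Ioo]
    exact ⟨by linarith [ht.1], by linarith [ht.2]⟩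
  have k := (hη'.concat (by linarith) hT.le h hη0).mono (Ioo_subset_Icc_self)
  have k' := (hη'.concat (by linarith) hT.le h' (hη0.trans h0)).mono (Ioo_subset_Icc_self)
  have key := isMIntegralCurveOn_Ioo_eqOn_of_contMDiff_boundaryless (t₀ := 0)
    ⟨by linarith, hT⟩ hv k k' (by simp)
  have hIoo : EqOn γ γ' (Ioo 0 T) := by
    intro t ht
    have := key (show t ∈ Ioo (-(ε / 2)) T from ⟨by linarith [ht.1], ht.2⟩)
    simpa [not_le.2 ht.1] using this
  exact hIoo.of_subset_closure h.continuousOn h'.continuousOn Ioo_subset_Icc_self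
    (by rw [closure_Ioo hT.ne])

end ManifoldFlow

/-! ### Vector fields in charts, local flows on manifolds, openness of the time-one domain -/

section ChartField

variable {E : Type*} [NormedAddCommGroup E] [NormedSpace ℝ E]
  {H : Type*} [TopologicalSpace H] {I : ModelWithCorners ℝ E H}
  {M : Type*} [TopologicalSpace M] [ChartedSpace H M]
  {v : (x : M) → TangentSpace I x}

/-- The vector field `v` read in the chart centred at `m`. -/
noncomputable def chartField (v : (x : M) → TangentSpace I x) (m : M) (z : E) : E :=
  mfderiv I 𝓘(ℝ, E) (extChartAt I m) ((extChartAt I m).symm z) (v ((extChartAt I m).symm z))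

variable [IsManifold I 1 M] [I.Boundaryless]

theorem mfderiv_extChartAt_symm_apply {m : M} {z : E} (hz : z ∈ (extChartAt I m).target)
    (w : TangentSpace I ((extChartAt I m).symm z)) :
    mfderiv 𝓘(ℝ, E) I (extChartAt I m).symm z
      (mfderiv I 𝓘(ℝ, E) (extChartAt I m) ((extChartAt I m).symm z) w) = w := by
  have h := mfderivWithin_extChartAt_symm_comp_mfderiv_extChartAt hz
  rw [I.range_eq_univ, mfderivWithin_univ] at h
  exact congrArg (fun L => L w) h

theorem mdifferentiableAt_extChartAt_symm {m : M} {z : E} (hz : z ∈ (extChartAt I m).target) :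
    MDifferentiableAt 𝓘(ℝ, E) I (extChartAt I m).symm z := by
  have h := mdifferentiableWithinAt_extChartAt_symm hz
  rwa [I.range_eq_univ, mdifferentiableWithinAt_univ] at h

/-- A solution of the differential equation in a chart gives an integral curve. -/
theorem hasMFDerivWithinAt_extChartAt_symm_comp {m : M} {α : ℝ → E} {s : Set ℝ} {t : ℝ}
    (hα : HasDerivWithinAt α (chartField v m (α t)) s t)
    (ht : α t ∈ (extChartAt I m).target) :
    HasMFDerivWithinAt 𝓘(ℝ, ℝ) I ((extChartAt I m).symm ∘ α) s t
      ((1 : ℝ →L[ℝ] ℝ).smulRight (v (((extChartAt I m).symm ∘ α) t))) := by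
  have h1 : HasMFDerivAt 𝓘(ℝ, E) I (extChartAt I m).symm (α t) _ :=
    (mdifferentiableAt_extChartAt_symm ht).hasMFDerivAt
  have h2 : HasMFDerivWithinAt 𝓘(ℝ, ℝ) 𝓘(ℝ, E) α s t _ := hα.hasFDerivWithinAt.hasMFDerivWithinAt
  have h := HasMFDerivAt.comp_hasMFDerivWithinAt t h1 h2
  refine h.congr_mfderiv (ContinuousLinearMap.ext fun r => ?_)
  have h3 := mfderiv_extChartAt_symm_apply ht (v ((extChartAt I m).symm (α t)))
  change (show E →L[ℝ] E from mfderiv 𝓘(ℝ, E) I (extChartAt I m).symm (α t))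
      ((show ℝ from r) • (chartField v m (α t))) =
    (show ℝ from r) • (show E from v ((extChartAt I m).symm (α t)))
  rw [map_smul]
  exact congrArg (fun w : E => (show ℝ from r) • w) h3

/-- Near the centre, `chartField v m` is the fibre component of `v` in the tangent trivialization at
`m`, composed with the inverse chart. -/
theorem contDiffAt_chartField {m : M}
    (hv : ContMDiffAt I I.tangent 1 (fun x => (⟨x, v x⟩ : TangentBundle I M)) m) :
    ContDiffAt ℝ 1 (chartField v m) (extChartAt I m m) := by
  rw [← contMDiffAt_iff_contDiffAt]
  have h1 : ContMDiffAt 𝓘(ℝ, E) I 1 (extChartAt I m).symm (extChartAt I m m) :=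
    (contMDiffOn_extChartAt_symm m).contMDiffAt (extChartAt_target_mem_nhds m)
  have hm : (extChartAt I m).symm (extChartAt I m m) = m := extChartAt_to_inv m
  have h2 := ContMDiffAt.comp (extChartAt I m m) (by rw [hm]; exact hv) h1
  rw [contMDiffAt_totalSpace] at h2
  refine h2.2.congr_of_eventuallyEq ?_
  filter_upwards [extChartAt_target_mem_nhds (I := I) m] with z hz
  simp only [Function.comp_apply, hm]
  exact (trivializationAt_tangent_snd ((extChartAt I m).map_target hz) _).symm

variable [CompleteSpace E]

/-- The local flow of a `C¹` vector field on a manifold, on an interval `[0, ε]`. Its time-`ε` map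
is differentiable at `m` if `v m = 0`. -/
theorem exists_local_flow (m : M)
    (hv : ContMDiffAt I I.tangent 1 (fun x => (⟨x, v x⟩ : TangentBundle I M)) m) :
    ∃ ε > (0 : ℝ), ∃ Φ : M → ℝ → M,
      (∀ᶠ p in 𝓝 m, Φ p 0 = p ∧ IsMIntegralCurveOn (Φ p) v (Icc 0 ε) ∧
        ∀ t ∈ Icc 0 ε, ContinuousAt (fun q => Φ q t) p) ∧
      (v m = 0 → Φ m ε = m ∧ MDifferentiableAt I I (fun q => Φ q ε) m) := by
  obtain ⟨ε, hε, r, hr, α, hα, hcont, heq⟩ :=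
    exists_local_flow_of_contDiffAt (contDiffAt_chartField hv) (extChartAt_target_mem_nhds m)
  set φ := extChartAt I m with hφ
  have hφm : φ.symm (φ m) = m := extChartAt_to_inv m
  have hnear : ∀ᶠ p in 𝓝 m, p ∈ φ.source ∧ φ p ∈ Metric.ball (φ m) r :=
    Eventually.and (extChartAt_source_mem_nhds m)
      ((continuousAt_extChartAt m).eventually_mem (Metric.ball_mem_nhds _ hr))
  refine ⟨ε, hε, fun p t => φ.symm (α (φ p) t), ?_, fun hm => ?_⟩
  · filter_upwards [hnear] with p hp
    obtain ⟨h0, h1⟩ := hα _ hp.2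
    refine ⟨by rw [h0, φ.left_inv hp.1], fun t ht => ?_, fun t ht => ?_⟩
    · exact hasMFDerivWithinAt_extChartAt_symm_comp (h1 t ht).2 (h1 t ht).1
    · have c1 : ContinuousAt φ p := continuousAt_extChartAt' hp.1
      have c2 : ContinuousAt (fun x => α x t) (φ p) :=
        (hcont t ht).continuousAt (Metric.isOpen_ball.mem_nhds hp.2)
      have c3 : ContinuousAt φ.symm (α (φ p) t) := continuousAt_extChartAt_symm'' (h1 t ht).1
      exact ContinuousAt.comp (f := fun q => α (φ q) t) c3
        (ContinuousAt.comp (f := φ) (g := fun x => α x t) c2 c1)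
  · have hf0 : chartField v m (φ m) = 0 := by
      change mfderiv I 𝓘(ℝ, E) (extChartAt I m) (φ.symm (φ m)) (v (φ.symm (φ m))) = 0
      rw [hφm, hm]
      exact map_zero _
    obtain ⟨hfix, L, hL⟩ := heq hf0
    refine ⟨by simp only [hfix, hφm], ?_⟩
    have d1 : MDifferentiableAt I 𝓘(ℝ, E) φ m :=
      mdifferentiableAt_extChartAt (mem_chart_source H m)
    have d2 : MDifferentiableAt 𝓘(ℝ, E) 𝓘(ℝ, E) (fun x => α x ε) (φ m) :=
      hL.differentiableAt.mdifferentiableAt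
    have d3 : MDifferentiableAt 𝓘(ℝ, E) I φ.symm (α (φ m) ε) := by
      rw [hfix]
      exact mdifferentiableAt_extChartAt_symm (mem_extChartAt_target m)
    exact MDifferentiableAt.comp m (f := fun q => α (φ q) ε) d3
      (MDifferentiableAt.comp m (f := φ) (g := fun x => α x ε) d2 d1)

/-- The set of points whose integral curve exists on `[0, 1]` is open. -/
theorem isOpen_setOf_exists_isMIntegralCurveOn_Icc [T2Space M]
    (hv : ContMDiff I I.tangent 1 (fun x => (⟨x, v x⟩ : TangentBundle I M))) :
    IsOpen {p : M | ∃ γ : ℝ → M, γ 0 = p ∧ IsMIntegralCurveOn γ v (Icc 0 1)} := by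
  rw [isOpen_iff_mem_nhds]
  rintro p ⟨c, rfl, hc⟩
  -- Existence up to time `t` is strengthened by control of the end point, without which the local
  -- flow around `c t` could not be attached.
  let P : ℝ → Prop := fun t => ∀ W ∈ 𝓝 (c t), ∀ᶠ p in 𝓝 (c 0),
    ∃ γ : ℝ → M, γ 0 = p ∧ IsMIntegralCurveOn γ v (Icc 0 t) ∧ γ t ∈ W
  -- One local flow around `c t` serves all `s` close to `t`, before or after it. Since `s' - s < 2
  -- δ`, taking `δ ≤ ε / 2` keeps the elapsed time within the life span `ε`.
  have step : ∀ t ∈ Icc (0 : ℝ) 1, ∃ δ > (0 : ℝ), ∀ s ∈ Icc (0 : ℝ) 1, |s - t| < δ →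
      P s → ∀ s' ∈ Icc s 1, s' < t + δ → P s' := by
    intro t ht
    obtain ⟨ε, hε, Φ, hΦ, -⟩ := exists_local_flow (c t) hv.contMDiffAt
    rw [eventually_nhds_iff] at hΦ
    obtain ⟨U, hU, hUo, hUc⟩ := hΦ
    obtain ⟨η, hη, hηU⟩ := Metric.mem_nhdsWithin_iff.1
      ((hc.continuousOn t ht).preimage_mem_nhdsWithin (hUo.mem_nhds hUc))
    refine ⟨min η (ε / 2), lt_min hη (half_pos hε), fun s hs hst hP s' hs' hs't W hW => ?_⟩
    have hsU : c s ∈ U := hηU ⟨by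
      rw [Metric.mem_ball, Real.dist_eq]; exact hst.trans_le (min_le_left _ _), hs⟩
    have hlen : s' - s ∈ Icc 0 ε := by
      refine ⟨by linarith [hs'.1], ?_⟩
      have h1 := abs_lt.1 (hst.trans_le (min_le_right _ _))
      have h2 := min_le_right η (ε / 2)
      linarith [h1.1]
    obtain ⟨hΦ0, hΦi, hΦc⟩ := hU _ hsU
    have hcs : IsMIntegralCurveOn (fun τ => c (τ + s)) v (Icc 0 (s' - s)) := by
      have := (hc.mono (Icc_subset_Icc hs.1 hs'.2 : Icc s s' ⊆ _)).comp_add_Icc (d := s)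
      rwa [sub_self] at this
    -- By uniqueness the local flow follows `c`, so continuity of its time `s' - s` map sends points
    -- near `c s` into the given neighbourhood of `c s'`.
    have hend : Φ (c s) (s' - s) = c s' := by
      have := IsMIntegralCurveOn.eqOn_Icc hv (hΦi.mono (Icc_subset_Icc_right hlen.2)) hcs
        (by simp only [hΦ0, zero_add]) (right_mem_Icc.2 hlen.1)
      simpa using this
    have hW' : ∀ᶠ q in 𝓝 (c s), q ∈ U ∧ Φ q (s' - s) ∈ W := by
      refine Eventually.and (hUo.mem_nhds hsU) ((hΦc _ hlen).eventually_mem ?_)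
      rwa [hend]
    filter_upwards [hP _ hW'] with p hp
    obtain ⟨γ, h0, hγ, hγs⟩ := hp
    obtain ⟨hΦ0', hΦi', -⟩ := hU _ hγs.1
    have hcurve : IsMIntegralCurveOn (fun τ => Φ (γ s) (τ - s)) v (Icc s s') := by
      have := (hΦi'.mono (Icc_subset_Icc_right hlen.2)).comp_add_Icc (d := -s)
      simpa [sub_eq_add_neg] using this
    refine ⟨_, ?_, hγ.concat hs.1 hs'.1 hcurve (by simp [hΦ0']), ?_⟩
    · simpa [hs.1] using h0
    · rcases hs'.1.eq_or_lt with h | h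
      · subst h
        simpa [hΦ0'] using hγs.2
      · simpa [not_le.2 h] using hγs.2
  have h0 : P 0 := by
    intro W hW
    filter_upwards [hW] with p hp
    refine ⟨fun _ => p, rfl, ?_, hp⟩
    obtain ⟨η, hη0, hη⟩ := exists_isMIntegralCurveAt_of_contMDiffAt_boundaryless (I := I) 0
      (hv.contMDiffAt (x := p))
    obtain ⟨ε, hε, hη⟩ := isMIntegralCurveAt_iff'.1 hη
    intro t ht
    -- The interval is the single point `0`, on which the constant curve agrees with a genuine
    -- integral curve through `p`.
    rw [Icc_self] at ht ⊢
    rw [mem_singleton_iff.1 ht]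
    have h1 := (hη 0 (Metric.mem_ball_self hε)).mono
      (singleton_subset_iff.2 (Metric.mem_ball_self hε))
    rw [hη0] at h1
    exact h1.congr_of_eventuallyEq (eventually_of_mem self_mem_nhdsWithin fun s hs => by
      rw [mem_singleton_iff.1 hs, hη0]) hη0.symm
  have hall : Icc (0 : ℝ) 1 ⊆ {t | ∀ s ∈ Icc 0 t, P s} := by
    intro t₁ ht₁
    by_contra hne
    -- Continuous induction: `step` at `sSup S` starts from a point of `S` less than `δ` before it
    -- and carries `P` beyond it. So the supremum is `1` and is attained.
    let S : Set ℝ := {t | t ∈ Icc (0 : ℝ) 1 ∧ ∀ s ∈ Icc 0 t, P s}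
    have hS0 : (0 : ℝ) ∈ S := ⟨⟨le_rfl, zero_le_one⟩, fun s hs => by
      rw [Icc_self] at hs; rw [mem_singleton_iff.1 hs]; exact h0⟩
    have hbdd : BddAbove S := ⟨1, fun t ht => ht.1.2⟩
    have hT0 : 0 ≤ sSup S := le_csSup hbdd hS0
    have hT1 : sSup S ≤ 1 := csSup_le ⟨0, hS0⟩ fun t ht => ht.1.2
    obtain ⟨δ, hδ, hstep⟩ := step (sSup S) ⟨hT0, hT1⟩
    obtain ⟨s, hsS, hs⟩ := exists_lt_of_lt_csSup ⟨0, hS0⟩ (show sSup S - δ < sSup S by linarith)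
    have hle := le_csSup hbdd hsS
    have hP' : ∀ s' ∈ Icc (0 : ℝ) 1, s' < sSup S + δ → P s' := by
      intro s' hs' hlt
      rcases le_total s' s with h | h
      · exact hsS.2 s' ⟨hs'.1, h⟩
      · exact hstep s hsS.1 (by rw [abs_lt]; constructor <;> linarith)
          (hsS.2 s ⟨hsS.1.1, le_rfl⟩) s' ⟨h, hs'.2⟩ hlt
    have hmem : min 1 (sSup S + δ / 2) ∈ S := by
      have h1 := min_le_left 1 (sSup S + δ / 2)
      have h2 := min_le_right 1 (sSup S + δ / 2)
      refine ⟨⟨le_min zero_le_one (by linarith), h1⟩, fun s' hs' =>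
        hP' s' ⟨hs'.1, hs'.2.trans h1⟩ (by linarith [hs'.2])⟩
    have h3 := le_csSup hbdd hmem
    have h4 : min 1 (sSup S + δ / 2) = 1 := by
      rcases min_choice 1 (sSup S + δ / 2) with h | h
      · exact h
      · rw [h] at h3; linarith
    rw [h4] at hmem
    exact hne fun s hs => hmem.2 s ⟨hs.1, hs.2.trans ht₁.2⟩
  have hP1 : P 1 := hall (right_mem_Icc.2 zero_le_one) 1 (right_mem_Icc.2 zero_le_one)
  filter_upwards [hP1 univ univ_mem] with p hp
  obtain ⟨γ, h0, hγ, -⟩ := hp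
  exact ⟨γ, h0, hγ⟩

end ChartField

/-! ### Manifold derivatives as maps between model spaces -/

section ModelDerivative

variable {E : Type*} [NormedAddCommGroup E] [NormedSpace ℝ E]
  {H : Type*} [TopologicalSpace H] {I : ModelWithCorners ℝ E H}
  {M : Type*} [TopologicalSpace M] [ChartedSpace H M]
  {E' : Type*} [NormedAddCommGroup E'] [NormedSpace ℝ E']
  {H' : Type*} [TopologicalSpace H'] {I' : ModelWithCorners ℝ E' H'}
  {M' : Type*} [TopologicalSpace M'] [ChartedSpace H' M']
  {E'' : Type*} [NormedAddCommGroup E''] [NormedSpace ℝ E'']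
  {H'' : Type*} [TopologicalSpace H''] {I'' : ModelWithCorners ℝ E'' H''}
  {M'' : Type*} [TopologicalSpace M''] [ChartedSpace H'' M'']

/-- The derivative of a map between manifolds, as a map between the model vector spaces. -/
noncomputable def modelDeriv (I : ModelWithCorners ℝ E H) (I' : ModelWithCorners ℝ E' H')
    (f : M → M') (x : M) : E →L[ℝ] E' :=
  mfderiv I I' f x

theorem HasMFDerivAt.modelDeriv_eq {f : M → M'} {x : M} {L : E →L[ℝ] E'}
    (h : HasMFDerivAt I I' f x L) : modelDeriv I I' f x = L :=
  h.mfderiv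

theorem MDifferentiableAt.hasMFDerivAt_modelDeriv {f : M → M'} {x : M}
    (h : MDifferentiableAt I I' f x) :
    HasMFDerivAt I I' f x (modelDeriv (E := E) (E' := E') I I' f x) :=
  h.hasMFDerivAt

/-- The intermediate point `y` is separate from `f x` because the two are often equal only
propositionally, as are `g⁻¹ g` and `ε(β(g))`. With model spaces as domain and codomain no transport
is needed. -/
theorem modelDeriv_comp {g : M' → M''} {f : M → M'} {x : M} {y : M'} (hy : f x = y)
    (hg : MDifferentiableAt I' I'' g y) (hf : MDifferentiableAt I I' f x) :
    modelDeriv I I'' (fun z => g (f z)) x = (modelDeriv I' I'' g y).comp (modelDeriv I I' f x) := by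
  subst hy
  exact mfderiv_comp x hg hf

theorem modelDeriv_comp_apply {g : M' → M''} {f : M → M'} {x : M} {y : M'} (hy : f x = y)
    (hg : MDifferentiableAt I' I'' g y) (hf : MDifferentiableAt I I' f x) (u : E) :
    modelDeriv I I'' (fun z => g (f z)) x u = modelDeriv I' I'' g y (modelDeriv I I' f x u) := by
  rw [modelDeriv_comp hy hg hf]; rfl

theorem Filter.EventuallyEq.modelDeriv_eq {f g : M → M'} {x : M} (h : f =ᶠ[𝓝 x] g) :
    modelDeriv I I' f x = modelDeriv I I' g x :=
  h.mfderiv_eq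

theorem modelDeriv_const {c : M'} {x : M} : modelDeriv I I' (fun _ : M => c) x = 0 :=
  mfderiv_const

theorem modelDeriv_id {x : M} : modelDeriv I I (fun y : M => y) x = ContinuousLinearMap.id ℝ E :=
  mfderiv_id

theorem modelDeriv_prodMk {f : M → M'} {g : M → M''} {x : M} (hf : MDifferentiableAt I I' f x)
    (hg : MDifferentiableAt I I'' g x) :
    modelDeriv I (I'.prod I'') (fun y => (f y, g y)) x =
      (modelDeriv I I' f x).prod (modelDeriv I I'' g x) :=
  mfderiv_prodMk hf hg

theorem HasDerivAt.modelDeriv_eq {f : ℝ → E'} {t : ℝ} {y : E'} (h : HasDerivAt f y t) (r : ℝ) :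
    modelDeriv 𝓘(ℝ, ℝ) 𝓘(ℝ, E') f t r = r • y := by
  rw [HasMFDerivAt.modelDeriv_eq h.hasFDerivAt.hasMFDerivAt]
  simp

theorem tangentBundle_mk_congr {x y : M} (h : x = y) {v : TangentSpace I x} {w : TangentSpace I y}
    (hv : (show E from v) = (show E from w)) :
    (⟨x, v⟩ : TangentBundle I M) = ⟨y, w⟩ := by
  subst h
  exact congrArg _ hv

theorem tangentBundle_snd_eq {p q : TangentBundle I M} (h : p = q) :
    (show E from p.2) = (show E from q.2) := by
  subst h; rfl

end ModelDerivative

/-! ### Coordinates, smooth maps and tangent vectors of the vertical bundles -/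

namespace VertData

variable {EZ : Type*} [NormedAddCommGroup EZ] [NormedSpace ℝ EZ]
  {Z : Type*} [TopologicalSpace Z] [ChartedSpace EZ Z]
  {EM : Type*} [NormedAddCommGroup EM] [NormedSpace ℝ EM]
  {M : Type*} [TopologicalSpace M] [ChartedSpace EM M]
  {EN : Type*} [NormedAddCommGroup EN] [NormedSpace ℝ EN]
  {N : Type*} [TopologicalSpace N] [ChartedSpace EN N]
  (S : VertData EZ Z EM M EN N)
  [IsManifold 𝓘(ℝ, EM) ∞ M] [IsManifold 𝓘(ℝ, EN) ∞ N]
  [FiniteDimensional ℝ EM] [FiniteDimensional ℝ EN]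

/-- The fibre coordinate of the local trivialization centred at `z₀`. -/
noncomputable def fibCoord (z₀ : Z) (p : S.Total) : VertModel EM EN := S.trivMap z₀ p.1 p.2

theorem contMDiff_totalProj : ContMDiff S.model 𝓘(ℝ, EZ) ∞ (fun p : S.Total => p.1) :=
  Bundle.contMDiff_proj S.Fiber

variable [IsManifold 𝓘(ℝ, EZ) ∞ Z]

theorem contMDiffAt_fibCoord {z₀ : Z} {p : S.Total} (hp : p.1 ∈ S.trivSet z₀) :
    ContMDiffAt S.model 𝓘(ℝ, VertModel EM EN) ∞ (S.fibCoord z₀) p := by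
  have h := (trivializationAt (VertModel EM EN) S.Fiber z₀).contMDiffOn (IB := 𝓘(ℝ, EZ)) (n := ∞)
  have h2 := h.contMDiffAt ((trivializationAt (VertModel EM EN) S.Fiber z₀).open_source.mem_nhds
    ((trivializationAt (VertModel EM EN) S.Fiber z₀).mem_source.2 hp))
  exact contMDiffAt_snd.comp p h2

theorem mdifferentiableAt_totalProj (p : S.Total) :
    MDifferentiableAt S.model 𝓘(ℝ, EZ) (fun p : S.Total => p.1) p :=
  S.contMDiff_totalProj.mdifferentiableAt (by simp)

theorem mdifferentiableAt_fibCoord {z₀ : Z} {p : S.Total} (hp : p.1 ∈ S.trivSet z₀) :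
    MDifferentiableAt S.model 𝓘(ℝ, VertModel EM EN) (S.fibCoord z₀) p :=
  (S.contMDiffAt_fibCoord hp).mdifferentiableAt (by simp)

/-- Near `p` the frame is invertible, depends smoothly on the base point and takes a vertical
vector, read in the chart, to `(0, fibCoord)`. The inclusion is thus the inverse frame applied to
`(0, fibCoord)`. -/
theorem contMDiff_incl : ContMDiff S.model 𝓘(ℝ, EM).tangent ∞ S.incl := by
  intro p
  rw [contMDiffAt_totalSpace]
  refine ⟨(S.contMDiff_base.comp S.contMDiff_totalProj).contMDiffAt, ?_⟩
  have hp : p.1 ∈ S.trivSet p.1 := S.mem_trivSet p.1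
  have hev : ∀ᶠ q : S.Total in 𝓝 p, q.1 ∈ S.trivSet p.1 :=
    S.contMDiff_totalProj.continuous.continuousAt.eventually_mem
      ((S.isOpen_trivSet p.1).mem_nhds hp)
  have h1 : ContMDiffAt S.model 𝓘(ℝ, EM →L[ℝ] EN × VertModel EM EN) ∞
      (fun q : S.Total => S.frame p.1 q.1) p :=
    ContMDiffAt.comp (I' := 𝓘(ℝ, EZ)) p ((S.contMDiffOn_frame p.1).contMDiffAt
      ((S.isOpen_chartSet p.1).mem_nhds hp.1)) S.contMDiff_totalProj.contMDiffAt
  have h2 : ContMDiffAt S.model 𝓘(ℝ, EN × VertModel EM EN →L[ℝ] EM) ∞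
      (fun q : S.Total => (S.frame p.1 q.1).inverse) p := by
    have : CompleteSpace EM := FiniteDimensional.complete ℝ EM
    obtain ⟨B, hB⟩ := hp.2
    have h3 : ContDiffAt ℝ ∞ (ContinuousLinearMap.inverse :
        (EM →L[ℝ] EN × VertModel EM EN) → _) (S.frame p.1 p.1) := by
      rw [← hB]
      exact contDiffAt_map_inverse B
    exact ContMDiffAt.comp p h3.contMDiffAt h1
  have h4 : ContMDiffAt S.model 𝓘(ℝ, EN × VertModel EM EN) ∞
      (fun q : S.Total => ((0 : EN), S.fibCoord p.1 q)) p :=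
    contMDiffAt_const.prodMk_space (S.contMDiffAt_fibCoord hp)
  refine (h2.clm_apply h4).congr_of_eventuallyEq ?_
  filter_upwards [hev] with q hq
  refine (trivializationAt_tangent_snd (I := 𝓘(ℝ, EM)) hq.1.1 (S.fiberIncl q.1 q.2)).trans ?_
  have h5 := S.frame_chartDeriv hq q.2
  obtain ⟨B, hB⟩ := hq.2
  change S.chartDeriv p.1 q.1 (S.fiberIncl q.1 q.2) =
    (S.frame p.1 q.1).inverse (0, S.trivMap p.1 q.1 q.2)
  rw [← h5, ← hB, ContinuousLinearMap.inverse_equiv]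
  exact (B.symm_apply_apply _).symm

/-- The fibre coordinate factors through `TM`, so smoothness of a map into the total space can be
tested after the inclusion. -/
theorem fibCoord_eq_compl (z₀ : Z) (p : S.Total) (hp : p.1 ∈ S.chartSet z₀) :
    S.fibCoord z₀ p =
      S.compl z₀ (trivializationAt EM (TangentSpace 𝓘(ℝ, EM)) (S.base z₀) (S.incl p)).2 := by
  rw [show (trivializationAt EM (TangentSpace 𝓘(ℝ, EM)) (S.base z₀) (S.incl p)).2 =
    S.chartDeriv z₀ p.1 (S.fiberIncl p.1 p.2) from
      trivializationAt_tangent_snd (I := 𝓘(ℝ, EM)) hp.1 (S.fiberIncl p.1 p.2)]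
  rfl

section Maps

variable {EY : Type*} [NormedAddCommGroup EY] [NormedSpace ℝ EY]
  {HY : Type*} [TopologicalSpace HY] {IY : ModelWithCorners ℝ EY HY}
  {Y : Type*} [TopologicalSpace Y] [ChartedSpace HY Y]

/-- A map to the total space is smooth if its components in the base and in the tangent bundle of
`M` are. -/
theorem contMDiffAt_total {f : Y → S.Total} {y : Y}
    (h₁ : ContMDiffAt IY 𝓘(ℝ, EZ) ∞ (fun x => (f x).1) y)
    (h₂ : ContMDiffAt IY 𝓘(ℝ, EM).tangent ∞ (fun x => S.incl (f x)) y) :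
    ContMDiffAt IY S.model ∞ f y := by
  rw [contMDiffAt_totalSpace]
  refine ⟨h₁, ?_⟩
  rw [contMDiffAt_totalSpace] at h₂
  have h3 : ContMDiffAt IY 𝓘(ℝ, VertModel EM EN) ∞ (fun x => S.compl (f y).1
      (trivializationAt EM (TangentSpace 𝓘(ℝ, EM)) (S.base (f y).1) (S.incl (f x))).2) y :=
    (S.compl (f y).1).contMDiff.contMDiffAt.comp y h₂.2
  refine h3.congr_of_eventuallyEq ?_
  filter_upwards [h₁.continuousAt.eventually_mem
    ((S.isOpen_chartSet (f y).1).mem_nhds (S.mem_chartSet (f y).1))] with x hx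
  exact S.fibCoord_eq_compl _ _ hx

/-- A map to the total space is smooth if its base and fibre coordinates are. -/
theorem contMDiffAt_total_of_fibCoord {f : Y → S.Total} {y : Y}
    (h₁ : ContMDiffAt IY 𝓘(ℝ, EZ) ∞ (fun x => (f x).1) y)
    (h₂ : ContMDiffAt IY 𝓘(ℝ, VertModel EM EN) ∞ (fun x => S.fibCoord (f y).1 (f x)) y) :
    ContMDiffAt IY S.model ∞ f y := by
  rw [contMDiffAt_totalSpace]
  exact ⟨h₁, h₂⟩

end Maps

/-- Tangent vectors to the total space are determined by their base and fibre coordinates. -/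
theorem tangent_eq_zero {z₀ : Z} {p : S.Total} (hp : p.1 ∈ S.trivSet z₀)
    (u : EZ × VertModel EM EN)
    (h₁ : modelDeriv S.model 𝓘(ℝ, EZ) (fun q : S.Total => q.1) p u = 0)
    (h₂ : modelDeriv S.model 𝓘(ℝ, VertModel EM EN) (S.fibCoord z₀) p u = 0) : u = 0 := by
  set e := trivializationAt (VertModel EM EN) S.Fiber z₀ with he
  have hsrc : p ∈ e.source := e.mem_source.2 hp
  have d1 : MDifferentiableAt S.model S.model (fun q : S.Total => (q.1, S.fibCoord z₀ q)) p :=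
    (S.mdifferentiableAt_totalProj p).prodMk (S.mdifferentiableAt_fibCoord hp)
  have d2 : MDifferentiableAt S.model S.model e.toOpenPartialHomeomorph.symm
      (p.1, S.fibCoord z₀ p) := by
    have h := e.contMDiffOn_symm (IB := 𝓘(ℝ, EZ)) (n := ∞)
    exact (h.contMDiffAt (e.open_target.mem_nhds (e.map_source hsrc))).mdifferentiableAt (by simp)
  -- Differentiating `e⁻¹ ∘ e = id` expresses `u` as the image of its two components, both zero,
  -- under the derivative of `e⁻¹`.
  have h := modelDeriv_comp_apply (x := p) rfl d2 d1 u
  have hid : (fun q : S.Total => e.toOpenPartialHomeomorph.symm (q.1, S.fibCoord z₀ q)) =ᶠ[𝓝 p]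
      fun q => q := by
    filter_upwards [e.open_source.mem_nhds hsrc] with q hq
    exact e.toOpenPartialHomeomorph.left_inv hq
  rw [hid.modelDeriv_eq, modelDeriv_id, modelDeriv_prodMk (S.mdifferentiableAt_totalProj p)
    (S.mdifferentiableAt_fibCoord hp)] at h
  have h' : ((modelDeriv S.model 𝓘(ℝ, EZ) (fun q : S.Total => q.1) p).prod
      (modelDeriv S.model 𝓘(ℝ, VertModel EM EN) (S.fibCoord z₀) p)) u = 0 := Prod.ext h₁ h₂
  rw [h', map_zero] at h
  exact h

theorem tangent_ext {z₀ : Z} {p : S.Total} (hp : p.1 ∈ S.trivSet z₀)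
    {u w : EZ × VertModel EM EN}
    (h₁ : modelDeriv S.model 𝓘(ℝ, EZ) (fun q : S.Total => q.1) p u =
      modelDeriv S.model 𝓘(ℝ, EZ) (fun q : S.Total => q.1) p w)
    (h₂ : modelDeriv S.model 𝓘(ℝ, VertModel EM EN) (S.fibCoord z₀) p u =
      modelDeriv S.model 𝓘(ℝ, VertModel EM EN) (S.fibCoord z₀) p w) : u = w := by
  rw [← sub_eq_zero]
  refine S.tangent_eq_zero hp _ ?_ ?_ <;> rw [map_sub, sub_eq_zero] <;> assumption

/-- The line through `p` in its fibre, with direction `w`. -/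
noncomputable def fiberLine (p : S.Total) (w : S.Fiber p.1) (t : ℝ) : S.Total := ⟨p.1, p.2 + t • w⟩

theorem fibCoord_fiberLine (z₀ : Z) (p : S.Total) (w : S.Fiber p.1) (t : ℝ) :
    S.fibCoord z₀ (S.fiberLine p w t) = S.fibCoord z₀ p + t • S.trivMap z₀ p.1 w := by
  change S.trivMap z₀ p.1 (p.2 + t • w) = _
  rw [map_add, map_smul]; rfl

theorem contMDiff_fiberLine (p : S.Total) (w : S.Fiber p.1) :
    ContMDiff 𝓘(ℝ, ℝ) S.model ∞ (S.fiberLine p w) := by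
  intro t
  refine S.contMDiffAt_total_of_fibCoord contMDiffAt_const ?_
  simp only [fibCoord_fiberLine]
  exact (contDiff_const.add (contDiff_id.smul contDiff_const)).contMDiff.contMDiffAt

/-- The vertical lift of `w` at `p`. -/
noncomputable def vertLift (p : S.Total) (w : S.Fiber p.1) : EZ × VertModel EM EN :=
  modelDeriv 𝓘(ℝ, ℝ) S.model (S.fiberLine p w) 0 1

theorem fiberLine_zero (p : S.Total) (w : S.Fiber p.1) : S.fiberLine p w 0 = p := by
  simp [fiberLine]

/-- The derivative of a map along a vertical vector. -/
theorem modelDeriv_vertLift {EY : Type*} [NormedAddCommGroup EY] [NormedSpace ℝ EY]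
    {HY : Type*} [TopologicalSpace HY] {IY : ModelWithCorners ℝ EY HY}
    {Y : Type*} [TopologicalSpace Y] [ChartedSpace HY Y] {f : S.Total → Y} {p : S.Total}
    (hf : MDifferentiableAt S.model IY f p) (w : S.Fiber p.1) :
    modelDeriv S.model IY f p (S.vertLift p w) =
      modelDeriv 𝓘(ℝ, ℝ) IY (fun t => f (S.fiberLine p w t)) 0 1 :=
  (modelDeriv_comp_apply (S.fiberLine_zero p w) hf
    ((S.contMDiff_fiberLine p w).mdifferentiableAt (by simp)) 1).symm

theorem modelDeriv_proj_vertLift (p : S.Total) (w : S.Fiber p.1) :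
    modelDeriv S.model 𝓘(ℝ, EZ) (fun q : S.Total => q.1) p (S.vertLift p w) = 0 := by
  rw [S.modelDeriv_vertLift (S.mdifferentiableAt_totalProj p)]
  change modelDeriv 𝓘(ℝ, ℝ) 𝓘(ℝ, EZ) (fun _ : ℝ => p.1) 0 1 = 0
  rw [modelDeriv_const]; rfl

theorem modelDeriv_fibCoord_vertLift {z₀ : Z} {p : S.Total} (hp : p.1 ∈ S.trivSet z₀)
    (w : S.Fiber p.1) :
    modelDeriv S.model 𝓘(ℝ, VertModel EM EN) (S.fibCoord z₀) p (S.vertLift p w) =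
      S.trivMap z₀ p.1 w := by
  rw [S.modelDeriv_vertLift (S.mdifferentiableAt_fibCoord hp)]
  simp only [fibCoord_fiberLine]
  have h : HasDerivAt (fun t : ℝ => S.fibCoord z₀ p + t • S.trivMap z₀ p.1 w)
      (S.trivMap z₀ p.1 w) 0 := by
    simpa using ((hasDerivAt_id (0 : ℝ)).smul_const (S.trivMap z₀ p.1 w)).const_add
      (S.fibCoord z₀ p)
  rw [h.modelDeriv_eq, one_smul]

/-- The vectors in the kernel of the projection to the base are the vertical lifts. -/
theorem exists_eq_vertLift {p : S.Total} {u : EZ × VertModel EM EN}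
    (h : modelDeriv S.model 𝓘(ℝ, EZ) (fun q : S.Total => q.1) p u = 0) :
    ∃ w, u = S.vertLift p w := by
  have hp := S.mem_trivSet p.1
  obtain ⟨w, hw⟩ := (S.bijective_trivMap hp).2
    (modelDeriv S.model 𝓘(ℝ, VertModel EM EN) (S.fibCoord p.1) p u)
  refine ⟨w, S.tangent_ext hp ?_ ?_⟩
  · rw [h, modelDeriv_proj_vertLift]
  · rw [S.modelDeriv_fibCoord_vertLift hp, hw]

theorem fibCoord_dilate (z₀ : Z) (t : ℝ) (p : S.Total) :
    S.fibCoord z₀ (S.dilate t p) = t • S.fibCoord z₀ p :=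
  map_smul (S.trivMap z₀ p.1) t p.2

theorem contMDiff_dilate (t : ℝ) : ContMDiff S.model S.model ∞ (S.dilate t) := by
  intro p
  refine S.contMDiffAt_total_of_fibCoord S.contMDiff_totalProj.contMDiffAt ?_
  simp only [fibCoord_dilate]
  exact (contDiff_const_smul (n := ∞) t).contMDiff.contMDiffAt.comp p
    (S.contMDiffAt_fibCoord (z₀ := p.1) (S.mem_trivSet p.1))

theorem contMDiff_dilate_left (p : S.Total) :
    ContMDiff 𝓘(ℝ, ℝ) S.model ∞ (fun t => S.dilate t p) := by
  intro t
  refine S.contMDiffAt_total_of_fibCoord contMDiffAt_const ?_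
  simp only [fibCoord_dilate]
  exact (contDiff_id.smul contDiff_const).contMDiff.contMDiffAt

theorem dilate_dilate (s t : ℝ) (p : S.Total) : S.dilate s (S.dilate t p) = S.dilate (s * t) p := by
  exact congrArg (TotalSpace.mk p.1) (mul_smul s t p.2).symm

theorem dilate_one (p : S.Total) : S.dilate 1 p = p := by simp [dilate]

theorem t2Space_total [T2Space Z] : T2Space S.Total := by
  refine ⟨fun p q hpq => ?_⟩
  have hc : Continuous (fun p : S.Total => p.1) := S.contMDiff_totalProj.continuous
  by_cases h : p.1 = q.1
  · set e := trivializationAt (VertModel EM EN) S.Fiber p.1 with he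
    have hp : p ∈ e.source := e.mem_source.2 (S.mem_trivSet p.1)
    have hq : q ∈ e.source := e.mem_source.2 (h ▸ S.mem_trivSet p.1)
    have hne : e p ≠ e q := fun heq => hpq (e.injOn hp hq heq)
    obtain ⟨U, V, hU, hV, hpU, hqV, hUV⟩ := t2_separation hne
    refine ⟨e.source ∩ e ⁻¹' U, e.source ∩ e ⁻¹' V,
      e.toOpenPartialHomeomorph.isOpen_inter_preimage hU,
      e.toOpenPartialHomeomorph.isOpen_inter_preimage hV, ⟨hp, hpU⟩, ⟨hq, hqV⟩, ?_⟩
    exact (hUV.preimage e).mono inter_subset_right inter_subset_right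
  · obtain ⟨U, V, hU, hV, hpU, hqV, hUV⟩ := t2_separation h
    exact ⟨_, _, hU.preimage hc, hV.preimage hc, hpU, hqV, hUV.preimage _⟩

end VertData

/-! ### The Lie bracket in a chart -/

section Bracket

variable {E : Type*} [NormedAddCommGroup E] [NormedSpace ℝ E]
  {H : Type*} [TopologicalSpace H] {I : ModelWithCorners ℝ E H}
  {M : Type*} [TopologicalSpace M] [ChartedSpace H M]
  [IsManifold I 1 M] [I.Boundaryless]

theorem chartField_extChartAt_self (W : (x : M) → TangentSpace I x) (m : M) :
    chartField W m (extChartAt I m m) = W m := by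
  change mfderiv I 𝓘(ℝ, E) (extChartAt I m) ((extChartAt I m).symm (extChartAt I m m))
    (W ((extChartAt I m).symm (extChartAt I m m))) = W m
  rw [extChartAt_to_inv]
  have h := mfderiv_extChartAt_self (I := I) (x := m)
  exact congrArg (fun L : E →L[ℝ] E => L (W m)) h

/-- The derivatives of a chart and of its inverse are mutually inverse, so pulling back along the
latter is pushing forward along the former. -/
theorem mpullbackWithin_extChartAt_symm_eq_chartField (W : (x : M) → TangentSpace I x) (m : M)
    {z : E} (hz : z ∈ (extChartAt I m).target) :
    VectorField.mpullbackWithin 𝓘(ℝ, E) I (extChartAt I m).symm W (range I) z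
      = chartField W m z := by
  obtain ⟨D, hD⟩ := isInvertible_mfderivWithin_extChartAt_symm (I := I) hz
  have h := mfderivWithin_extChartAt_symm_comp_mfderiv_extChartAt (I := I) hz
  have h2 : mfderivWithin 𝓘(ℝ, E) I (extChartAt I m).symm (range I) z
      (show TangentSpace 𝓘(ℝ, E) z from chartField (E := E) W m z) = W ((extChartAt I m).symm z) :=
    congrArg (fun L => L (W ((extChartAt I m).symm z))) h
  rw [VectorField.mpullbackWithin_apply, ← h2, ← hD, ContinuousLinearMap.inverse_equiv]
  exact D.symm_apply_apply _

/-- The Lie bracket of vector fields, computed in a chart. -/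
theorem mlieBracket_eq_chartField (V W : (x : M) → TangentSpace I x) (m : M) :
    (show E from VectorField.mlieBracket I V W m) =
      fderiv ℝ (chartField W m) (extChartAt I m m) (show E from V m)
        - fderiv ℝ (chartField V m) (extChartAt I m m) (show E from W m) := by
  have key : VectorField.lieBracketWithin ℝ
      (VectorField.mpullbackWithin 𝓘(ℝ, E) I (extChartAt I m).symm V (range I))
      (VectorField.mpullbackWithin 𝓘(ℝ, E) I (extChartAt I m).symm W (range I))
      ((extChartAt I m).symm ⁻¹' univ ∩ range I) (extChartAt I m m) =
      VectorField.lieBracket ℝ (chartField V m) (chartField W m) (extChartAt I m m) := by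
    have aux : ∀ A B A' B' : E → E, A =ᶠ[𝓝 (extChartAt I m m)] A' →
        B =ᶠ[𝓝 (extChartAt I m m)] B' → VectorField.lieBracketWithin ℝ A B
          ((extChartAt I m).symm ⁻¹' univ ∩ range I) (extChartAt I m m) =
        VectorField.lieBracket ℝ A' B' (extChartAt I m m) := by
      intro A B A' B' hA hB
      rw [I.range_eq_univ, preimage_univ, inter_univ, VectorField.lieBracketWithin_univ]
      exact hA.lieBracket_vectorField_eq hB
    refine aux _ _ _ _ ?_ ?_ <;>
    · filter_upwards [extChartAt_target_mem_nhds (I := I) m] with z hz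
      exact mpullbackWithin_extChartAt_symm_eq_chartField _ m hz
  have h1 : (mfderiv I 𝓘(ℝ, E) (extChartAt I m) m).inverse =
      (ContinuousLinearMap.id ℝ E : E →L[ℝ] E) := by
    rw [mfderiv_extChartAt_self]
    exact ContinuousLinearMap.inverse_id
  have h2 : (show E from VectorField.mlieBracket I V W m) = VectorField.lieBracketWithin ℝ
      (VectorField.mpullbackWithin 𝓘(ℝ, E) I (extChartAt I m).symm V (range I))
      (VectorField.mpullbackWithin 𝓘(ℝ, E) I (extChartAt I m).symm W (range I))
      ((extChartAt I m).symm ⁻¹' univ ∩ range I) (extChartAt I m m) := by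
    refine Eq.trans (VectorField.mlieBracketWithin_apply (I := I) (s := univ)) ?_
    exact congrArg (fun L : E →L[ℝ] E => L _) h1
  rw [h2, key, VectorField.lieBracket_eq]
  simp only [chartField_extChartAt_self]

end Bracket

/-- A solution of Euler's equation `s h'(s) = 2 h(s)` is homogeneous of degree two. -/
theorem eq_sq_smul_of_euler {F : Type*} [NormedAddCommGroup F] [NormedSpace ℝ F] {h h' : ℝ → F}
    (hd : ∀ s, HasDerivAt h (h' s) s) (he : ∀ s, s • h' s = (2 : ℝ) • h s) {s : ℝ} (hs : 0 ≤ s) :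
    h s = s ^ 2 • h 1 := by
  -- At `s = 0` Euler's equation reads `0 = 2 h(0)`.
  have h0 : h 0 = 0 := by simpa using (he 0).symm
  rcases hs.eq_or_lt with rfl | hs
  · simp [h0]
  -- Euler's equation says precisely that `h(t) / t²` is constant on `t > 0`.
  have hk : ∀ t ∈ Ioi (0 : ℝ), HasDerivAt (fun t => (t ^ 2)⁻¹ • h t) 0 t := by
    intro t ht
    have ht' : t ≠ 0 := ne_of_gt ht
    have h1 : HasDerivAt (fun t : ℝ => (t ^ 2)⁻¹) (-(2 * t) / (t ^ 2) ^ 2) t := by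
      simpa using (hasDerivAt_pow 2 t).fun_inv (pow_ne_zero 2 ht')
    refine (h1.smul (hd t)).congr_deriv ?_
    have h2 : h' t = (2 / t) • h t := by
      rw [div_eq_inv_mul, mul_smul, ← he t, smul_smul, inv_mul_cancel₀ ht', one_smul]
    rw [h2, smul_smul, ← add_smul]
    convert zero_smul ℝ (h t) using 2
    field_simp
    ring
  have hc := (convex_Ioi (0 : ℝ)).is_const_of_fderivWithin_eq_zero (𝕜 := ℝ)
    (f := fun t => (t ^ 2)⁻¹ • h t)
    (fun t ht => (hk t ht).differentiableAt.differentiableWithinAt)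
    (fun t ht => by
      rw [fderivWithin_of_isOpen isOpen_Ioi ht, (hk t ht).hasFDerivAt.fderiv]
      ext; simp)
    (mem_Ioi.2 hs) (mem_Ioi.2 zero_lt_one)
  simp only [one_pow, inv_one, one_smul] at hc
  rw [← hc, smul_smul, mul_inv_cancel₀ (pow_ne_zero 2 hs.ne'), one_smul]

/-! ### From the bracket identity to homogeneity of degree two -/

namespace VertData

variable {EZ : Type*} [NormedAddCommGroup EZ] [NormedSpace ℝ EZ]
  {Z : Type*} [TopologicalSpace Z] [ChartedSpace EZ Z]
  {EM : Type*} [NormedAddCommGroup EM] [NormedSpace ℝ EM]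
  {M : Type*} [TopologicalSpace M] [ChartedSpace EM M]
  {EN : Type*} [NormedAddCommGroup EN] [NormedSpace ℝ EN]
  {N : Type*} [TopologicalSpace N] [ChartedSpace EN N]
  (S : VertData EZ Z EM M EN N)
  [IsManifold 𝓘(ℝ, EM) ∞ M] [IsManifold 𝓘(ℝ, EN) ∞ N]
  [FiniteDimensional ℝ EM] [FiniteDimensional ℝ EN] [IsManifold 𝓘(ℝ, EZ) ∞ Z]

theorem isManifold_total : IsManifold S.model ∞ S.Total :=
  inferInstance

theorem isManifold_total_one : IsManifold S.model 1 S.Total :=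
  have := S.isManifold_total
  IsManifold.of_le (n := ∞) (by simp)

/-- The preferred chart at `p` depends on `p` only through its base point, so a single chart serves
a whole ray in a fibre. -/
theorem extChartAt_total (p q : S.Total) :
    extChartAt S.model p q = (extChartAt 𝓘(ℝ, EZ) p.1 q.1, S.fibCoord p.1 q) := rfl

theorem extChartAt_total_source (p : S.Total) :
    (extChartAt S.model p).source ⊆ {q | q.1 ∈ S.trivSet p.1 ∧
      q.1 ∈ (extChartAt 𝓘(ℝ, EZ) p.1).source} := by
  intro q hq
  rw [FiberBundle.extChartAt] at hq
  simp only [PartialEquiv.trans_source, mem_inter_iff, mem_preimage] at hq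
  have h1 : q ∈ (trivializationAt (VertModel EM EN) S.Fiber p.1).source := hq.1
  rw [Trivialization.mem_source] at h1
  exact ⟨h1, hq.2.1⟩

theorem modelDeriv_extChartAt_total_snd {p q : S.Total} (hq : q ∈ (extChartAt S.model p).source)
    (u : EZ × VertModel EM EN) :
    (modelDeriv S.model 𝓘(ℝ, EZ × VertModel EM EN) (extChartAt S.model p) q u).2 =
      modelDeriv S.model 𝓘(ℝ, VertModel EM EN) (S.fibCoord p.1) q u := by
  obtain ⟨h1, h2⟩ := S.extChartAt_total_source p hq
  have d1 : MDifferentiableAt S.model 𝓘(ℝ, EZ) (fun q : S.Total => extChartAt 𝓘(ℝ, EZ) p.1 q.1) q :=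
    MDifferentiableAt.comp (I' := 𝓘(ℝ, EZ)) q (mdifferentiableAt_extChartAt (by simpa using h2))
      (S.mdifferentiableAt_totalProj q)
  have d2 := S.mdifferentiableAt_fibCoord h1
  have h3 : MDifferentiableAt S.model 𝓘(ℝ, EZ × VertModel EM EN) (extChartAt S.model p) q :=
    d1.prodMk_space d2
  have h4 := modelDeriv_comp_apply (x := q) (g := Prod.snd) rfl
    (differentiableAt_snd.mdifferentiableAt (𝕜 := ℝ)) h3 u
  have h5 : modelDeriv 𝓘(ℝ, EZ × VertModel EM EN) 𝓘(ℝ, VertModel EM EN) Prod.snd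
      (extChartAt S.model p q) = ContinuousLinearMap.snd ℝ EZ (VertModel EM EN) :=
    hasFDerivAt_snd.hasMFDerivAt.modelDeriv_eq
  rw [h5] at h4
  exact h4.symm

theorem modelDeriv_extChartAt_total_fst {p q : S.Total} (hq : q ∈ (extChartAt S.model p).source)
    {u : EZ × VertModel EM EN}
    (hu : modelDeriv S.model 𝓘(ℝ, EZ) (fun q : S.Total => q.1) q u = 0) :
    (modelDeriv S.model 𝓘(ℝ, EZ × VertModel EM EN) (extChartAt S.model p) q u).1 = 0 := by
  obtain ⟨h1, h2⟩ := S.extChartAt_total_source p hq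
  have d0 : MDifferentiableAt 𝓘(ℝ, EZ) 𝓘(ℝ, EZ) (extChartAt 𝓘(ℝ, EZ) p.1) q.1 :=
    mdifferentiableAt_extChartAt (by simpa using h2)
  have d1 : MDifferentiableAt S.model 𝓘(ℝ, EZ) (fun q : S.Total => extChartAt 𝓘(ℝ, EZ) p.1 q.1) q :=
    MDifferentiableAt.comp (I' := 𝓘(ℝ, EZ)) q d0 (S.mdifferentiableAt_totalProj q)
  have d2 := S.mdifferentiableAt_fibCoord h1
  have h3 : MDifferentiableAt S.model 𝓘(ℝ, EZ × VertModel EM EN) (extChartAt S.model p) q :=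
    d1.prodMk_space d2
  have h4 := modelDeriv_comp_apply (x := q) (g := Prod.fst) rfl
    (differentiableAt_fst.mdifferentiableAt (𝕜 := ℝ)) h3 u
  have h5 : modelDeriv 𝓘(ℝ, EZ × VertModel EM EN) 𝓘(ℝ, EZ) Prod.fst
      (extChartAt S.model p q) = ContinuousLinearMap.fst ℝ EZ (VertModel EM EN) :=
    hasFDerivAt_fst.hasMFDerivAt.modelDeriv_eq
  rw [h5] at h4
  refine h4.symm.trans ?_
  have h6 := modelDeriv_comp_apply (x := q) rfl d0 (S.mdifferentiableAt_totalProj q) u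
  rw [hu, map_zero] at h6
  exact h6

theorem modelDeriv_proj_euler (q : S.Total) :
    modelDeriv S.model 𝓘(ℝ, EZ) (fun q : S.Total => q.1) q
      (show EZ × VertModel EM EN from S.euler q)
      = 0 := by
  have hc : MDifferentiableAt 𝓘(ℝ, ℝ) S.model (fun t : ℝ => S.dilate (Real.exp t) q) 0 :=
    ((S.contMDiff_dilate_left q).comp Real.contDiff_exp.contMDiff).mdifferentiableAt (by simp)
  have h := modelDeriv_comp_apply (y := q) (by simp [dilate]) (S.mdifferentiableAt_totalProj q) hc 1
  refine h.symm.trans ?_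
  change modelDeriv 𝓘(ℝ, ℝ) 𝓘(ℝ, EZ) (fun _ : ℝ => q.1) 0 1 = 0
  rw [modelDeriv_const]; rfl

theorem modelDeriv_fibCoord_euler {z₀ : Z} {q : S.Total} (hq : q.1 ∈ S.trivSet z₀) :
    modelDeriv S.model 𝓘(ℝ, VertModel EM EN) (S.fibCoord z₀) q
      (show EZ × VertModel EM EN from S.euler q) = S.fibCoord z₀ q := by
  have hc : MDifferentiableAt 𝓘(ℝ, ℝ) S.model (fun t : ℝ => S.dilate (Real.exp t) q) 0 :=
    ((S.contMDiff_dilate_left q).comp Real.contDiff_exp.contMDiff).mdifferentiableAt (by simp)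
  have h := modelDeriv_comp_apply (y := q) (by simp [dilate]) (S.mdifferentiableAt_fibCoord hq) hc 1
  refine h.symm.trans ?_
  simp only [fibCoord_dilate]
  have h2 : HasDerivAt (fun t : ℝ => Real.exp t • S.fibCoord z₀ q) (S.fibCoord z₀ q) 0 := by
    simpa using (Real.hasDerivAt_exp 0).smul_const (S.fibCoord z₀ q)
  rw [h2.modelDeriv_eq, one_smul]

/-- Dilations fix the base point and scale the fibre coordinate, so the Euler field is linear in the
chart. The bracket with it then reduces to one directional derivative. -/
theorem chartField_euler (p : S.Total) {z : EZ × VertModel EM EN}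
    (hz : z ∈ (extChartAt S.model p).target) : chartField S.euler p z = (0, z.2) := by
  have hq := (extChartAt S.model p).map_target hz
  refine Prod.ext (S.modelDeriv_extChartAt_total_fst hq (S.modelDeriv_proj_euler _)) ?_
  refine (S.modelDeriv_extChartAt_total_snd hq _).trans ?_
  rw [S.modelDeriv_fibCoord_euler (S.extChartAt_total_source p hq).1]
  exact congrArg Prod.snd ((extChartAt S.model p).right_inv hz)

variable {S} in
/-- The fibre component of a homogeneous quadratic field is homogeneous of degree two. -/
theorem IsHomogeneousQuadratic.fibCoord_dilate {X : S.VField} (hX : S.IsSmoothField X)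
    (hq : S.IsHomogeneousQuadratic X) (p : S.Total) {s : ℝ} (hs : 0 ≤ s) :
    modelDeriv S.model 𝓘(ℝ, VertModel EM EN) (S.fibCoord p.1) (S.dilate s p) (X (S.dilate s p)) =
      s ^ 2 • modelDeriv S.model 𝓘(ℝ, VertModel EM EN) (S.fibCoord p.1) p (X p) := by
  have := S.isManifold_total_one
  set x := extChartAt 𝓘(ℝ, EZ) p.1 p.1 with hx
  set y := S.fibCoord p.1 p with hy
  set g : EZ × VertModel EM EN → EZ × VertModel EM EN := chartField X p with hg
  have hpt : ∀ s, extChartAt S.model (S.dilate s p) (S.dilate s p) = (x, s • y) := by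
    intro s
    rw [S.extChartAt_total]
    exact Prod.ext rfl (S.fibCoord_dilate _ s p)
  have hchart : ∀ s, chartField X (S.dilate s p) = g := fun s => rfl
  have hgd : ∀ s : ℝ, DifferentiableAt ℝ g (x, s • y) := by
    intro s
    rw [← hpt s, ← hchart s]
    exact (contDiffAt_chartField ((hX.of_le (by simp)).contMDiffAt)).differentiableAt (by simp)
  have hgv : ∀ s : ℝ, g (x, s • y) = X (S.dilate s p) := by
    intro s
    rw [← hpt s, ← hchart s]
    exact chartField_extChartAt_self X (S.dilate s p)
  -- With `Δ = (0, y)` the bracket is `Dg(0, y) - (0, g₂)`. Its fibre component equals `g₂`, whence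
  -- the factor `2`.
  have hbr : ∀ s : ℝ, (fderiv ℝ g (x, s • y) (0, s • y)).2 = (2 : ℝ) • (g (x, s • y)).2 := by
    intro s
    have h1 := mlieBracket_eq_chartField S.euler X (S.dilate s p)
    have h2 : (show EZ × VertModel EM EN from VectorField.mlieBracket S.model S.euler X
        (S.dilate s p)) = g (x, s • y) := (hq (S.dilate s p)).trans (hgv s).symm
    have h3 : (show EZ × VertModel EM EN from S.euler (S.dilate s p)) = (0, s • y) := by
      have := S.chartField_euler (S.dilate s p) (mem_extChartAt_target _)
      rw [chartField_extChartAt_self, hpt s] at this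
      exact this
    have h4 : fderiv ℝ (chartField S.euler (S.dilate s p)) (x, s • y) =
        (ContinuousLinearMap.inr ℝ EZ (VertModel EM EN)).comp
          (ContinuousLinearMap.snd ℝ EZ (VertModel EM EN)) := by
      refine HasFDerivAt.fderiv (HasFDerivAt.congr_of_eventuallyEq
        (((ContinuousLinearMap.inr ℝ EZ (VertModel EM EN)).comp
          (ContinuousLinearMap.snd ℝ EZ (VertModel EM EN))).hasFDerivAt) ?_)
      rw [← hpt s]
      filter_upwards [extChartAt_target_mem_nhds (I := S.model) (S.dilate s p)] with z hz
      exact S.chartField_euler _ hz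
    rw [h2, hchart, hpt s, h3, h4] at h1
    have h5 : g (x, s • y) = fderiv ℝ g (x, s • y) (0, s • y) - (0, (g (x, s • y)).2) := by
      have h6 : (show EZ × VertModel EM EN from X (S.dilate s p)) = g (x, s • y) := (hgv s).symm
      rw [h6] at h1
      exact h1
    have h7 := congrArg Prod.snd h5
    rw [Prod.snd_sub] at h7
    rw [two_smul]
    exact (eq_sub_iff_add_eq.1 h7).symm
  have hder : ∀ s : ℝ, HasDerivAt (fun s : ℝ => (g (x, s • y)).2)
      ((fderiv ℝ g (x, s • y) (0, y)).2) s := by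
    intro s
    have h1 : HasDerivAt (fun s : ℝ => ((x, s • y) : EZ × VertModel EM EN)) (0, y) s := by
      have := (hasDerivAt_const s x).prodMk ((hasDerivAt_id s).smul_const y)
      simpa using this
    have h2 := (hgd s).hasFDerivAt.comp_hasDerivAt s h1
    exact (ContinuousLinearMap.snd ℝ EZ (VertModel EM EN)).hasFDerivAt.comp_hasDerivAt s h2
  have hfin := eq_sq_smul_of_euler hder (fun s => by
    rw [← hbr s, ← Prod.smul_snd, ← map_smul]
    congr 3
    simp) hs
  have hval : ∀ s, (g (x, s • y)).2 = modelDeriv S.model 𝓘(ℝ, VertModel EM EN) (S.fibCoord p.1)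
      (S.dilate s p) (X (S.dilate s p)) := by
    intro s
    have hq : S.dilate s p ∈ (extChartAt S.model p).source :=
      mem_extChartAt_source (I := S.model) (S.dilate s p)
    refine Eq.trans ?_ (S.modelDeriv_extChartAt_total_snd hq _)
    change (modelDeriv S.model 𝓘(ℝ, EZ × VertModel EM EN) (extChartAt S.model p)
      ((extChartAt S.model p).symm (x, s • y)) (X ((extChartAt S.model p).symm (x, s • y)))).2 = _
    have : (extChartAt S.model p).symm (x, s • y) = S.dilate s p := by
      rw [← hpt s]
      exact extChartAt_to_inv (I := S.model) (S.dilate s p)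
    rw [this]
  rw [hval, hval, S.dilate_one] at hfin
  exact hfin

end VertData

/-! ### Retractions onto the fibres of a submersion -/

section Submersion

variable {EM : Type*} [NormedAddCommGroup EM] [NormedSpace ℝ EM]
  {M : Type*} [TopologicalSpace M] [ChartedSpace EM M]
  {EN : Type*} [NormedAddCommGroup EN] [NormedSpace ℝ EN]
  {N : Type*} [TopologicalSpace N] [ChartedSpace EN N]
  [IsManifold 𝓘(ℝ, EM) ∞ M] [IsManifold 𝓘(ℝ, EN) ∞ N]
  [FiniteDimensional ℝ EM] [FiniteDimensional ℝ EN]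

/-- Near a point, there is a smooth family of retractions onto the fibres of a submersion:
`r (x, ·)` is a retraction onto the fibre through `x`. -/
theorem exists_fiberwise_retraction {f : M → N} (hf : ContMDiff 𝓘(ℝ, EM) 𝓘(ℝ, EN) ∞ f)
    (hs : ∀ x, Function.Surjective (mfderiv 𝓘(ℝ, EM) 𝓘(ℝ, EN) f x)) (x₀ : M) :
    ∃ r : M × M → M, ContMDiffAt (𝓘(ℝ, EM).prod 𝓘(ℝ, EM)) 𝓘(ℝ, EM) ∞ r (x₀, x₀) ∧
      (∀ᶠ p in 𝓝 (x₀, x₀), f (r p) = f p.1) ∧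
      ∀ᶠ p in 𝓝 (x₀, x₀), f p.2 = f p.1 → r p = p.2 := by
  have : CompleteSpace EM := FiniteDimensional.complete ℝ EM
  let S : VertData EM M EM M EN N := ⟨id, f, contMDiff_id, hf, hs⟩
  set φ := extChartAt 𝓘(ℝ, EM) x₀ with hφ
  set ψ := extChartAt 𝓘(ℝ, EN) (f x₀) with hψ
  -- `F` straightens the submersion: it is a local diffeomorphism with the submersion as its first
  -- component.
  let F : EM → EN × VertModel EM EN := fun e => (S.localRep x₀ e, S.compl x₀ e)
  have hloc : ContDiffAt ℝ ∞ (S.localRep x₀) (φ x₀) := S.contDiffAt_localRep (S.mem_chartSet x₀)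
  have hF : ContDiffAt ℝ ∞ F (φ x₀) := hloc.prodMk (S.compl x₀).contDiff.contDiffAt
  obtain ⟨B, hB⟩ := (S.mem_trivSet x₀).2
  have hF' : HasFDerivAt F (B : EM →L[ℝ] EN × VertModel EM EN) (φ x₀) := by
    rw [hB]
    exact ((hloc.differentiableAt (by simp)).hasFDerivAt).prodMk (S.compl x₀).hasFDerivAt
  have hn : (∞ : WithTop ℕ∞) ≠ 0 := by simp
  have hstrict := hF.hasStrictFDerivAt' hF' hn
  set Gi := hF.localInverse hF' hn with hGi
  -- In the straightened coordinates the retraction keeps the fibre part of the second point and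
  -- takes the level from the first.
  let w : M × M → EN × VertModel EM EN := fun p => (ψ (f p.1), S.compl x₀ (φ p.2))
  have hloc0 : S.localRep x₀ (φ x₀) = ψ (f x₀) := by
    change ψ (f (φ.symm (φ x₀))) = _
    rw [extChartAt_to_inv]
  have hw0 : w (x₀, x₀) = F (φ x₀) := Prod.ext hloc0.symm rfl
  have hGi0 : Gi (F (φ x₀)) = φ x₀ := hF.localInverse_apply_image hF' hn
  have hw : ContMDiffAt (𝓘(ℝ, EM).prod 𝓘(ℝ, EM)) 𝓘(ℝ, EN × VertModel EM EN) ∞ w (x₀, x₀) := by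
    refine ContMDiffAt.prodMk_space ?_ ?_
    · exact ContMDiffAt.comp (I' := 𝓘(ℝ, EN)) (x₀, x₀) contMDiffAt_extChartAt
        (ContMDiffAt.comp (I' := 𝓘(ℝ, EM)) (x₀, x₀) hf.contMDiffAt contMDiffAt_fst)
    · exact ContMDiffAt.comp (I' := 𝓘(ℝ, EM)) (x₀, x₀) (S.compl x₀).contMDiff.contMDiffAt
        (ContMDiffAt.comp (I' := 𝓘(ℝ, EM)) (x₀, x₀) contMDiffAt_extChartAt contMDiffAt_snd)
  have hGw : ContMDiffAt (𝓘(ℝ, EM).prod 𝓘(ℝ, EM)) 𝓘(ℝ, EM) ∞ (fun p => Gi (w p)) (x₀, x₀) := by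
    have h1 := hF.to_localInverse hF' hn
    rw [← hw0] at h1
    exact ContMDiffAt.comp (I' := 𝓘(ℝ, EN × VertModel EM EN)) (x₀, x₀) h1.contMDiffAt hw
  have hGw0 : Gi (w (x₀, x₀)) = φ x₀ := by rw [hw0, hGi0]
  have hr : ContMDiffAt (𝓘(ℝ, EM).prod 𝓘(ℝ, EM)) 𝓘(ℝ, EM) ∞ (fun p => φ.symm (Gi (w p)))
      (x₀, x₀) := by
    have h1 : ContMDiffAt 𝓘(ℝ, EM) 𝓘(ℝ, EM) ∞ φ.symm (Gi (w (x₀, x₀))) := by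
      rw [hGw0]
      exact (contMDiffOn_extChartAt_symm x₀).contMDiffAt (extChartAt_target_mem_nhds x₀)
    exact ContMDiffAt.comp (I' := 𝓘(ℝ, EM)) (x₀, x₀) h1 hGw
  have hr0 : φ.symm (Gi (w (x₀, x₀))) = x₀ := by rw [hGw0, extChartAt_to_inv]
  refine ⟨fun p => φ.symm (Gi (w p)), hr, ?_, ?_⟩
  · have e1 : ∀ᶠ p in 𝓝 (x₀, x₀), F (Gi (w p)) = w p := by
      have h := hstrict.eventually_right_inverse
      rw [← hw0] at h
      exact hw.continuousAt.eventually h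
    have e2 : ∀ᶠ p in 𝓝 (x₀, x₀), f (φ.symm (Gi (w p))) ∈ ψ.source := by
      refine (hf.continuous.continuousAt.comp hr.continuousAt).eventually_mem ?_
      rw [Function.comp_apply, hr0]
      exact extChartAt_source_mem_nhds _
    have e3 : ∀ᶠ p : M × M in 𝓝 (x₀, x₀), f p.1 ∈ ψ.source :=
      (hf.continuous.continuousAt.comp continuousAt_fst).eventually_mem
        (extChartAt_source_mem_nhds _)
    filter_upwards [e1, e2, e3] with p h1 h2 h3
    exact ψ.injOn h2 h3 (congrArg Prod.fst h1)
  · have e1 : ∀ᶠ p : M × M in 𝓝 (x₀, x₀), Gi (F (φ p.2)) = φ p.2 :=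
      ((continuousAt_extChartAt (I := 𝓘(ℝ, EM)) x₀).comp
        (continuousAt_snd (p := (x₀, x₀)))).eventually hstrict.eventually_left_inverse
    have e2 : ∀ᶠ p : M × M in 𝓝 (x₀, x₀), p.2 ∈ φ.source :=
      continuousAt_snd.eventually_mem (extChartAt_source_mem_nhds _)
    filter_upwards [e1, e2] with p h1 h2 h3
    have hwp : w p = F (φ p.2) := by
      refine Prod.ext ?_ rfl
      change ψ (f p.1) = ψ (f (φ.symm (φ p.2)))
      rw [φ.left_inv h2, h3]
    simp only [hwp, h1, φ.left_inv h2]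

end Submersion

/-! ### Left translations and smoothness of `Ψ` -/

namespace LieGroupoid

variable {EG : Type*} [NormedAddCommGroup EG] [NormedSpace ℝ EG]
  {G : Type*} [TopologicalSpace G] [ChartedSpace EG G]
  {EQ : Type*} [NormedAddCommGroup EQ] [NormedSpace ℝ EQ]
  {Q : Type*} [TopologicalSpace Q] [ChartedSpace EQ Q]
  (𝒢 : LieGroupoid EG G EQ Q)
  [IsManifold 𝓘(ℝ, EG) ∞ G] [IsManifold 𝓘(ℝ, EQ) ∞ Q]
  [FiniteDimensional ℝ EG] [FiniteDimensional ℝ EQ]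

theorem exists_curve_in_srcFiber (g : G) (v : EG)
    (hv : modelDeriv 𝓘(ℝ, EG) 𝓘(ℝ, EQ) 𝒢.src g v = 0) :
    ∃ c : ℝ → G, c 0 = g ∧ (∀ᶠ t in 𝓝 (0 : ℝ), 𝒢.src (c t) = 𝒢.src g) ∧
      HasMFDerivAt 𝓘(ℝ, ℝ) 𝓘(ℝ, EG) c 0
        (ContinuousLinearMap.toSpanSingleton ℝ v : ℝ →L[ℝ] EG) :=
  exists_curve_in_fiber 𝒢.contMDiff_src 𝒢.surjective_mfderiv_src g v hv

/-- `leftTransl`, as a map between model spaces. -/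
noncomputable def leftTranslModel (g : G) : EG →L[ℝ] EG := 𝒢.leftTransl g

/-- The velocity of the left translate of a curve in a source fibre. -/
theorem modelDeriv_leftTransl_curve {g : G} {v : EG} {c : ℝ → G} (hc0 : c 0 = g)
    (hcs : ∀ᶠ t in 𝓝 (0 : ℝ), 𝒢.src (c t) = 𝒢.src g)
    (hc : HasMFDerivAt 𝓘(ℝ, ℝ) 𝓘(ℝ, EG) c 0
        (ContinuousLinearMap.toSpanSingleton ℝ v : ℝ →L[ℝ] EG)) :
    HasMFDerivAt 𝓘(ℝ, ℝ) 𝓘(ℝ, EG) (fun t => 𝒢.mul (𝒢.inv g) (c t)) 0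
        (ContinuousLinearMap.toSpanSingleton ℝ (𝒢.leftTranslModel g v) : ℝ →L[ℝ] EG) := by
  have hl : HasMFDerivWithinAt 𝓘(ℝ, EG) 𝓘(ℝ, EG) (fun h => 𝒢.mul (𝒢.inv g) h)
      (𝒢.srcFiber g) (c 0) (show EG →L[ℝ] EG from 𝒢.leftTransl g) := by
    rw [hc0]; exact 𝒢.hasMFDerivWithinAt_leftTransl g
  have h2 := HasMFDerivWithinAt.comp (0 : ℝ) hl
    (hc.hasMFDerivWithinAt (s := c ⁻¹' 𝒢.srcFiber g)) Subset.rfl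
  have h3 := h2.hasMFDerivAt (show c ⁻¹' 𝒢.srcFiber g ∈ 𝓝 (0 : ℝ) from hcs)
  have h4 : (ContinuousLinearMap.toSpanSingleton ℝ (𝒢.leftTranslModel g v) : ℝ →L[ℝ] EG) =
      (𝒢.leftTranslModel g).comp (ContinuousLinearMap.toSpanSingleton ℝ v) := by
    ext; simp
  rw [h4]
  exact h3

/-- The derivative of `β(g⁻¹ h) = β(h)` along a curve in the source fibre. This compatibility of the
anchors is what makes the lift exist. -/
theorem modelDeriv_tgt_leftTransl {g : G} {v : EG}
    (hv : modelDeriv 𝓘(ℝ, EG) 𝓘(ℝ, EQ) 𝒢.src g v = 0) :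
    modelDeriv 𝓘(ℝ, EG) 𝓘(ℝ, EQ) 𝒢.tgt (𝒢.one (𝒢.tgt g)) (𝒢.leftTranslModel g v) =
      modelDeriv 𝓘(ℝ, EG) 𝓘(ℝ, EQ) 𝒢.tgt g v := by
  obtain ⟨c, hc0, hcs, hc⟩ := 𝒢.exists_curve_in_srcFiber g v hv
  have h1 := 𝒢.modelDeriv_leftTransl_curve hc0 hcs hc
  have ht : ∀ x, MDifferentiableAt 𝓘(ℝ, EG) 𝓘(ℝ, EQ) 𝒢.tgt x :=
    fun x => 𝒢.contMDiff_tgt.mdifferentiableAt (by simp)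
  have h2 := modelDeriv_comp_apply (f := fun t => 𝒢.mul (𝒢.inv g) (c t)) (y := 𝒢.one (𝒢.tgt g))
    (by rw [hc0, 𝒢.inv_mul]) (ht _) h1.mdifferentiableAt 1
  have h3 := modelDeriv_comp_apply hc0 (ht _) hc.mdifferentiableAt 1
  rw [h1.modelDeriv_eq] at h2
  rw [hc.modelDeriv_eq] at h3
  rw [ContinuousLinearMap.toSpanSingleton_apply, one_smul] at h2 h3
  rw [← h2, ← h3]
  refine congrArg (fun L : ℝ →L[ℝ] EQ => L 1) (Filter.EventuallyEq.modelDeriv_eq ?_)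
  filter_upwards [hcs] with t ht
  exact 𝒢.tgt_mul _ _ (by rw [𝒢.tgt_inv, ht])

/-- Multiplication by `g` undoes multiplication by `g⁻¹` on the source fibre, so its derivative
recovers `v` from its left translate. -/
theorem leftTranslModel_injOn {g : G} {v : EG}
    (hv : modelDeriv 𝓘(ℝ, EG) 𝓘(ℝ, EQ) 𝒢.src g v = 0) (h0 : 𝒢.leftTranslModel g v = 0) :
    v = 0 := by
  obtain ⟨c, hc0, hcs, hc⟩ := 𝒢.exists_curve_in_srcFiber g v hv
  have h1 := 𝒢.modelDeriv_leftTransl_curve hc0 hcs hc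
  rw [h0] at h1
  set d : ℝ → G := fun t => 𝒢.mul (𝒢.inv g) (c t) with hd
  let s : Set G := {h | 𝒢.src h = 𝒢.tgt g}
  have hd0 : d 0 = 𝒢.one (𝒢.tgt g) := by simp only [hd, hc0, 𝒢.inv_mul]
  have hmul : MDifferentiableWithinAt 𝓘(ℝ, EG) 𝓘(ℝ, EG) (fun h => 𝒢.mul g h) s (d 0) := by
    rw [hd0]
    have h2 := 𝒢.contMDiffOn_mul (g, 𝒢.one (𝒢.tgt g)) (𝒢.src_one _).symm
    have h3 : ContMDiffWithinAt 𝓘(ℝ, EG) (𝓘(ℝ, EG).prod 𝓘(ℝ, EG)) ∞ (fun h => (g, h))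
        s (𝒢.one (𝒢.tgt g)) := contMDiffWithinAt_const.prodMk contMDiffWithinAt_id
    exact (ContMDiffWithinAt.comp (𝒢.one (𝒢.tgt g)) h2 h3
      (fun h hh => Eq.symm hh)).mdifferentiableWithinAt (by simp)
  have h2 := HasMFDerivWithinAt.comp (0 : ℝ) hmul.hasMFDerivWithinAt
    (h1.hasMFDerivWithinAt (s := d ⁻¹' s)) Subset.rfl
  have hds : d ⁻¹' s ∈ 𝓝 (0 : ℝ) := by
    filter_upwards [hcs] with t ht
    change 𝒢.src (𝒢.mul (𝒢.inv g) (c t)) = 𝒢.tgt g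
    rw [𝒢.src_mul _ _ (by rw [𝒢.tgt_inv, ht]), 𝒢.src_inv]
  have h3 := h2.hasMFDerivAt hds
  have h4 : (fun h => 𝒢.mul g h) ∘ d =ᶠ[𝓝 0] c := by
    filter_upwards [hcs] with t ht
    change 𝒢.mul g (𝒢.mul (𝒢.inv g) (c t)) = c t
    rw [← 𝒢.mul_assoc _ _ _ (𝒢.src_inv g).symm (by rw [𝒢.tgt_inv, ht]), 𝒢.mul_inv, ← ht,
      𝒢.one_mul]
  have h5 := congrArg (fun L : ℝ →L[ℝ] EG => L 1)
    (h3.modelDeriv_eq.symm.trans (h4.modelDeriv_eq.trans hc.modelDeriv_eq))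
  have h6 : (show EG →L[ℝ] EG from
      mfderivWithin 𝓘(ℝ, EG) 𝓘(ℝ, EG) (fun h => 𝒢.mul g h) s (d 0)) ((1 : ℝ) • (0 : EG)) =
      (1 : ℝ) • v := h5
  rw [smul_zero, map_zero, one_smul] at h6
  exact h6.symm

/-- The division map `(g, h) ↦ g⁻¹ h`, defined for `g` and `h` with the same source, extends locally
to a smooth map. -/
theorem exists_division_extension (g₀ : G) :
    ∃ D : G → G → G, ContMDiffAt (𝓘(ℝ, EG).prod 𝓘(ℝ, EG)) 𝓘(ℝ, EG) ∞ (Function.uncurry D) (g₀, g₀) ∧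
      ∀ᶠ p in 𝓝 (g₀, g₀), 𝒢.src p.2 = 𝒢.src p.1 → D p.1 p.2 = 𝒢.mul (𝒢.inv p.1) p.2 := by
  obtain ⟨r, hr, hr1, hr2⟩ :=
    exists_fiberwise_retraction 𝒢.contMDiff_src 𝒢.surjective_mfderiv_src g₀
  refine ⟨fun g h => 𝒢.mul (𝒢.inv g) (r (g, h)), ?_, ?_⟩
  -- On `s` the elements `g⁻¹` and `r(g, h)` are composable. As `s` is a neighbourhood of `(g₀,
  -- g₀)`, smoothness within the composable pairs becomes smoothness at that point.
  · let s : Set (G × G) := {p | 𝒢.src (r p) = 𝒢.src p.1}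
    have h1 := 𝒢.contMDiffOn_mul (𝒢.inv g₀, r (g₀, g₀))
      (by rw [mem_ofPred_eq, 𝒢.tgt_inv]; exact hr1.self_of_nhds.symm)
    have h2 : ContMDiffAt (𝓘(ℝ, EG).prod 𝓘(ℝ, EG)) (𝓘(ℝ, EG).prod 𝓘(ℝ, EG)) ∞
        (fun p : G × G => (𝒢.inv p.1, r p)) (g₀, g₀) :=
      (ContMDiffAt.comp (I' := 𝓘(ℝ, EG)) (g₀, g₀) 𝒢.contMDiff_inv.contMDiffAt
        contMDiffAt_fst).prodMk hr
    have h3 := ContMDiffWithinAt.comp (s := s) (g₀, g₀) h1 h2.contMDiffWithinAt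
      (fun p hp => by
        change 𝒢.tgt (𝒢.inv p.1) = 𝒢.src (r p)
        rw [𝒢.tgt_inv]; exact Eq.symm hp)
    exact h3.contMDiffAt hr1
  · filter_upwards [hr2] with p hp h
    simp only [hp h]

/-- The derivative of left translation, through an extension of the division map. -/
theorem leftTranslModel_eq_modelDeriv {D : G → G → G} {g : G}
    (hD : MDifferentiableAt 𝓘(ℝ, EG) 𝓘(ℝ, EG) (D g) g)
    (hm : ∀ᶠ h in 𝓝 g, 𝒢.src h = 𝒢.src g → D g h = 𝒢.mul (𝒢.inv g) h) {v : EG}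
    (hv : modelDeriv 𝓘(ℝ, EG) 𝓘(ℝ, EQ) 𝒢.src g v = 0) :
    modelDeriv 𝓘(ℝ, EG) 𝓘(ℝ, EG) (D g) g v = 𝒢.leftTranslModel g v := by
  obtain ⟨c, hc0, hcs, hc⟩ := 𝒢.exists_curve_in_srcFiber g v hv
  have h1 := 𝒢.modelDeriv_leftTransl_curve hc0 hcs hc
  have h2 := modelDeriv_comp_apply hc0 hD hc.mdifferentiableAt 1
  have h3 : (fun t => D g (c t)) =ᶠ[𝓝 0] fun t => 𝒢.mul (𝒢.inv g) (c t) := by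
    have hcc : Tendsto c (𝓝 0) (𝓝 g) := by
      have := hc.continuousAt.tendsto
      rwa [hc0] at this
    filter_upwards [hcs, hcc.eventually hm] with t ht ht'
    exact ht' ht
  rw [h3.modelDeriv_eq, h1.modelDeriv_eq, hc.modelDeriv_eq,
    ContinuousLinearMap.toSpanSingleton_apply, ContinuousLinearMap.toSpanSingleton_apply,
    one_smul, one_smul] at h2
  exact h2.symm

/-- `leftTransl` is a derivative within a set that moves with the point. On vertical vectors it
equals the partial derivative, in the second variable, of the extended division map, which depends
smoothly on the point. -/
theorem contMDiff_Psi : ContMDiff 𝒢.V.model 𝒢.A.model ∞ 𝒢.Psi := by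
  intro p₀
  have hproj := 𝒢.V.contMDiff_totalProj
  refine 𝒢.A.contMDiffAt_total
    (𝒢.contMDiff_tgt.comp hproj).contMDiffAt ?_
  obtain ⟨D, hD, hm⟩ := 𝒢.exists_division_extension p₀.1
  have hD' : ContMDiffAt (𝒢.V.model.prod 𝓘(ℝ, EG)) 𝓘(ℝ, EG) ∞
      (Function.uncurry (fun (p : 𝒢.V.Total) (h : G) => D p.1 h)) (p₀, p₀.1) := by
    have h1 : ContMDiffAt (𝒢.V.model.prod 𝓘(ℝ, EG)) (𝓘(ℝ, EG).prod 𝓘(ℝ, EG)) ∞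
        (fun x : 𝒢.V.Total × G => (x.1.1, x.2)) (p₀, p₀.1) :=
      (ContMDiffAt.comp (I' := 𝒢.V.model) (p₀, p₀.1) hproj.contMDiffAt contMDiffAt_fst).prodMk
        contMDiffAt_snd
    exact ContMDiffAt.comp (I' := 𝓘(ℝ, EG).prod 𝓘(ℝ, EG)) (p₀, p₀.1) hD h1
  have h2 := ContMDiffAt.mfderiv (m := ∞) (fun (p : 𝒢.V.Total) (h : G) => D p.1 h)
    (fun p => p.1) hD' hproj.contMDiffAt (by simp)
  have h3 : ContMDiffAt 𝒢.V.model 𝓘(ℝ, EG) ∞ (fun p : 𝒢.V.Total => D p.1 p.1) p₀ :=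
    ContMDiffAt.comp (I' := 𝓘(ℝ, EG).prod 𝓘(ℝ, EG)) (g := Function.uncurry D)
      (f := fun p : 𝒢.V.Total => (p.1, p.1)) p₀ hD
      (hproj.contMDiffAt.prodMk hproj.contMDiffAt)
  have h4 := ContMDiffAt.clm_apply_of_inCoordinates
    (E₁ := TangentSpace 𝓘(ℝ, EG) (M := G)) (E₂ := TangentSpace 𝓘(ℝ, EG) (M := G))
    (b₁ := fun p : 𝒢.V.Total => p.1) (b₂ := fun p : 𝒢.V.Total => D p.1 p.1)
    (v := fun p : 𝒢.V.Total => 𝒢.V.fiberIncl p.1 p.2)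
    (ϕ := fun p : 𝒢.V.Total => mfderiv 𝓘(ℝ, EG) 𝓘(ℝ, EG) (D p.1) p.1)
    h2 (𝒢.V.contMDiff_incl p₀) h3
  refine h4.congr_of_eventuallyEq ?_
  have hdiag : Tendsto (fun p : 𝒢.V.Total => (p.1, p.1)) (𝓝 p₀) (𝓝 (p₀.1, p₀.1)) :=
    (hproj.continuous.prodMk hproj.continuous).continuousAt
  -- To be differentiated, the formula for `D` has to hold on a neighbourhood of each nearby
  -- diagonal point, not only at that point.
  have e1 : ∀ᶠ p : 𝒢.V.Total in 𝓝 p₀, ∀ᶠ q in 𝓝 (p.1, p.1),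
      𝒢.src q.2 = 𝒢.src q.1 → D q.1 q.2 = 𝒢.mul (𝒢.inv q.1) q.2 :=
    hdiag.eventually hm.eventually_nhds
  have e2 : ∀ᶠ p : 𝒢.V.Total in 𝓝 p₀,
      ContMDiffAt (𝓘(ℝ, EG).prod 𝓘(ℝ, EG)) 𝓘(ℝ, EG) 1 (Function.uncurry D) (p.1, p.1) :=
    hdiag.eventually ((contMDiffAt_iff_contMDiffAt_nhds (by simp)).1
      (hD.of_le (m := 1) (by simp)))
  filter_upwards [e1, e2] with p h5 h6
  have h7 : D p.1 p.1 = 𝒢.one (𝒢.tgt p.1) := by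
    rw [h5.self_of_nhds rfl, 𝒢.inv_mul]
  have h8 : Continuous (fun h : G => (p.1, h)) := by fun_prop
  have h9 : MDifferentiableAt 𝓘(ℝ, EG) 𝓘(ℝ, EG) (D p.1) p.1 :=
    (ContMDiffAt.comp (I' := 𝓘(ℝ, EG).prod 𝓘(ℝ, EG)) (g := Function.uncurry D)
      (f := fun h : G => (p.1, h)) p.1 h6
      (contMDiffAt_const.prodMk contMDiffAt_id)).mdifferentiableAt (by simp)
  refine tangentBundle_mk_congr h7.symm ?_
  exact (𝒢.leftTranslModel_eq_modelDeriv h9 (h8.continuousAt.eventually h5)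
    (𝒢.V.mfderiv_fiberIncl p.1 p.2)).symm

end LieGroupoid

/-! ### Smoothness of vector fields tested through maps to vector spaces -/

section VectorSpaceTarget

variable {E : Type*} [NormedAddCommGroup E] [NormedSpace ℝ E]
  {H : Type*} [TopologicalSpace H] {I : ModelWithCorners ℝ E H}
  {M : Type*} [TopologicalSpace M] [ChartedSpace H M] [IsManifold I ∞ M]
  {F : Type*} [NormedAddCommGroup F] [NormedSpace ℝ F]

/-- The derivative of a map to a vector space, in the tangent bundle coordinates at `x₀`. -/
theorem exists_modelDeriv_coordinates {f : M → F} {x₀ : M} (hf : ContMDiffAt I 𝓘(ℝ, F) ∞ f x₀) :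
    ∃ A : M → E →L[ℝ] F, ContMDiffAt I 𝓘(ℝ, E →L[ℝ] F) ∞ A x₀ ∧
      (∀ᶠ x in 𝓝 x₀, ∀ v : TangentSpace I x, A x (trivializationAt E (TangentSpace I) x₀ ⟨x, v⟩).2 =
        modelDeriv I 𝓘(ℝ, F) f x v) ∧
      ((modelDeriv I 𝓘(ℝ, F) f x₀).IsInvertible → (A x₀).IsInvertible) := by
  have h := hf.mfderiv_const (m := ∞) (by simp)
  refine ⟨_, h, ?_, ?_⟩
  · have hb : (trivializationAt E (TangentSpace I) x₀).baseSet ∈ 𝓝 x₀ :=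
      (trivializationAt E (TangentSpace I) x₀).open_baseSet.mem_nhds
        (FiberBundle.mem_baseSet_trivializationAt' x₀)
    filter_upwards [hb] with x hx v
    have hF : f x ∈ (trivializationAt F (TangentSpace 𝓘(ℝ, F)) (f x₀)).baseSet := by
      rw [TangentBundle.trivializationAt_baseSet, chartAt_self_eq]; exact mem_univ _
    refine Eq.trans (congrArg (fun L : E →L[ℝ] F =>
      L (trivializationAt E (TangentSpace I) x₀ ⟨x, v⟩).2)
      (ContinuousLinearMap.inCoordinates_eq hx hF)) ?_
    change (trivializationAt F (TangentSpace 𝓘(ℝ, F)) (f x₀) ⟨f x, mfderiv I 𝓘(ℝ, F) f x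
      (((trivializationAt E (TangentSpace I) x₀).continuousLinearEquivAt ℝ x hx).symm
        ((trivializationAt E (TangentSpace I) x₀).continuousLinearEquivAt ℝ x hx v))⟩).2 = _
    rw [ContinuousLinearEquiv.symm_apply_apply]
    refine (trivializationAt_tangent_snd (I := 𝓘(ℝ, F))
      (by rw [extChartAt_model_space_eq_id]; exact mem_univ _) _).trans ?_
    have hid : (extChartAt 𝓘(ℝ, F) (f x₀) : F → F) = id := by
      rw [extChartAt_model_space_eq_id]; rfl
    rw [hid, mfderiv_id]
    rfl
  · intro hi
    have hi' : (mfderiv I 𝓘(ℝ, F) f x₀).IsInvertible := hi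
    have h2 := ContinuousLinearMap.inCoordinates_eq (ϕ := mfderiv I 𝓘(ℝ, F) f x₀)
      (FiberBundle.mem_baseSet_trivializationAt' (F := E) (E := TangentSpace I) x₀)
      (FiberBundle.mem_baseSet_trivializationAt' (F := F) (E := TangentSpace 𝓘(ℝ, F)) (f x₀))
    refine Eq.mpr (congrArg ContinuousLinearMap.IsInvertible h2) ?_
    exact ContinuousLinearMap.isInvertible_equiv.comp
      (hi'.comp ContinuousLinearMap.isInvertible_equiv)

theorem contMDiffAt_modelDeriv_apply {f : M → F} {X : (x : M) → TangentSpace I x} {x₀ : M}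
    (hf : ContMDiffAt I 𝓘(ℝ, F) ∞ f x₀)
    (hX : ContMDiffAt I I.tangent ∞ (fun x => (⟨x, X x⟩ : TangentBundle I M)) x₀) :
    ContMDiffAt I 𝓘(ℝ, F) ∞ (fun x => modelDeriv I 𝓘(ℝ, F) f x (X x)) x₀ := by
  obtain ⟨A, hA, hAe, -⟩ := exists_modelDeriv_coordinates hf
  rw [contMDiffAt_totalSpace] at hX
  refine (hA.clm_apply hX.2).congr_of_eventuallyEq ?_
  filter_upwards [hAe] with x hx
  exact (hx (X x)).symm

/-- A vector field which is mapped to a smooth map by the invertible derivative of a smooth map is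
smooth. -/
theorem contMDiffAt_of_modelDeriv_eq [CompleteSpace E] {f : M → F} {X : (x : M) → TangentSpace I x}
    {x₀ : M} {b : M → F} (hf : ContMDiffAt I 𝓘(ℝ, F) ∞ f x₀)
    (hi : (modelDeriv I 𝓘(ℝ, F) f x₀).IsInvertible) (hb : ContMDiffAt I 𝓘(ℝ, F) ∞ b x₀)
    (hX : ∀ᶠ x in 𝓝 x₀, modelDeriv I 𝓘(ℝ, F) f x (X x) = b x) :
    ContMDiffAt I I.tangent ∞ (fun x => (⟨x, X x⟩ : TangentBundle I M)) x₀ := by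
  obtain ⟨A, hA, hAe, hAi⟩ := exists_modelDeriv_coordinates hf
  obtain ⟨B, hB⟩ := hAi hi
  rw [contMDiffAt_totalSpace]
  refine ⟨contMDiffAt_id, ?_⟩
  have h1 : ContDiffAt ℝ ∞ (ContinuousLinearMap.inverse : (E →L[ℝ] F) → _) (A x₀) := by
    rw [← hB]
    exact contDiffAt_map_inverse B
  have h2 : ContMDiffAt I 𝓘(ℝ, F →L[ℝ] E) ∞ (fun x => (A x).inverse) x₀ :=
    ContMDiffAt.comp x₀ h1.contMDiffAt hA
  refine (h2.clm_apply hb).congr_of_eventuallyEq ?_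
  have hopen : ∀ᶠ x in 𝓝 x₀, (A x).IsInvertible :=
    hA.continuousAt.eventually_mem ((ContinuousLinearEquiv.isOpen (𝕜 := ℝ) (E := E)
      (F := F)).mem_nhds ⟨B, hB⟩)
  filter_upwards [hAe, hX, hopen] with x h3 h4 h5
  obtain ⟨C, hC⟩ := h5
  have h6 := h3 (X x)
  rw [h4, ← hC] at h6
  rw [← h6, ← hC, ContinuousLinearMap.inverse_equiv]
  exact (C.symm_apply_apply _).symm

end VectorSpaceTarget

/-! ### Existence, uniqueness and homogeneity of the lift -/

namespace LieGroupoid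

variable {EG : Type*} [NormedAddCommGroup EG] [NormedSpace ℝ EG]
  {G : Type*} [TopologicalSpace G] [ChartedSpace EG G]
  {EQ : Type*} [NormedAddCommGroup EQ] [NormedSpace ℝ EQ]
  {Q : Type*} [TopologicalSpace Q] [ChartedSpace EQ Q]
  (𝒢 : LieGroupoid EG G EQ Q)
  [IsManifold 𝓘(ℝ, EG) ∞ G] [IsManifold 𝓘(ℝ, EQ) ∞ Q]
  [FiniteDimensional ℝ EG] [FiniteDimensional ℝ EQ]

/-- The restriction of `Psi` to a fibre, as a linear map. -/
noncomputable def fiberPsi (g : G) : 𝒢.V.Fiber g →ₗ[ℝ] 𝒢.A.Fiber (𝒢.tgt g) where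
  toFun w := (𝒢.Psi ⟨g, w⟩).2
  map_add' w w' := Subtype.ext (by
    change 𝒢.leftTransl g (𝒢.V.fiberIncl g (w + w')) = 𝒢.leftTransl g (𝒢.V.fiberIncl g w) +
      𝒢.leftTransl g (𝒢.V.fiberIncl g w')
    rw [map_add, map_add])
  map_smul' r w := Subtype.ext (by
    change 𝒢.leftTransl g (𝒢.V.fiberIncl g (r • w)) = r • 𝒢.leftTransl g (𝒢.V.fiberIncl g w)
    rw [map_smul, map_smul])

theorem fiberPsi_eq_zero {g : G} {w : 𝒢.V.Fiber g} (h : 𝒢.fiberPsi g w = 0) : w = 0 := by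
  apply 𝒢.V.fiberIncl_injective g
  rw [map_zero]
  exact 𝒢.leftTranslModel_injOn (𝒢.V.mfderiv_fiberIncl g w) (congrArg Subtype.val h)

theorem Psi_dilate (t : ℝ) (p : 𝒢.V.Total) : 𝒢.Psi (𝒢.V.dilate t p) = 𝒢.A.dilate t (𝒢.Psi p) :=
  congrArg (TotalSpace.mk (𝒢.tgt p.1)) (map_smul (𝒢.fiberPsi p.1) t p.2)

theorem mdifferentiableAt_Psi (p : 𝒢.V.Total) :
    MDifferentiableAt 𝒢.V.model 𝒢.A.model 𝒢.Psi p :=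
  𝒢.contMDiff_Psi.mdifferentiableAt (by simp)

theorem mdifferentiableAt_fibCoord_Psi {q : Q} {p : 𝒢.V.Total} (hp : 𝒢.tgt p.1 ∈ 𝒢.A.trivSet q) :
    MDifferentiableAt 𝒢.V.model 𝓘(ℝ, VertModel EG EQ) (fun p => 𝒢.A.fibCoord q (𝒢.Psi p)) p :=
  MDifferentiableAt.comp (I' := 𝒢.A.model) (g := 𝒢.A.fibCoord q) (f := 𝒢.Psi) p
    (𝒢.A.mdifferentiableAt_fibCoord hp)
    (𝒢.mdifferentiableAt_Psi p)

/-- `(T τ̃, T Ψ)` is injective. -/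
theorem tangent_eq_zero_of_Psi {q : Q} {p : 𝒢.V.Total} (hp : 𝒢.tgt p.1 ∈ 𝒢.A.trivSet q)
    {u : EG × VertModel EG EQ}
    (h₁ : modelDeriv 𝒢.V.model 𝓘(ℝ, EG) (fun p : 𝒢.V.Total => p.1) p u = 0)
    (h₂ : modelDeriv 𝒢.V.model 𝓘(ℝ, VertModel EG EQ)
      (fun p => 𝒢.A.fibCoord q (𝒢.Psi p)) p u = 0) : u = 0 := by
  -- A vector without base component is a vertical lift, on which `T Ψ` acts as the injective linear
  -- map `fiberPsi`.
  obtain ⟨w, rfl⟩ := 𝒢.V.exists_eq_vertLift h₁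
  have hw : 𝒢.A.trivMap q (𝒢.tgt p.1) (𝒢.fiberPsi p.1 w) = 0 := by
    rw [𝒢.V.modelDeriv_vertLift (𝒢.mdifferentiableAt_fibCoord_Psi hp)] at h₂
    have hl : (fun t : ℝ => 𝒢.A.fibCoord q (𝒢.Psi (𝒢.V.fiberLine p w t))) = fun t =>
        𝒢.A.fibCoord q (𝒢.Psi p) + t • 𝒢.A.trivMap q (𝒢.tgt p.1) (𝒢.fiberPsi p.1 w) := by
      funext t
      change 𝒢.A.trivMap q (𝒢.tgt p.1) (𝒢.fiberPsi p.1 (p.2 + t • w)) = _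
      rw [map_add, map_smul, map_add, map_smul]
      rfl
    have h : HasDerivAt (fun t : ℝ => 𝒢.A.fibCoord q (𝒢.Psi p) +
        t • 𝒢.A.trivMap q (𝒢.tgt p.1) (𝒢.fiberPsi p.1 w))
        (𝒢.A.trivMap q (𝒢.tgt p.1) (𝒢.fiberPsi p.1 w)) 0 := by
      simpa using ((hasDerivAt_id (0 : ℝ)).smul_const
        (𝒢.A.trivMap q (𝒢.tgt p.1) (𝒢.fiberPsi p.1 w))).const_add (𝒢.A.fibCoord q (𝒢.Psi p))
    rw [hl, h.modelDeriv_eq, one_smul] at h₂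
    exact h₂
  have hw0 : w = 0 := 𝒢.fiberPsi_eq_zero ((𝒢.A.bijective_trivMap hp).1 (by rw [hw, map_zero]))
  refine 𝒢.V.tangent_eq_zero (𝒢.V.mem_trivSet p.1) _ (𝒢.V.modelDeriv_proj_vertLift p w) ?_
  rw [𝒢.V.modelDeriv_fibCoord_vertLift (𝒢.V.mem_trivSet p.1), hw0, map_zero]

/-- The uniqueness half of the pull-back picture. It yields uniqueness of the lift and also
transfers homogeneity from `Γ` to it. -/
theorem tangent_ext_of_Psi {p : 𝒢.V.Total} {u w : EG × VertModel EG EQ}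
    (h₁ : modelDeriv 𝒢.V.model 𝓘(ℝ, EG) (fun p : 𝒢.V.Total => p.1) p u =
      modelDeriv 𝒢.V.model 𝓘(ℝ, EG) (fun p : 𝒢.V.Total => p.1) p w)
    (h₂ : modelDeriv 𝒢.V.model 𝒢.A.model 𝒢.Psi p u = modelDeriv 𝒢.V.model 𝒢.A.model 𝒢.Psi p w) :
    u = w := by
  have hp := 𝒢.A.mem_trivSet (𝒢.tgt p.1)
  rw [← sub_eq_zero]
  refine 𝒢.tangent_eq_zero_of_Psi hp (by rw [map_sub, h₁, sub_self]) ?_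
  rw [modelDeriv_comp_apply (y := 𝒢.Psi p) rfl (𝒢.A.mdifferentiableAt_fibCoord hp)
    (𝒢.mdifferentiableAt_Psi p), map_sub, h₂, sub_self, map_zero]

/-- The coordinates of the base point and of the image under `Psi`. -/
noncomputable def liftCoord (g₀ : G) (p : 𝒢.V.Total) : EG × VertModel EG EQ :=
  (extChartAt 𝓘(ℝ, EG) g₀ p.1, 𝒢.A.fibCoord (𝒢.tgt g₀) (𝒢.Psi p))

/-- The domain of `liftCoord`. -/
def liftDom (g₀ : G) : Set 𝒢.V.Total :=
  {p | p.1 ∈ (extChartAt 𝓘(ℝ, EG) g₀).source ∧ 𝒢.tgt p.1 ∈ 𝒢.A.trivSet (𝒢.tgt g₀)}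

theorem mem_liftDom (p : 𝒢.V.Total) : p ∈ 𝒢.liftDom p.1 :=
  ⟨mem_extChartAt_source _, 𝒢.A.mem_trivSet _⟩

theorem isOpen_liftDom (g₀ : G) : IsOpen (𝒢.liftDom g₀) :=
  ((isOpen_extChartAt_source g₀).preimage 𝒢.V.contMDiff_totalProj.continuous).inter
    ((𝒢.A.isOpen_trivSet _).preimage
      (𝒢.contMDiff_tgt.continuous.comp 𝒢.V.contMDiff_totalProj.continuous))

variable {𝒢} in
theorem contMDiffAt_liftCoord {g₀ : G} {p : 𝒢.V.Total} (hp : p ∈ 𝒢.liftDom g₀) :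
    ContMDiffAt 𝒢.V.model 𝓘(ℝ, EG × VertModel EG EQ) ∞ (𝒢.liftCoord g₀) p :=
  (ContMDiffAt.comp (I' := 𝓘(ℝ, EG)) p (contMDiffAt_extChartAt' (by simpa using hp.1))
    𝒢.V.contMDiff_totalProj.contMDiffAt).prodMk_space
    (ContMDiffAt.comp (I' := 𝒢.A.model) (g := 𝒢.A.fibCoord (𝒢.tgt g₀)) (f := 𝒢.Psi) p
      (𝒢.A.contMDiffAt_fibCoord hp.2)
      𝒢.contMDiff_Psi.contMDiffAt)

variable {𝒢} in
theorem modelDeriv_liftCoord {g₀ : G} {p : 𝒢.V.Total} (hp : p ∈ 𝒢.liftDom g₀)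
    (u : EG × VertModel EG EQ) :
    modelDeriv 𝒢.V.model 𝓘(ℝ, EG × VertModel EG EQ) (𝒢.liftCoord g₀) p u =
      (modelDeriv 𝓘(ℝ, EG) 𝓘(ℝ, EG) (extChartAt 𝓘(ℝ, EG) g₀) p.1
        (modelDeriv 𝒢.V.model 𝓘(ℝ, EG) (fun p : 𝒢.V.Total => p.1) p u),
      modelDeriv 𝒢.V.model 𝓘(ℝ, VertModel EG EQ)
        (fun p => 𝒢.A.fibCoord (𝒢.tgt g₀) (𝒢.Psi p)) p u) := by
  have d0 : MDifferentiableAt 𝓘(ℝ, EG) 𝓘(ℝ, EG) (extChartAt 𝓘(ℝ, EG) g₀) p.1 :=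
    mdifferentiableAt_extChartAt (by simpa using hp.1)
  have d3 := (contMDiffAt_liftCoord hp).mdifferentiableAt (by simp)
  have h1 := modelDeriv_comp_apply (x := p) (g := Prod.fst) rfl
    (differentiableAt_fst.mdifferentiableAt (𝕜 := ℝ)) d3 u
  have h2 := modelDeriv_comp_apply (x := p) (g := Prod.snd) rfl
    (differentiableAt_snd.mdifferentiableAt (𝕜 := ℝ)) d3 u
  rw [hasFDerivAt_fst.hasMFDerivAt.modelDeriv_eq] at h1
  rw [hasFDerivAt_snd.hasMFDerivAt.modelDeriv_eq] at h2
  refine Prod.ext ?_ h2.symm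
  exact h1.symm.trans (modelDeriv_comp_apply (x := p) rfl d0 (𝒢.V.mdifferentiableAt_totalProj p) u)

variable {𝒢} in
-- The derivative is an endomorphism of a finite-dimensional space, so injectivity, from
-- `tangent_eq_zero_of_Psi`, is enough.
theorem isInvertible_modelDeriv_liftCoord {g₀ : G} {p : 𝒢.V.Total} (hp : p ∈ 𝒢.liftDom g₀) :
    (modelDeriv 𝒢.V.model 𝓘(ℝ, EG × VertModel EG EQ) (𝒢.liftCoord g₀) p).IsInvertible := by
  set T := modelDeriv 𝒢.V.model 𝓘(ℝ, EG × VertModel EG EQ) (𝒢.liftCoord g₀) p with hT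
  have hinj : Function.Injective T.toLinearMap := by
    rw [← LinearMap.ker_eq_bot, LinearMap.ker_eq_bot']
    intro u hu
    have hu' : T u = 0 := hu
    rw [hT, modelDeriv_liftCoord hp] at hu'
    refine 𝒢.tangent_eq_zero_of_Psi hp.2 ?_ (congrArg Prod.snd hu')
    obtain ⟨C, hC⟩ := isInvertible_mfderiv_extChartAt (I := 𝓘(ℝ, EG)) hp.1
    refine C.injective (Eq.trans ?_ (map_zero C).symm)
    exact (congrArg (fun L : EG →L[ℝ] EG => L (modelDeriv 𝒢.V.model 𝓘(ℝ, EG)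
      (fun p : 𝒢.V.Total => p.1) p u)) hC).trans (congrArg Prod.fst hu')
  exact ⟨(LinearEquiv.ofInjectiveEndo T.toLinearMap hinj).toContinuousLinearEquiv, by ext <;> rfl⟩

/-- The value of a lift of `Γ` at `p`, in the coordinates `liftCoord g₀`. -/
noncomputable def liftValue (Γ : 𝒢.A.VField) (g₀ : G) (p : 𝒢.V.Total) : EG × VertModel EG EQ :=
  (modelDeriv 𝓘(ℝ, EG) 𝓘(ℝ, EG) (extChartAt 𝓘(ℝ, EG) g₀) p.1 (𝒢.V.fiberIncl p.1 p.2),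
    modelDeriv 𝒢.A.model 𝓘(ℝ, VertModel EG EQ) (𝒢.A.fibCoord (𝒢.tgt g₀)) (𝒢.Psi p) (Γ (𝒢.Psi p)))

theorem contMDiffAt_liftValue {Γ : 𝒢.A.VField} (hΓ : 𝒢.A.IsSmoothField Γ) (p : 𝒢.V.Total) :
    ContMDiffAt 𝒢.V.model 𝓘(ℝ, EG × VertModel EG EQ) ∞ (𝒢.liftValue Γ p.1) p := by
  have h1 := 𝒢.V.contMDiff_incl p
  rw [contMDiffAt_totalSpace] at h1
  refine ContMDiffAt.prodMk_space (h1.2.congr_of_eventuallyEq ?_) ?_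
  · filter_upwards [(𝒢.isOpen_liftDom p.1).mem_nhds (𝒢.mem_liftDom p)] with q hq
    exact (trivializationAt_tangent_snd (I := 𝓘(ℝ, EG)) hq.1 (𝒢.V.fiberIncl q.1 q.2)).symm
  · have := 𝒢.A.isManifold_total
    have h2 := contMDiffAt_modelDeriv_apply
      (𝒢.A.contMDiffAt_fibCoord (p := 𝒢.Psi p) (𝒢.mem_liftDom p).2) (hΓ (𝒢.Psi p))
    exact ContMDiffAt.comp (I' := 𝒢.A.model) p h2 𝒢.contMDiff_Psi.contMDiffAt

variable {𝒢}

theorem IsSODE.modelDeriv_proj {Γ : 𝒢.A.VField} (hΓ : 𝒢.IsSODE Γ) (a : 𝒢.A.Total) :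
    modelDeriv 𝒢.A.model 𝓘(ℝ, EQ) (fun b : 𝒢.A.Total => b.1) a (Γ a) =
      modelDeriv 𝓘(ℝ, EG) 𝓘(ℝ, EQ) 𝒢.tgt (𝒢.one a.1) (𝒢.A.fiberIncl a.1 a.2) :=
  tangentBundle_snd_eq (hΓ.anchor a)

/-- The two conditions on a lift `X` of `Γ`, in coordinates. -/
theorem IsSODE.modelDeriv_liftCoord_eq_iff {Γ : 𝒢.A.VField} (hΓ : 𝒢.IsSODE Γ) {g₀ : G}
    {p : 𝒢.V.Total} (hp : p ∈ 𝒢.liftDom g₀) (u : EG × VertModel EG EQ) :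
    modelDeriv 𝒢.V.model 𝓘(ℝ, EG × VertModel EG EQ) (𝒢.liftCoord g₀) p u = 𝒢.liftValue Γ g₀ p ↔
      modelDeriv 𝒢.V.model 𝓘(ℝ, EG) (fun p : 𝒢.V.Total => p.1) p u = 𝒢.V.fiberIncl p.1 p.2 ∧
        modelDeriv 𝒢.V.model 𝒢.A.model 𝒢.Psi p u = Γ (𝒢.Psi p) := by
  have hcomp := modelDeriv_comp_apply (y := 𝒢.Psi p) rfl
    (𝒢.A.mdifferentiableAt_fibCoord (p := 𝒢.Psi p) hp.2) (𝒢.mdifferentiableAt_Psi p) u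
  rw [modelDeriv_liftCoord hp, hcomp]
  constructor
  · intro h
    have h1 : modelDeriv 𝒢.V.model 𝓘(ℝ, EG) (fun p : 𝒢.V.Total => p.1) p u =
        𝒢.V.fiberIncl p.1 p.2 := by
      obtain ⟨C, hC⟩ := isInvertible_mfderiv_extChartAt (I := 𝓘(ℝ, EG)) hp.1
      apply C.injective
      have h2 : modelDeriv 𝓘(ℝ, EG) 𝓘(ℝ, EG) (extChartAt 𝓘(ℝ, EG) g₀) p.1 _ =
        modelDeriv 𝓘(ℝ, EG) 𝓘(ℝ, EG) (extChartAt 𝓘(ℝ, EG) g₀) p.1 _ := congrArg Prod.fst h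
      have hC' : modelDeriv 𝓘(ℝ, EG) 𝓘(ℝ, EG) (extChartAt 𝓘(ℝ, EG) g₀) p.1 = _ := hC.symm
      rw [hC'] at h2
      exact h2
    -- The base components agree because `Tτ ∘ TΨ = Tβ ∘ Tτ̃` sends `u` to `Tβ(v) = ρ(Ψ v)`, which
    -- is `Tτ(Γ(Ψ v))` by the SODE condition.
    refine ⟨h1, 𝒢.A.tangent_ext hp.2 ?_ (congrArg Prod.snd h)⟩
    have h3 := modelDeriv_comp_apply (y := 𝒢.Psi p) rfl
      (𝒢.A.mdifferentiableAt_totalProj (𝒢.Psi p)) (𝒢.mdifferentiableAt_Psi p) u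
    have h4 := modelDeriv_comp_apply (x := p) (g := 𝒢.tgt) (I'' := 𝓘(ℝ, EQ)) rfl
      (𝒢.contMDiff_tgt.mdifferentiableAt (by simp)) (𝒢.V.mdifferentiableAt_totalProj p) u
    refine h3.symm.trans (Eq.trans h4 ?_)
    rw [h1]
    refine Eq.trans ?_ (hΓ.modelDeriv_proj (𝒢.Psi p)).symm
    exact (𝒢.modelDeriv_tgt_leftTransl (𝒢.V.mfderiv_fiberIncl p.1 p.2)).symm
  · rintro ⟨h1, h2⟩
    rw [h1, h2]; rfl

theorem IsLift.modelDeriv_proj {Γ : 𝒢.A.VField} {X : 𝒢.V.VField} (hX : 𝒢.IsLift Γ X)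
    (p : 𝒢.V.Total) : modelDeriv 𝒢.V.model 𝓘(ℝ, EG) (fun p : 𝒢.V.Total => p.1) p (X p) =
      𝒢.V.fiberIncl p.1 p.2 :=
  tangentBundle_snd_eq (hX.sode.anchor p)

theorem IsLift.modelDeriv_Psi {Γ : 𝒢.A.VField} {X : 𝒢.V.VField} (hX : 𝒢.IsLift Γ X)
    (p : 𝒢.V.Total) : modelDeriv 𝒢.V.model 𝒢.A.model 𝒢.Psi p (X p) = Γ (𝒢.Psi p) :=
  tangentBundle_snd_eq (hX.related p)

/-- At each point the two conditions are one invertible linear equation with right-hand side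
`liftValue`. Coefficients and right-hand side are smooth, hence so is the solution. -/
theorem IsSODE.existsUnique_isLift {Γ : 𝒢.A.VField} (hΓ : 𝒢.IsSODE Γ) :
    ∃! X : 𝒢.V.VField, 𝒢.IsLift Γ X := by
  have hex : ∀ p : 𝒢.V.Total, ∃ u : EG × VertModel EG EQ,
      modelDeriv 𝒢.V.model 𝓘(ℝ, EG) (fun p : 𝒢.V.Total => p.1) p u = 𝒢.V.fiberIncl p.1 p.2 ∧
        modelDeriv 𝒢.V.model 𝒢.A.model 𝒢.Psi p u = Γ (𝒢.Psi p) := by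
    intro p
    obtain ⟨C, hC⟩ := isInvertible_modelDeriv_liftCoord (𝒢.mem_liftDom p)
    refine ⟨C.symm (𝒢.liftValue Γ p.1 p), (hΓ.modelDeriv_liftCoord_eq_iff (𝒢.mem_liftDom p) _).1 ?_⟩
    rw [← hC]
    exact C.apply_symm_apply _
  choose X h1 h2 using hex
  refine ⟨X, ⟨⟨fun p => ?_, fun p => ?_⟩, fun p => ?_⟩, fun Y hY => funext fun p => ?_⟩
  · have := 𝒢.V.isManifold_total
    have : CompleteSpace EG := FiniteDimensional.complete ℝ EG
    refine contMDiffAt_of_modelDeriv_eq (contMDiffAt_liftCoord (𝒢.mem_liftDom p))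
      (isInvertible_modelDeriv_liftCoord (𝒢.mem_liftDom p)) (𝒢.contMDiffAt_liftValue hΓ.smooth p) ?_
    filter_upwards [(𝒢.isOpen_liftDom p.1).mem_nhds (𝒢.mem_liftDom p)] with q hq
    exact (hΓ.modelDeriv_liftCoord_eq_iff hq _).2 ⟨h1 q, h2 q⟩
  · exact tangentBundle_mk_congr rfl (h1 p)
  · exact tangentBundle_mk_congr rfl (h2 p)
  · exact 𝒢.tangent_ext_of_Psi ((hY.modelDeriv_proj p).trans (h1 p).symm)
      ((hY.modelDeriv_Psi p).trans (h2 p).symm)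

/-- A homogeneous quadratic SODE is homogeneous with respect to dilations. -/
theorem IsSODE.apply_dilate {Γ : 𝒢.A.VField} (hΓ : 𝒢.IsSODE Γ)
    (hq : 𝒢.A.IsHomogeneousQuadratic Γ) (a : 𝒢.A.Total) {s : ℝ} (hs : 0 ≤ s) :
    Γ (𝒢.A.dilate s a) =
      s • modelDeriv 𝒢.A.model 𝒢.A.model (𝒢.A.dilate s) a (Γ a) := by
  have ha := 𝒢.A.mem_trivSet a.1
  have hd : MDifferentiableAt 𝒢.A.model 𝒢.A.model (𝒢.A.dilate s) a :=
    (𝒢.A.contMDiff_dilate s).mdifferentiableAt (by simp)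
  -- The derivative of the dilation leaves base components alone and multiplies fibre components by
  -- `s`. With the outer factor this gives degree one on the base, as the anchor demands, and degree
  -- two on the fibre.
  refine 𝒢.A.tangent_ext (z₀ := a.1) (p := 𝒢.A.dilate s a) ha ?_ ?_
  · rw [hΓ.modelDeriv_proj, map_smul]
    have h1 := modelDeriv_comp_apply (y := 𝒢.A.dilate s a) rfl
      (𝒢.A.mdifferentiableAt_totalProj (𝒢.A.dilate s a)) hd (Γ a)
    rw [← h1]
    refine Eq.trans ?_ (congrArg (s • ·) (hΓ.modelDeriv_proj a)).symm
    change modelDeriv 𝓘(ℝ, EG) 𝓘(ℝ, EQ) 𝒢.tgt (𝒢.one a.1) (𝒢.A.fiberIncl a.1 (s • a.2)) = _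
    rw [map_smul]
    exact map_smul (modelDeriv 𝓘(ℝ, EG) 𝓘(ℝ, EQ) 𝒢.tgt (𝒢.one a.1)) s _
  · rw [hq.fibCoord_dilate hΓ.smooth a hs, map_smul]
    have h1 := modelDeriv_comp_apply (y := 𝒢.A.dilate s a) rfl
      (𝒢.A.mdifferentiableAt_fibCoord (z₀ := a.1) (p := 𝒢.A.dilate s a) ha) hd (Γ a)
    rw [← h1]
    simp only [VertData.fibCoord_dilate]
    have h2 := modelDeriv_comp_apply (x := a) (f := 𝒢.A.fibCoord a.1)
      (g := fun y : VertModel EG EQ => s • y) rfl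
      ((differentiable_id.const_smul s).differentiableAt.mdifferentiableAt (𝕜 := ℝ))
      (𝒢.A.mdifferentiableAt_fibCoord ha) (Γ a)
    have h3 : HasFDerivAt (fun y : VertModel EG EQ => s • y)
        (s • ContinuousLinearMap.id ℝ (VertModel EG EQ)) (𝒢.A.fibCoord a.1 a) :=
      (hasFDerivAt_id _).const_smul s
    rw [h2, h3.hasMFDerivAt.modelDeriv_eq]
    exact (sq s).symm ▸ (mul_smul s s _)

/-- The lift of a homogeneous quadratic SODE is homogeneous with respect to dilations. -/
theorem IsLift.apply_dilate {Γ : 𝒢.A.VField} {X : 𝒢.V.VField} (hX : 𝒢.IsLift Γ X)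
    (hΓ : 𝒢.IsSODE Γ) (hq : 𝒢.A.IsHomogeneousQuadratic Γ) (p : 𝒢.V.Total) {s : ℝ} (hs : 0 ≤ s) :
    X (𝒢.V.dilate s p) =
      s • modelDeriv 𝒢.V.model 𝒢.V.model (𝒢.V.dilate s) p (X p) := by
  have hd : MDifferentiableAt 𝒢.V.model 𝒢.V.model (𝒢.V.dilate s) p :=
    (𝒢.V.contMDiff_dilate s).mdifferentiableAt (by simp)
  refine 𝒢.tangent_ext_of_Psi (p := 𝒢.V.dilate s p) ?_ ?_
  · rw [hX.modelDeriv_proj, map_smul]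
    have h1 := modelDeriv_comp_apply (y := 𝒢.V.dilate s p) rfl
      (𝒢.V.mdifferentiableAt_totalProj (𝒢.V.dilate s p)) hd (X p)
    rw [← h1]
    refine Eq.trans ?_ (congrArg (s • ·) (hX.modelDeriv_proj p)).symm
    exact map_smul (𝒢.V.fiberIncl p.1) s p.2
  · rw [hX.modelDeriv_Psi, map_smul]
    have h1 := modelDeriv_comp_apply (y := 𝒢.V.dilate s p) rfl
      (𝒢.mdifferentiableAt_Psi (𝒢.V.dilate s p)) hd (X p)
    rw [← h1]
    simp only [Psi_dilate]
    have h2 := modelDeriv_comp_apply (x := p) (f := 𝒢.Psi) (g := 𝒢.A.dilate s) rfl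
      ((𝒢.A.contMDiff_dilate s).mdifferentiableAt (by simp)) (𝒢.mdifferentiableAt_Psi p) (X p)
    rw [h2, hX.modelDeriv_Psi]
    exact (congrArg (fun a => (show EQ × VertModel EG EQ from Γ a)) (𝒢.Psi_dilate s p)).trans
      (hΓ.apply_dilate hq (𝒢.Psi p) hs)

end LieGroupoid

/-! ### Rescaled integral curves; the zero section and vertical lifts -/

namespace VertData

variable {EZ : Type*} [NormedAddCommGroup EZ] [NormedSpace ℝ EZ]
  {Z : Type*} [TopologicalSpace Z] [ChartedSpace EZ Z]
  {EM : Type*} [NormedAddCommGroup EM] [NormedSpace ℝ EM]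
  {M : Type*} [TopologicalSpace M] [ChartedSpace EM M]
  {EN : Type*} [NormedAddCommGroup EN] [NormedSpace ℝ EN]
  {N : Type*} [TopologicalSpace N] [ChartedSpace EN N]
  {S : VertData EZ Z EM M EN N}
  [IsManifold 𝓘(ℝ, EM) ∞ M] [IsManifold 𝓘(ℝ, EN) ∞ N]
  [FiniteDimensional ℝ EM] [FiniteDimensional ℝ EN] [IsManifold 𝓘(ℝ, EZ) ∞ Z]

/-- Scaling an integral curve of a field which is homogeneous with respect to dilations. -/
theorem isMIntegralCurveOn_dilate {X : S.VField} {s : ℝ}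
    (hX : ∀ p, X (S.dilate s p) = s • modelDeriv S.model S.model (S.dilate s) p (X p))
    (hs : 0 ≤ s) {c : ℝ → S.Total} {T T' : ℝ} (hT : s * T' ≤ T)
    (hc : IsMIntegralCurveOn c X (Icc 0 T)) :
    IsMIntegralCurveOn (fun t => S.dilate s (c (s * t))) X (Icc 0 T') := by
  intro t ht
  have hmaps : MapsTo (fun t : ℝ => s * t) (Icc 0 T') (Icc 0 T) := fun t ht =>
    ⟨mul_nonneg hs ht.1, (mul_le_mul_of_nonneg_left ht.2 hs).trans hT⟩
  have h1 : HasMFDerivWithinAt 𝓘(ℝ, ℝ) 𝓘(ℝ, ℝ) (fun t : ℝ => s * t) (Icc 0 T') t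
      (s • ContinuousLinearMap.id ℝ ℝ : ℝ →L[ℝ] ℝ) :=
    ((hasFDerivAt_id t).const_mul s).hasMFDerivAt.hasMFDerivWithinAt
  have h2 := HasMFDerivWithinAt.comp t (hc (s * t) (hmaps ht)) h1 hmaps
  have h3 : HasMFDerivAt S.model S.model (S.dilate s) (c (s * t)) _ :=
    ((S.contMDiff_dilate s).mdifferentiableAt (by simp)).hasMFDerivAt_modelDeriv
  have h4 := HasMFDerivAt.comp_hasMFDerivWithinAt t h3 h2
  -- The inner factor `s` of the chain rule is the scalar in the homogeneity identity.
  refine h4.congr_mfderiv (ContinuousLinearMap.ext_ring ?_)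
  change modelDeriv S.model S.model (S.dilate s) (c (s * t))
    ((s * 1 : ℝ) • (show EZ × VertModel EM EN from X (c (s * t)))) =
      (1 : ℝ) • (show EZ × VertModel EM EN from X (S.dilate s (c (s * t))))
  rw [mul_one, one_smul, map_smul]
  exact (hX _).symm

theorem contMDiff_zero : ContMDiff 𝓘(ℝ, EZ) S.model ∞ (fun z => (⟨z, 0⟩ : S.Total)) := by
  intro z
  refine S.contMDiffAt_total_of_fibCoord contMDiffAt_id ?_
  have h : (fun x : Z => S.fibCoord z ⟨x, 0⟩) = fun _ => 0 := funext fun x => map_zero _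
  rw [h]
  exact contMDiffAt_const

theorem vertLift_injective (p : S.Total) : Function.Injective (S.vertLift p) := by
  intro w w' h
  have hp := S.mem_trivSet p.1
  apply (S.bijective_trivMap hp).1
  rw [← S.modelDeriv_fibCoord_vertLift hp, h, S.modelDeriv_fibCoord_vertLift hp]

theorem vertLift_smul (p : S.Total) (r : ℝ) (w : S.Fiber p.1) :
    S.vertLift p (r • w) = r • S.vertLift p w := by
  have hp := S.mem_trivSet p.1
  refine S.tangent_ext hp ?_ ?_
  · rw [map_smul, modelDeriv_proj_vertLift, modelDeriv_proj_vertLift, smul_zero]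
  · rw [map_smul, S.modelDeriv_fibCoord_vertLift hp, S.modelDeriv_fibCoord_vertLift hp, map_smul]

end VertData

/-! ### The two splittings of tangent spaces along the zero and identity sections -/

namespace LieGroupoid

variable {EG : Type*} [NormedAddCommGroup EG] [NormedSpace ℝ EG]
  {G : Type*} [TopologicalSpace G] [ChartedSpace EG G]
  {EQ : Type*} [NormedAddCommGroup EQ] [NormedSpace ℝ EQ]
  {Q : Type*} [TopologicalSpace Q] [ChartedSpace EQ Q]
  (𝒢 : LieGroupoid EG G EQ Q)
  [IsManifold 𝓘(ℝ, EG) ∞ G] [IsManifold 𝓘(ℝ, EQ) ∞ Q]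
  [FiniteDimensional ℝ EG] [FiniteDimensional ℝ EQ]

theorem contMDiff_iota : ContMDiff 𝒢.A.model 𝒢.V.model ∞ 𝒢.iota := fun a =>
  𝒢.V.contMDiffAt_total (𝒢.contMDiff_one.comp 𝒢.A.contMDiff_totalProj).contMDiffAt
    (𝒢.A.contMDiff_incl a)

theorem iota_dilate (t : ℝ) (a : 𝒢.A.Total) : 𝒢.iota (𝒢.A.dilate t a) = 𝒢.V.dilate t (𝒢.iota a) :=
  rfl

theorem dilate_zeroVec (t : ℝ) (q : Q) : 𝒢.A.dilate t (𝒢.zeroVec q) = 𝒢.zeroVec q :=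
  congrArg (TotalSpace.mk q) (smul_zero t)

theorem dilate_zero (a : 𝒢.A.Total) : 𝒢.A.dilate 0 a = 𝒢.zeroVec a.1 :=
  congrArg (TotalSpace.mk a.1) (zero_smul ℝ a.2)

theorem contMDiff_zeroVec : ContMDiff 𝓘(ℝ, EQ) 𝒢.A.model ∞ 𝒢.zeroVec :=
  VertData.contMDiff_zero

theorem fiberLine_zeroVec (q : Q) (v : 𝒢.A.Fiber q) (t : ℝ) :
    𝒢.A.fiberLine (𝒢.zeroVec q) v t = 𝒢.A.dilate t ⟨q, v⟩ :=
  congrArg (TotalSpace.mk q) (zero_add (t • v))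

theorem vertVec_eq_vertLift (q : Q) (v : 𝒢.A.Fiber q) :
    𝒢.vertVec q v = 𝒢.A.vertLift (𝒢.zeroVec q) v :=
  congrArg (fun f : ℝ → 𝒢.A.Total => modelDeriv 𝓘(ℝ, ℝ) 𝒢.A.model f 0 1)
    (funext fun t => (𝒢.fiberLine_zeroVec q v t).symm)

theorem modelDeriv_proj_zeroVec (q : Q) (u : EQ) :
    modelDeriv 𝒢.A.model 𝓘(ℝ, EQ) (fun a : 𝒢.A.Total => a.1) (𝒢.zeroVec q)
      (modelDeriv 𝓘(ℝ, EQ) 𝒢.A.model 𝒢.zeroVec q u) = u := by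
  have h := modelDeriv_comp_apply (x := q) rfl (𝒢.A.mdifferentiableAt_totalProj (𝒢.zeroVec q))
    (𝒢.contMDiff_zeroVec.mdifferentiableAt (by simp)) u
  refine h.symm.trans ?_
  change modelDeriv 𝓘(ℝ, EQ) 𝓘(ℝ, EQ) (fun x : Q => x) q u = u
  rw [modelDeriv_id]; rfl

theorem modelDeriv_src_one (q : Q) (u : EQ) :
    modelDeriv 𝓘(ℝ, EG) 𝓘(ℝ, EQ) 𝒢.src (𝒢.one q)
      (modelDeriv 𝓘(ℝ, EQ) 𝓘(ℝ, EG) 𝒢.one q u) = u := by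
  have h := modelDeriv_comp_apply (x := q) (g := 𝒢.src) (I'' := 𝓘(ℝ, EQ)) rfl
    (𝒢.contMDiff_src.mdifferentiableAt (by simp))
    (𝒢.contMDiff_one.mdifferentiableAt (by simp)) u
  refine h.symm.trans ?_
  rw [show (fun x => 𝒢.src (𝒢.one x)) = fun x => x from funext 𝒢.src_one, modelDeriv_id]; rfl

theorem identAG_apply (q : Q) (p : TangentSpace 𝓘(ℝ, EQ) q × 𝒢.A.Fiber q) :
    (show EQ × VertModel EG EQ from 𝒢.identAG q p) =
      modelDeriv 𝓘(ℝ, EQ) 𝒢.A.model 𝒢.zeroVec q p.1 + 𝒢.A.vertLift (𝒢.zeroVec q) p.2 :=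
  congrArg (modelDeriv 𝓘(ℝ, EQ) 𝒢.A.model 𝒢.zeroVec q p.1 + ·) (𝒢.vertVec_eq_vertLift q p.2)

/-- The differential of the zero section is a right inverse of `Tτ`, and the vertical lifts make up
the kernel of `Tτ`. -/
theorem bijective_identAG (q : Q) : Function.Bijective (𝒢.identAG q) := by
  have hfst : ∀ p : TangentSpace 𝓘(ℝ, EQ) q × 𝒢.A.Fiber q,
      modelDeriv 𝒢.A.model 𝓘(ℝ, EQ) (fun a : 𝒢.A.Total => a.1) (𝒢.zeroVec q)
        (show EQ × VertModel EG EQ from 𝒢.identAG q p) = p.1 := by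
    rintro ⟨u, v⟩
    rw [identAG_apply, map_add]
    exact (congrArg₂ (· + ·) (𝒢.modelDeriv_proj_zeroVec q u)
      (𝒢.A.modelDeriv_proj_vertLift (𝒢.zeroVec q) v)).trans (add_zero u)
  constructor
  · intro p p' h
    have h1 : p.1 = p'.1 := (hfst p).symm.trans ((congrArg _ h).trans (hfst p'))
    refine Prod.ext h1 (VertData.vertLift_injective (𝒢.zeroVec q) ?_)
    have h2 := (𝒢.identAG_apply q p).symm.trans (Eq.trans h (𝒢.identAG_apply q p'))
    rw [h1] at h2
    exact add_left_cancel h2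
  · intro w
    obtain ⟨v, hv⟩ := 𝒢.A.exists_eq_vertLift (p := 𝒢.zeroVec q)
      (u := (show EQ × VertModel EG EQ from w) - modelDeriv 𝓘(ℝ, EQ) 𝒢.A.model 𝒢.zeroVec q
        (modelDeriv 𝒢.A.model 𝓘(ℝ, EQ) (fun a : 𝒢.A.Total => a.1) (𝒢.zeroVec q) w))
      (by rw [map_sub, 𝒢.modelDeriv_proj_zeroVec]; exact sub_self _)
    refine ⟨(modelDeriv 𝒢.A.model 𝓘(ℝ, EQ) (fun a : 𝒢.A.Total => a.1) (𝒢.zeroVec q) w, v), ?_⟩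
    refine (𝒢.identAG_apply q _).trans ?_
    rw [← hv]
    exact add_sub_cancel _ _

/-- The same splitting for `α ∘ ε = id`; the kernel of `Tα` at `ε(q)` is `A_q G` by definition. -/
theorem bijective_identG (q : Q) : Function.Bijective (𝒢.identG q) := by
  have hfst : ∀ p : TangentSpace 𝓘(ℝ, EQ) q × 𝒢.A.Fiber q,
      modelDeriv 𝓘(ℝ, EG) 𝓘(ℝ, EQ) 𝒢.src (𝒢.one q) (show EG from 𝒢.identG q p) = p.1 := by
    rintro ⟨u, v⟩
    refine (map_add (modelDeriv 𝓘(ℝ, EG) 𝓘(ℝ, EQ) 𝒢.src (𝒢.one q)) _ _).trans ?_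
    have hv : modelDeriv 𝓘(ℝ, EG) 𝓘(ℝ, EQ) 𝒢.src (𝒢.one q) (𝒢.A.fiberIncl q v) = 0 :=
      𝒢.A.mfderiv_fiberIncl q v
    exact (congrArg₂ (· + ·) (𝒢.modelDeriv_src_one q u) hv).trans (add_zero u)
  constructor
  · intro p p' h
    have h1 : p.1 = p'.1 := (hfst p).symm.trans ((congrArg _ h).trans (hfst p'))
    refine Prod.ext h1 (𝒢.A.fiberIncl_injective q ?_)
    simp only [identG, h1] at h
    exact add_left_cancel h
  · intro w
    let u : EQ := modelDeriv 𝓘(ℝ, EG) 𝓘(ℝ, EQ) 𝒢.src (𝒢.one q) w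
    let z : EG := (show EG from w) - modelDeriv 𝓘(ℝ, EQ) 𝓘(ℝ, EG) 𝒢.one q u
    have hz : modelDeriv 𝓘(ℝ, EG) 𝓘(ℝ, EQ) 𝒢.src (𝒢.one q) z = 0 := by
      refine (map_sub (modelDeriv 𝓘(ℝ, EG) 𝓘(ℝ, EQ) 𝒢.src (𝒢.one q)) (show EG from w) _).trans ?_
      rw [𝒢.modelDeriv_src_one]
      exact sub_self _
    exact ⟨(u, ⟨z, hz⟩), add_sub_cancel (modelDeriv 𝓘(ℝ, EQ) 𝓘(ℝ, EG) 𝒢.one q u) w⟩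

variable {𝒢}

/-! ### The exponential map and its differential at zero vectors -/

section Exponential

variable {Γ : 𝒢.A.VField} {X : 𝒢.V.VField}

theorem IsLift.contMDiff_one (hX : 𝒢.IsLift Γ X) : ContMDiff 𝒢.V.model 𝒢.V.model.tangent 1
    fun p => (⟨p, X p⟩ : TangentBundle 𝒢.V.model 𝒢.V.Total) :=
  ContMDiff.of_le hX.sode.smooth (by simp)

/-- `exp` is defined by a chosen integral curve. Uniqueness, on the Hausdorff total space, frees it
from that choice. -/
theorem IsLift.exp_eq [T2Space G] (hX : 𝒢.IsLift Γ X) {v : 𝒢.A.Total} {c : ℝ → 𝒢.V.Total}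
    (h0 : c 0 = 𝒢.iota v) (hc : IsMIntegralCurveOn c X (Icc 0 1)) : 𝒢.exp X v = (c 1).1 := by
  have := 𝒢.V.t2Space_total
  have := 𝒢.V.isManifold_total_one
  have : CompleteSpace EG := FiniteDimensional.complete ℝ EG
  have hv : v ∈ 𝒢.expDomain X := ⟨c, h0, hc⟩
  obtain ⟨h1, h2⟩ := hv.choose_spec
  rw [exp, dif_pos hv]
  exact congrArg (fun p : 𝒢.V.Total => p.1) (IsMIntegralCurveOn.eqOn_Icc hX.contMDiff_one h2 hc
    (h1.trans h0.symm) (right_mem_Icc.2 zero_le_one))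

theorem IsLift.isOpen_expDomain [T2Space G] (hX : 𝒢.IsLift Γ X) : IsOpen (𝒢.expDomain X) := by
  have := 𝒢.V.t2Space_total
  have := 𝒢.V.isManifold_total_one
  have : CompleteSpace EG := FiniteDimensional.complete ℝ EG
  exact (isOpen_setOf_exists_isMIntegralCurveOn_Icc hX.contMDiff_one).preimage
    𝒢.contMDiff_iota.continuous

/-- Homogeneity with `s = 0`: the dilation by `0` fixes the zero vector, and the right-hand side
vanishes. -/
theorem IsLift.apply_iota_zeroVec (hX : 𝒢.IsLift Γ X) (hΓ : 𝒢.IsSODE Γ)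
    (hq : 𝒢.A.IsHomogeneousQuadratic Γ) (q : Q) : X (𝒢.iota (𝒢.zeroVec q)) = 0 := by
  have h := hX.apply_dilate hΓ hq (𝒢.iota (𝒢.zeroVec q)) le_rfl
  rw [zero_smul] at h
  have h2 : 𝒢.V.dilate 0 (𝒢.iota (𝒢.zeroVec q)) = 𝒢.iota (𝒢.zeroVec q) := by
    rw [← iota_dilate, dilate_zeroVec]
  rwa [h2] at h

theorem IsLift.isMIntegralCurveOn_const (hX : 𝒢.IsLift Γ X) (hΓ : 𝒢.IsSODE Γ)
    (hq : 𝒢.A.IsHomogeneousQuadratic Γ) (q : Q) :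
    IsMIntegralCurveOn (fun _ => 𝒢.iota (𝒢.zeroVec q)) X (Icc 0 1) :=
  (isMIntegralCurve_const (hX.apply_iota_zeroVec hΓ hq q)).isMIntegralCurveOn _

theorem IsLift.zeroVec_mem_expDomain (hX : 𝒢.IsLift Γ X) (hΓ : 𝒢.IsSODE Γ)
    (hq : 𝒢.A.IsHomogeneousQuadratic Γ) (q : Q) : 𝒢.zeroVec q ∈ 𝒢.expDomain X :=
  ⟨_, rfl, hX.isMIntegralCurveOn_const hΓ hq q⟩

theorem IsLift.exp_zeroVec [T2Space G] (hX : 𝒢.IsLift Γ X) (hΓ : 𝒢.IsSODE Γ)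
    (hq : 𝒢.A.IsHomogeneousQuadratic Γ) (q : Q) : 𝒢.exp X (𝒢.zeroVec q) = 𝒢.one q :=
  hX.exp_eq rfl (hX.isMIntegralCurveOn_const hΓ hq q)

/-- The integral curve through a dilated initial velocity. -/
theorem IsLift.isMIntegralCurveOn_dilate (hX : 𝒢.IsLift Γ X) (hΓ : 𝒢.IsSODE Γ)
    (hq : 𝒢.A.IsHomogeneousQuadratic Γ) {c : ℝ → 𝒢.V.Total} {T s : ℝ} (hs : 0 ≤ s) (hT : s ≤ T)
    (hc : IsMIntegralCurveOn c X (Icc 0 T)) :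
    IsMIntegralCurveOn (fun t => 𝒢.V.dilate s (c (s * t))) X (Icc 0 1) :=
  VertData.isMIntegralCurveOn_dilate (fun p => hX.apply_dilate hΓ hq p hs) hs
    (by rwa [_root_.mul_one]) hc

theorem IsLift.dilate_mem_expDomain (hX : 𝒢.IsLift Γ X) (hΓ : 𝒢.IsSODE Γ)
    (hq : 𝒢.A.IsHomogeneousQuadratic Γ) {v : 𝒢.A.Total} (hv : v ∈ 𝒢.expDomain X) {t : ℝ}
    (ht : t ∈ Icc (0 : ℝ) 1) : 𝒢.A.dilate t v ∈ 𝒢.expDomain X := by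
  obtain ⟨c, h0, hc⟩ := hv
  refine ⟨_, ?_, hX.isMIntegralCurveOn_dilate hΓ hq ht.1 ht.2 hc⟩
  rw [mul_zero, h0, iota_dilate]

/-- The curve is required only on `[0, T]`, and `T` may be less than `1`. A short-time local flow
thus already computes `exp` on small vectors. -/
theorem IsLift.exp_dilate [T2Space G] (hX : 𝒢.IsLift Γ X) (hΓ : 𝒢.IsSODE Γ)
    (hq : 𝒢.A.IsHomogeneousQuadratic Γ) {v : 𝒢.A.Total} {c : ℝ → 𝒢.V.Total}
    {T s : ℝ} (hs : 0 ≤ s) (hT : s ≤ T) (h0 : c 0 = 𝒢.iota v)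
    (hc : IsMIntegralCurveOn c X (Icc 0 T)) : 𝒢.exp X (𝒢.A.dilate s v) = (c s).1 := by
  have h := hX.exp_eq (v := 𝒢.A.dilate s v) (by rw [mul_zero, h0, iota_dilate])
    (hX.isMIntegralCurveOn_dilate hΓ hq hs hT hc)
  rw [_root_.mul_one] at h
  exact h

/-- Near `0_q` the map is `v ↦ τ̃(Φ_ε(ι(v/ε)))`, and `Φ_ε` is differentiable at the equilibrium
`ι(0_q)`. -/
theorem IsLift.mdifferentiableAt_exp [T2Space G] (hX : 𝒢.IsLift Γ X) (hΓ : 𝒢.IsSODE Γ)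
    (hq : 𝒢.A.IsHomogeneousQuadratic Γ) (q : Q) :
    MDifferentiableAt 𝒢.A.model 𝓘(ℝ, EG) (𝒢.exp X) (𝒢.zeroVec q) := by
  have := 𝒢.V.isManifold_total_one
  have : CompleteSpace EG := FiniteDimensional.complete ℝ EG
  obtain ⟨ε, hε, Φ, hΦ, hΦ0⟩ := exists_local_flow (𝒢.iota (𝒢.zeroVec q))
    hX.contMDiff_one.contMDiffAt
  obtain ⟨-, hd⟩ := hΦ0 (hX.apply_iota_zeroVec hΓ hq q)
  let f : 𝒢.A.Total → 𝒢.V.Total := fun v => 𝒢.iota (𝒢.A.dilate ε⁻¹ v)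
  have hf : ContMDiff 𝒢.A.model 𝒢.V.model ∞ f := 𝒢.contMDiff_iota.comp (𝒢.A.contMDiff_dilate _)
  have hf0 : f (𝒢.zeroVec q) = 𝒢.iota (𝒢.zeroVec q) := by
    simp only [f, dilate_zeroVec]
  have hev : ∀ᶠ v in 𝓝 (𝒢.zeroVec q), 𝒢.exp X v = (Φ (f v) ε).1 := by
    have ht : Tendsto f (𝓝 (𝒢.zeroVec q)) (𝓝 (𝒢.iota (𝒢.zeroVec q))) := by
      have := hf.continuous.tendsto (𝒢.zeroVec q)
      rwa [hf0] at this
    filter_upwards [ht.eventually hΦ] with v hv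
    have h := hX.exp_dilate hΓ hq hε.le le_rfl hv.1 hv.2.1
    rwa [VertData.dilate_dilate, mul_inv_cancel₀ hε.ne', VertData.dilate_one] at h
  have h1 : MDifferentiableAt 𝒢.A.model 𝒢.V.model (fun v => Φ (f v) ε) (𝒢.zeroVec q) :=
    MDifferentiableAt.comp (g := fun p => Φ p ε) (𝒢.zeroVec q) (by rw [hf0]; exact hd)
      (hf.mdifferentiableAt (by simp))
  have h2 : MDifferentiableAt 𝒢.A.model 𝓘(ℝ, EG) (fun v => (Φ (f v) ε).1) (𝒢.zeroVec q) :=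
    MDifferentiableAt.comp (I' := 𝒢.V.model) (g := fun p : 𝒢.V.Total => p.1) (𝒢.zeroVec q)
      (𝒢.V.mdifferentiableAt_totalProj _) h1
  exact h2.congr_of_eventuallyEq hev

theorem fiberIncl_iota (a : 𝒢.A.Total) :
    (show EG from 𝒢.V.fiberIncl (𝒢.iota a).1 (𝒢.iota a).2) = 𝒢.A.fiberIncl a.1 a.2 := rfl

/-- The initial velocity of the projection of an integral curve. -/
theorem IsLift.hasMFDerivWithinAt_proj (hX : 𝒢.IsLift Γ X) {a : 𝒢.A.Total} {c : ℝ → 𝒢.V.Total}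
    (h0 : c 0 = 𝒢.iota a) (hc : IsMIntegralCurveOn c X (Icc 0 1)) :
    HasMFDerivWithinAt 𝓘(ℝ, ℝ) 𝓘(ℝ, EG) (fun t => (c t).1) (Icc 0 1) 0
      (ContinuousLinearMap.toSpanSingleton ℝ (show EG from 𝒢.A.fiberIncl a.1 a.2) :
        ℝ →L[ℝ] EG) := by
  have h2 := HasMFDerivAt.comp_hasMFDerivWithinAt (0 : ℝ)
    ((𝒢.V.mdifferentiableAt_totalProj (c 0)).hasMFDerivAt_modelDeriv)
    (hc 0 (left_mem_Icc.2 zero_le_one))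
  refine h2.congr_mfderiv (ContinuousLinearMap.ext_ring ?_)
  have h3 : modelDeriv 𝒢.V.model 𝓘(ℝ, EG) (fun p : 𝒢.V.Total => p.1) (c 0) (X (c 0)) =
      (show EG from 𝒢.A.fiberIncl a.1 a.2) := by
    rw [hX.modelDeriv_proj, h0]
    exact fiberIncl_iota a
  change modelDeriv 𝒢.V.model 𝓘(ℝ, EG) (fun p : 𝒢.V.Total => p.1) (c 0)
    ((1 : ℝ) • (show EG × VertModel EG EQ from X (c 0))) =
      (1 : ℝ) • (show EG from 𝒢.A.fiberIncl a.1 a.2)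
  rw [one_smul, one_smul]
  exact h3

theorem IsLift.modelDeriv_exp_vertLift_of_mem [T2Space G] (hX : 𝒢.IsLift Γ X) (hΓ : 𝒢.IsSODE Γ)
    (hq : 𝒢.A.IsHomogeneousQuadratic Γ) {q : Q}
    {v : 𝒢.A.Fiber (𝒢.zeroVec q).1} (hv : (⟨q, v⟩ : 𝒢.A.Total) ∈ 𝒢.expDomain X) :
    modelDeriv 𝒢.A.model 𝓘(ℝ, EG) (𝒢.exp X) (𝒢.zeroVec q) (𝒢.A.vertLift (𝒢.zeroVec q) v) =
      (show EG from 𝒢.A.fiberIncl q v) := by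
  obtain ⟨c, h0, hc⟩ := hv
  have hd : MDifferentiableAt 𝒢.A.model 𝓘(ℝ, EG) (𝒢.exp X)
      (𝒢.A.fiberLine (𝒢.zeroVec q) v 0) := by
    rw [𝒢.A.fiberLine_zero]
    exact hX.mdifferentiableAt_exp hΓ hq q
  have hh : MDifferentiableAt 𝓘(ℝ, ℝ) 𝓘(ℝ, EG)
      (fun t => 𝒢.exp X (𝒢.A.fiberLine (𝒢.zeroVec q) v t)) 0 :=
    MDifferentiableAt.comp (g := 𝒢.exp X) (0 : ℝ) hd
      ((𝒢.A.contMDiff_fiberLine _ v).mdifferentiableAt (by simp))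
  rw [𝒢.A.modelDeriv_vertLift (hX.mdifferentiableAt_exp hΓ hq q)]
  -- The ray agrees with the trajectory only for `t ∈ [0, 1]`, so the derivatives are compared
  -- within that interval, where they are still unique at `0`.
  have h1 := hh.hasMFDerivAt_modelDeriv.hasMFDerivWithinAt (s := Icc (0 : ℝ) 1)
  have h2 := hX.hasMFDerivWithinAt_proj h0 hc
  have h3 : ∀ t ∈ Icc (0 : ℝ) 1, 𝒢.exp X (𝒢.A.fiberLine (𝒢.zeroVec q) v t) = (c t).1 := by
    intro t ht
    exact (congrArg (𝒢.exp X) (𝒢.fiberLine_zeroVec q v t)).trans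
      (hX.exp_dilate hΓ hq ht.1 ht.2 h0 hc)
  have h4 := HasMFDerivWithinAt.congr_mono h2 h3 (h3 0 (left_mem_Icc.2 zero_le_one)) Subset.rfl
  have h5 : UniqueMDiffWithinAt 𝓘(ℝ, ℝ) (Icc (0 : ℝ) 1) 0 :=
    ((uniqueDiffOn_Icc zero_lt_one).uniqueDiffWithinAt
      (left_mem_Icc.2 zero_le_one)).uniqueMDiffWithinAt
  have h6 := congrArg (fun L : ℝ →L[ℝ] EG => L 1) (h5.eq h1 h4)
  exact h6.trans (one_smul ℝ _)

/-- The domain is a neighbourhood of `0_q`, so it contains a small positive multiple of `v`; both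
sides are homogeneous in `v`. -/
theorem IsLift.modelDeriv_exp_vertLift [T2Space G] (hX : 𝒢.IsLift Γ X) (hΓ : 𝒢.IsSODE Γ)
    (hq : 𝒢.A.IsHomogeneousQuadratic Γ) (q : Q) (v : 𝒢.A.Fiber q) :
    modelDeriv 𝒢.A.model 𝓘(ℝ, EG) (𝒢.exp X) (𝒢.zeroVec q) (𝒢.A.vertLift (𝒢.zeroVec q) v) =
      (show EG from 𝒢.A.fiberIncl q v) := by
  have hc : ContinuousAt (fun t : ℝ => 𝒢.A.dilate t ⟨q, v⟩) 0 :=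
    (𝒢.A.contMDiff_dilate_left ⟨q, v⟩).continuous.continuousAt
  have hev : ∀ᶠ t in 𝓝 (0 : ℝ), 𝒢.A.dilate t ⟨q, v⟩ ∈ 𝒢.expDomain X :=
    hc.eventually_mem (hX.isOpen_expDomain.mem_nhds (by
      rw [dilate_zero]; exact hX.zeroVec_mem_expDomain hΓ hq q))
  obtain ⟨δ, hδ, hδD⟩ := Metric.eventually_nhds_iff.1 hev
  have hmem := hδD (y := δ / 2) (by
    rw [Real.dist_eq, sub_zero, abs_of_pos (half_pos hδ)]; exact half_lt_self hδ)
  have h := hX.modelDeriv_exp_vertLift_of_mem hΓ hq (q := q) (v := (δ / 2) • v) hmem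
  have h1 : 𝒢.A.vertLift (𝒢.zeroVec q) ((δ / 2) • v) = (δ / 2) • 𝒢.A.vertLift (𝒢.zeroVec q) v :=
    VertData.vertLift_smul (𝒢.zeroVec q) (δ / 2) v
  rw [h1, map_smul] at h
  refine smul_right_injective EG (half_pos hδ).ne' (h.trans ?_)
  exact map_smul (𝒢.A.fiberIncl q) (δ / 2) v

/-- The two summands are treated separately: the chain rule for `exp ∘ 0 = ε` along the zero
section, and the trajectories in the fibre direction. -/
theorem IsLift.modelDeriv_exp_identAG [T2Space G] (hX : 𝒢.IsLift Γ X) (hΓ : 𝒢.IsSODE Γ)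
    (hq : 𝒢.A.IsHomogeneousQuadratic Γ) (q : Q) (p : TangentSpace 𝓘(ℝ, EQ) q × 𝒢.A.Fiber q) :
    modelDeriv 𝒢.A.model 𝓘(ℝ, EG) (𝒢.exp X) (𝒢.zeroVec q)
      (show EQ × VertModel EG EQ from 𝒢.identAG q p) = (show EG from 𝒢.identG q p) := by
  obtain ⟨u, v⟩ := p
  have h := modelDeriv_comp_apply (x := q) rfl (hX.mdifferentiableAt_exp hΓ hq q)
    (𝒢.contMDiff_zeroVec.mdifferentiableAt (by simp)) u
  rw [show (fun x => 𝒢.exp X (𝒢.zeroVec x)) = 𝒢.one from funext (hX.exp_zeroVec hΓ hq)] at h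
  rw [identAG_apply, map_add]
  exact congrArg₂ (· + ·) h.symm (hX.modelDeriv_exp_vertLift hΓ hq q v)

end Exponential

end LieGroupoid

theorem proposition4p3
    {EG : Type*} [NormedAddCommGroup EG] [NormedSpace ℝ EG] [FiniteDimensional ℝ EG]
    {G : Type*} [TopologicalSpace G] [ChartedSpace EG G] [IsManifold 𝓘(ℝ, EG) ∞ G] [T2Space G]
    {EQ : Type*} [NormedAddCommGroup EQ] [NormedSpace ℝ EQ] [FiniteDimensional ℝ EQ]
    {Q : Type*} [TopologicalSpace Q] [ChartedSpace EQ Q] [IsManifold 𝓘(ℝ, EQ) ∞ Q] [T2Space Q]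
    (𝒢 : LieGroupoid EG G EQ Q) (Γ : 𝒢.A.VField) (hΓ : 𝒢.IsSODE Γ)
    (hquad : 𝒢.A.IsHomogeneousQuadratic Γ) :
    (∃! X : 𝒢.V.VField, 𝒢.IsLift Γ X) ∧
    ∀ X : 𝒢.V.VField, 𝒢.IsLift Γ X →
      (IsOpen (𝒢.expDomain X) ∧ (∀ q, 𝒢.zeroVec q ∈ 𝒢.expDomain X) ∧
        ∀ v ∈ 𝒢.expDomain X, ∀ t ∈ Icc (0 : ℝ) 1, 𝒢.A.dilate t v ∈ 𝒢.expDomain X) ∧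
      (∀ q, 𝒢.exp X (𝒢.zeroVec q) = 𝒢.one q) ∧
      (∀ v ∈ 𝒢.expDomain X, ∀ σ : ℝ → G, 𝒢.IsTrajectory X (𝒢.iota v) σ →
        ∀ t ∈ Icc (0 : ℝ) 1, 𝒢.exp X (𝒢.A.dilate t v) = σ t) ∧
      ∀ q : Q,
        Function.Bijective (𝒢.identAG q) ∧ Function.Bijective (𝒢.identG q) ∧
        ∃ L : TangentSpace 𝒢.A.model (𝒢.zeroVec q) →L[ℝ] TangentSpace 𝓘(ℝ, EG) (𝒢.one q),
          HasMFDerivAt 𝒢.A.model 𝓘(ℝ, EG) (𝒢.exp X) (𝒢.zeroVec q) L ∧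
          ∀ p : TangentSpace 𝓘(ℝ, EQ) q × 𝒢.A.Fiber q, L (𝒢.identAG q p) = 𝒢.identG q p := by
  refine ⟨hΓ.existsUnique_isLift, fun X hX => ⟨⟨hX.isOpen_expDomain,
    hX.zeroVec_mem_expDomain hΓ hquad, fun v hv t ht => hX.dilate_mem_expDomain hΓ hquad hv ht⟩,
    hX.exp_zeroVec hΓ hquad, ?_, fun q => ⟨𝒢.bijective_identAG q, 𝒢.bijective_identG q,
      (show EQ × VertModel EG EQ →L[ℝ] EG from
        modelDeriv 𝒢.A.model 𝓘(ℝ, EG) (𝒢.exp X) (𝒢.zeroVec q)),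
      (hX.mdifferentiableAt_exp hΓ hquad q).hasMFDerivAt_modelDeriv,
      hX.modelDeriv_exp_identAG hΓ hquad q⟩⟩⟩
  rintro v - σ ⟨c, h0, hc, hσ⟩ t ht
  rw [hσ t ht]
  exact hX.exp_dilate hΓ hquad ht.1 ht.2 h0 hc
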